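/- Let $G$ be a Lie group with Lie algebra $\mathfrak g$, let $c$ be an $\mathrm{Ad}(G)$-invariant non-degenerate symmetric bilinear form on $\mathfrak g$, and let $P\to M$ be a smooth principal $G$-bundle over a smooth manifold $M$. Write $\operatorname{ad}P=P\times_G\mathfrak g$, with its induced fibrewise bracket $[\cdot,\cdot]$ and pairing $c$. Let $\theta$ be a connection on $P$, with covariant derivative $d^\theta$ on $\operatorname{ad}P$ and curvature $F\in\Omega^2(\operatorname{ad}P)$, and let $H\in\Omega^3(M)$ satisfy $dH=c(F\wedge F)$. Equip $E=T\oplus\operatorname{ad}P\oplus T^*$ (with $T=TM$) with the pairing $$\langle X+r+\xi,Y+t+\eta\rangle=\tfrac12(\eta(X)+\xi(Y))+c(r,t)$$ and the Dorfman bracket $$\begin{aligned}[X+r+\xi,Y+t+\eta]={}&[X,Y]-[r,t]-F(X,Y)+d^\theta_Xt-d^\theta_Yr\\&+\mathcal L_X\eta-i_Yd\xi+i_Yi_XH+2c(d^\theta r,t)+2c(F(X,\cdot),t)-2c(F(Y,\cdot),r).\end{aligned}$$ Let $\operatorname{Aut}(E)$ be the group of vector bundle automorphisms of $E$, covering arbitrary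 diffeomorphisms of $M$, that preserve the pairing and the bracket. Let $\operatorname{Aut}(\operatorname{ad}P,c,[\cdot,\cdot])$ be the group of vector bundle automorphisms $\nu$ of $\operatorname{ad}P$, covering diffeomorphisms $\check f$ of $M$, that preserve the fibrewise pairing and bracket. For such a $\nu$, for $B\in\Omega^2(M)$ and for $a\in\Omega^1(\operatorname{ad}P)$, put $$f_\nu(X+r+\xi)=d\check f(X)+\nu(r)+(d\check f^*)^{-1}\xi,$$ $$(B,a)(X+r+\xi)=X+(a(X)+r)+\big(\xi+i_XB-c(a(X),a)-2c(a,r)\big),$$ and $f_\nu(B,a)=f_\nu\circ(B,a)$. The automorphism $\nu$ acts on sections of $\operatorname{ad}P$ by $(\nu\cdot r)(x)=\nu(r(\check f^{-1}(x)))$, and $$(\nu\cdot d^{\theta+a})_Vr=\nu\cdot\big(d^{\theta+a}_{\check f^*V}(\nu^{-1}\cdot r)\big),\qquad(\nu\cdot F_{\theta+a})(V,W)=\nu\cdot\big(F_{\theta+a}(\check f^*V,\check f^*W)\big),$$ where $\check f^*V=d\check f^{-1}(V\circ\check f)$. Here $$d^{\theta+a}_Vr=d^\theta_Vr+[a(V),r],\qquad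 F_{\theta+a}=F+d^\theta a+\tfrac12[a,a],\qquad[a,a](V,W)=2[a(V),a(W)]$$ are the covariant derivative and the curvature of the connection $\theta+a$. All wedge products and exterior derivatives are normalized without factorial factors, so that $(\alpha\wedge\beta)(V,W)=\alpha(V)\beta(W)-\alpha(W)\beta(V)$ for one-forms. Then $\operatorname{Aut}(E)$ is exactly the set of transformations $f_\nu(B,a)$ with $\nu\in\operatorname{Aut}(\operatorname{ad}P,c,[\cdot,\cdot])$, $B\in\Omega^2(M)$ and $a\in\Omega^1(\operatorname{ad}P)$ such that $$d^\theta=\nu\cdot d^{\theta+a},\qquad F=\nu\cdot F_{\theta+a},$$ $$\check f^*H=H-dB+2c(a\wedge F)+c(a\wedge d^\theta a)+\tfrac13c(a\wedge[a,a]).$$ Moreover, if $f=f_\nu(B,a)$ and $f'=f_{\nu'}(B',a')$ are elements of $\operatorname{Aut}(E)$ written in this way, with $\nu'$ covering $\check f'$, then $$f\circ f'=f_{\nu\nu'}\big(\check f'^*B+B'+c((\nu'^{-1}\cdot a)\wedge a'),\ \nu'^{-1}\cdot a+a'\big),$$ where $(\nu'^{-1}\cdot a)_x=\nu'^{-1}\circ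 a_{\check f'(x)}\circ d\check f'_x$. -/

import Mathlib

open scoped Manifold ContDiff Topology
open VectorField

set_option linter.unusedSectionVars false

namespace TransitiveCourant

noncomputable section Forms

variable {E M : Type*} [NormedAddCommGroup E] [NormedSpace ℝ E] [FiniteDimensional ℝ E]
  [TopologicalSpace M] [ChartedSpace E M]

instance tangentFinite (x : M) : FiniteDimensional ℝ (TangentSpace 𝓘(ℝ, E) x) :=
  inferInstanceAs (FiniteDimensional ℝ E)

instance tangentT2 (x : M) : T2Space (TangentSpace 𝓘(ℝ, E) x) := inferInstanceAs (T2Space E)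

instance lieGroupThree {G : Type*} [Group G] [TopologicalSpace G] [ChartedSpace E G]
    [LieGroup 𝓘(ℝ, E) ∞ G] : LieGroup 𝓘(ℝ, E) (minSmoothness ℝ 3) G := by
  rw [minSmoothness_of_isRCLikeNormedField]; infer_instance

variable {G : Type*} [Group G] [TopologicalSpace G] [ChartedSpace E G] [LieGroup 𝓘(ℝ, E) ∞ G] 

/-- The adjoint action of a Lie group on its Lie algebra. -/
def Ad (g : G) : GroupLieAlgebra 𝓘(ℝ, E) G →L[ℝ] GroupLieAlgebra 𝓘(ℝ, E) G :=
  mfderiv 𝓘(ℝ, E) 𝓘(ℝ, E) (fun h : G => g * h * g⁻¹) 1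

theorem contMDiff_conj (g : G) : ContMDiff 𝓘(ℝ, E) 𝓘(ℝ, E) ∞ (fun h : G => g * h * g⁻¹) :=
  (contMDiff_const.mul contMDiff_id).mul contMDiff_const

theorem mfderiv_mul_eq (g h : G) (v : GroupLieAlgebra 𝓘(ℝ, E) G) :
    mfderiv 𝓘(ℝ, E) 𝓘(ℝ, E) (fun h : G => g * h * g⁻¹) h (mulInvariantVectorField v h) =
      mulInvariantVectorField (Ad g v) (g * h * g⁻¹) := by
  have e : (fun h : G => g * h * g⁻¹) ∘ (fun k => h * k) =
    (fun k => (g * h * g⁻¹) * k) ∘ (fun h : G => g * h * g⁻¹) := by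
    funext k; simp [mul_assoc]
  have d1 : ∀ k : G, MDifferentiableAt 𝓘(ℝ, E) 𝓘(ℝ, E) (fun h : G => g * h * g⁻¹) k :=
    fun k => (contMDiff_conj g).mdifferentiableAt (by simp)
  have d2 : ∀ a k : G, MDifferentiableAt 𝓘(ℝ, E) 𝓘(ℝ, E) (fun h : G => a * h) k :=
    fun a k => (contMDiff_const.mul contMDiff_id : ContMDiff 𝓘(ℝ, E) 𝓘(ℝ, E) ∞ (fun h : G => a * h)).mdifferentiableAt (by simp)
  have h1 := mfderiv_comp (I' := 𝓘(ℝ, E)) (1 : G) (d1 (h * 1)) (d2 h 1)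
  have h2 := mfderiv_comp (I' := 𝓘(ℝ, E)) (1 : G) (d2 (g * h * g⁻¹) (g * 1 * g⁻¹)) (d1 1)
  rw [e, h2] at h1
  have h3 := congrArg (fun L => L v) h1
  have key : ∀ (y : G) (hy : y = h) (z : G) (hz : z = 1) ,
    mfderiv 𝓘(ℝ, E) 𝓘(ℝ, E) (fun k => (g * h * g⁻¹) * k) z (Ad g v) = 
    mfderiv 𝓘(ℝ, E) 𝓘(ℝ, E) (fun h : G => g * h * g⁻¹) y (mulInvariantVectorField v h) → 
    mfderiv 𝓘(ℝ, E) 𝓘(ℝ, E) (fun h : G => g * h * g⁻¹) h (mulInvariantVectorField v h) =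
      mulInvariantVectorField (Ad g v) (g * h * g⁻¹) := by
    rintro y rfl z rfl hh
    exact hh.symm
  exact key (h * 1) (by simp) (g * 1 * g⁻¹) (by simp) h3

theorem Ad_lie (g : G) (v w : GroupLieAlgebra 𝓘(ℝ, E) G) : Ad g ⁅v, w⁆ = ⁅Ad g v, Ad g w⁆ := by
  have inv : ∀ h : G, (mfderiv 𝓘(ℝ, E) 𝓘(ℝ, E) (fun h : G => g * h * g⁻¹) h).IsInvertible := by
    intro h
    let Φ : G ≃ₘ^∞⟮𝓘(ℝ, E), 𝓘(ℝ, E)⟯ G :=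
      { toFun := fun h => g * h * g⁻¹
        invFun := fun h => g⁻¹ * h * g
        left_inv := fun h => by simp [mul_assoc]
        right_inv := fun h => by simp [mul_assoc]
        contMDiff_toFun := contMDiff_conj g
        contMDiff_invFun := by simpa using contMDiff_conj g⁻¹ }
    exact ⟨Φ.mfderivToContinuousLinearEquiv (by simp) h, rfl⟩
  have pb : ∀ v : GroupLieAlgebra 𝓘(ℝ, E) G, mpullback 𝓘(ℝ, E) 𝓘(ℝ, E) (fun h : G => g * h * g⁻¹)
      (mulInvariantVectorField (Ad g v)) = mulInvariantVectorField v := by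
    intro v
    funext h
    obtain ⟨L, hL⟩ := inv h
    have := mfderiv_mul_eq g h v
    rw [← hL] at this
    simp only [mpullback]
    rw [← hL, ContinuousLinearMap.inverse_equiv, ← this]
    simp
  have h := mpullback_mlieBracket (I := 𝓘(ℝ, E)) (I' := 𝓘(ℝ, E)) (n := ∞) (x₀ := (1 : G))
    (f := fun h : G => g * h * g⁻¹)
    (V := mulInvariantVectorField (Ad g v)) (W := mulInvariantVectorField (Ad g w))
    (mdifferentiableAt_mulInvariantVectorField _) (mdifferentiableAt_mulInvariantVectorField _)
    (contMDiff_conj g).contMDiffAt (by rw [minSmoothness_of_isRCLikeNormedField]; exact ENat.LEInfty.out)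
  rw [pb, pb] at h
  obtain ⟨L, hL⟩ := inv 1
  simp only [mpullback] at h
  rw [← hL, ContinuousLinearMap.inverse_equiv] at h
  have h' := congrArg L h
  simp only [ContinuousLinearEquiv.coe_coe, ContinuousLinearEquiv.apply_symm_apply] at h'
  have key : ∀ (y : G) (hy : y = 1),
    ((mlieBracket 𝓘(ℝ, E) (mulInvariantVectorField (Ad g v)) (mulInvariantVectorField (Ad g w)) y : E)
      = (Ad g ⁅v, w⁆ : E)) → Ad g ⁅v, w⁆ = ⁅Ad g v, Ad g w⁆ := by
    rintro y rfl h; exact h.symm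
  refine key (g * 1 * g⁻¹) (by simp) (h'.trans ?_)
  exact congrArg (fun T => T ⁅v, w⁆) hL

theorem Ad_mul (g h : G) (v : GroupLieAlgebra 𝓘(ℝ, E) G) : Ad (g * h) v = Ad g (Ad h v) := by
  have e : (fun k : G => g * h * k * (g * h)⁻¹) = (fun k : G => g * k * g⁻¹) ∘ (fun k : G => h * k * h⁻¹) := by
    funext k; simp [mul_assoc]
  have d1 : ∀ g k : G, MDifferentiableAt 𝓘(ℝ, E) 𝓘(ℝ, E) (fun h : G => g * h * g⁻¹) k :=
    fun g k => (contMDiff_conj g).mdifferentiableAt (by simp)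
  have h2 := mfderiv_comp (I' := 𝓘(ℝ, E)) (1 : G) (d1 g (h * 1 * h⁻¹)) (d1 h 1)
  rw [← e] at h2
  have h3 := congrArg (fun L => L v) h2
  have key : ∀ (y : G) (hy : y = 1), Ad (g * h) v = 
     mfderiv 𝓘(ℝ, E) 𝓘(ℝ, E) (fun h : G => g * h * g⁻¹) y (Ad h v) →  Ad (g * h) v = Ad g (Ad h v) := by
    rintro y rfl h; exact h
  exact key _ (by simp) h3

theorem Ad_one (v : GroupLieAlgebra 𝓘(ℝ, E) G) : Ad (1 : G) v = v := by
  have : (fun k : G => 1 * k * (1 : G)⁻¹) = id := by funext k; simp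
  have key : ∀ (f : G → G) (hf : f = id), (mfderiv 𝓘(ℝ, E) 𝓘(ℝ, E) f 1 v : E) = v := by
    rintro f rfl; simp [mfderiv_id]
  exact key _ this

variable {EP P : Type*} [NormedAddCommGroup EP] [NormedSpace ℝ EP] [FiniteDimensional ℝ EP]
  [TopologicalSpace P] [ChartedSpace EP P]
variable {W : Type*} [NormedAddCommGroup W] [NormedSpace ℝ W]

variable (E M) in
/-- (Not necessarily smooth) vector fields on `M`. -/
abbrev VecField := ∀ x : M, TangentSpace 𝓘(ℝ, E) x

/-- Smoothness of a vector field, as a section of the tangent bundle. -/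
def VecField.Smooth [IsManifold 𝓘(ℝ, E) ∞ M] (X : VecField E M) : Prop :=
  ContMDiff 𝓘(ℝ, E) 𝓘(ℝ, E).tangent ∞ (fun x => (⟨x, X x⟩ : TangentBundle 𝓘(ℝ, E) M))

variable (E M) in
/-- (Not necessarily smooth) differential `k`-forms on `M` with values in `W`. -/
abbrev VForm (k : ℕ) (W : Type*) [NormedAddCommGroup W] [NormedSpace ℝ W] :=
  ∀ x : M, TangentSpace 𝓘(ℝ, E) x [⋀^Fin k]→L[ℝ] W

/-- The expression of a form in the preferred chart at `x₀`: its pull-back under the inverse of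
the chart. -/
def VForm.inChart {k : ℕ} (α : VForm E M k W) (x₀ : M) (z : E) : E [⋀^Fin k]→L[ℝ] W :=
  (α ((extChartAt 𝓘(ℝ, E) x₀).symm z)).compContinuousLinearMap
    (mfderiv 𝓘(ℝ, E) 𝓘(ℝ, E) (extChartAt 𝓘(ℝ, E) x₀).symm z)

/-- The exterior derivative of a form, computed at `x` in the preferred chart at `x` (which is used
to identify the tangent space at `x` with `E`). -/
def VForm.extD {k : ℕ} (α : VForm E M k W) : VForm E M (k + 1) W := fun x =>
  (show E [⋀^Fin (k + 1)]→L[ℝ] W from extDeriv (α.inChart x) (extChartAt 𝓘(ℝ, E) x x))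

theorem VForm.apply_congr {k : ℕ} (α : VForm E M k W) {x y : M} (h : x = y) (v : Fin k → E) :
    (α x v : W) = α y v := by subst h; rfl

theorem VForm.extD_pullback [IsManifold 𝓘(ℝ, E) ∞ M] {k : ℕ} (α : VForm E M k W) (Φ : M → M) (u : M)
    (hΦ : ContMDiff 𝓘(ℝ, E) 𝓘(ℝ, E) ∞ Φ)
    (hα : DifferentiableAt ℝ (α.inChart (Φ u)) (extChartAt 𝓘(ℝ, E) (Φ u) (Φ u))) :
    VForm.extD (fun u => (α (Φ u)).compContinuousLinearMap (mfderiv 𝓘(ℝ, E) 𝓘(ℝ, E) Φ u)) u =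
      (α.extD (Φ u)).compContinuousLinearMap (mfderiv 𝓘(ℝ, E) 𝓘(ℝ, E) Φ u) := by
  set φ := extChartAt 𝓘(ℝ, E) u with hφ
  set φ' := extChartAt 𝓘(ℝ, E) (Φ u) with hφ'
  set ψ : E → E := φ' ∘ Φ ∘ φ.symm with hψ
  have hz : φ.symm (φ u) = u := φ.left_inv (mem_extChartAt_source u)
  have hψz : ψ (φ u) = φ' (Φ u) := by simp [hψ, hz]
  have hψs : ContDiffAt ℝ ∞ ψ (φ u) := by
    have := (contMDiffAt_iff.1 (hΦ.contMDiffAt (x := u))).2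
    simpa [contDiffWithinAt_univ, hψ, hφ, hφ'] using this
  have hd : (mfderiv 𝓘(ℝ, E) 𝓘(ℝ, E) Φ u : E →L[ℝ] E) = fderiv ℝ ψ (φ u) := by
    have := (hΦ.mdifferentiableAt (x := u) (by simp)).mfderiv
    rw [this]
    simp [writtenInExtChartAt, fderivWithin_univ, hψ, hφ, hφ']
    rfl
  have ev : VForm.inChart (fun u => (α (Φ u)).compContinuousLinearMap
      (mfderiv 𝓘(ℝ, E) 𝓘(ℝ, E) Φ u)) u =ᶠ[𝓝 (φ u)]
      fun z => ((α.inChart (Φ u)) (ψ z)).compContinuousLinearMap (fderiv ℝ ψ z) := by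
    have t1 : φ.target ∈ 𝓝 (φ u) := extChartAt_target_mem_nhds u
    have t2 : ∀ᶠ z in 𝓝 (φ u), Φ (φ.symm z) ∈ φ'.source := by
      have : ContinuousAt (fun z => Φ (φ.symm z)) (φ u) := by
        apply ContinuousAt.comp
        · exact hΦ.continuous.continuousAt
        · exact continuousAt_extChartAt_symm u
      apply this
      simp only [hz]
      exact extChartAt_source_mem_nhds (Φ u)
    filter_upwards [eventually_mem_nhds_iff.2 t1, t2.eventually_nhds] with z hz1 hz2
    have a1 : MDifferentiableAt 𝓘(ℝ, E) 𝓘(ℝ, E) φ.symm z :=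
      ((contMDiffOn_extChartAt_symm (n := ∞) u).contMDiffAt hz1).mdifferentiableAt (by simp)
    have a2 : MDifferentiableAt 𝓘(ℝ, E) 𝓘(ℝ, E) Φ (φ.symm z) := hΦ.mdifferentiableAt (by simp)
    have a3 : MDifferentiableAt 𝓘(ℝ, E) 𝓘(ℝ, E) φ' (Φ (φ.symm z)) := by
      have : Φ (φ.symm z) ∈ (chartAt E (Φ u)).source := by
        simpa [hφ'] using hz2.self_of_nhds
      exact (contMDiffAt_extChartAt' (n := ∞) this).mdifferentiableAt (by simp)
    have a4 : MDifferentiableAt 𝓘(ℝ, E) 𝓘(ℝ, E) ψ z := by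
      rw [hψ]; exact a3.comp z (a2.comp z a1)
    have a5 : MDifferentiableAt 𝓘(ℝ, E) 𝓘(ℝ, E) φ'.symm (ψ z) := by
      have : φ'.target ∈ 𝓝 (ψ z) := by
        apply extChartAt_target_mem_nhds'
        exact φ'.map_source hz2.self_of_nhds
      exact ((contMDiffOn_extChartAt_symm (n := ∞) (Φ u)).contMDiffAt this).mdifferentiableAt (by simp)
    have e1 : φ'.symm ∘ ψ =ᶠ[𝓝 z] Φ ∘ φ.symm := by
      filter_upwards [hz2] with y hy
      simp [hψ, φ'.left_inv hy]
    have e2 := e1.mfderiv_eq (I := 𝓘(ℝ, E)) (I' := 𝓘(ℝ, E))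
    rw [mfderiv_comp (I' := 𝓘(ℝ, E)) z a5 a4, mfderiv_comp (I' := 𝓘(ℝ, E)) z a2 a1, mfderiv_eq_fderiv] at e2
    ext v
    have e3 : Φ (φ.symm z) = φ'.symm (ψ z) := e1.self_of_nhds.symm
    refine (VForm.apply_congr α e3 _).trans ?_
    show (α (φ'.symm (ψ z))) _ = (α (φ'.symm (ψ z))) _
    congr 1
    funext i
    exact (congrArg (fun L : E →L[ℝ] E => L (v i)) e2).symm
  have h1 : VForm.extD (fun u => (α (Φ u)).compContinuousLinearMap (mfderiv 𝓘(ℝ, E) 𝓘(ℝ, E) Φ u)) u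
     = extDeriv (fun z => ((α.inChart (Φ u)) (ψ z)).compContinuousLinearMap (fderiv ℝ ψ z)) (φ u) :=
    ev.extDeriv_eq
  rw [h1, extDeriv_pullback (r := ∞) (by rw [hψz]; exact hα) hψs
    (by rw [minSmoothness_of_isRCLikeNormedField]; exact ENat.LEInfty.out), hψz, ← hd]
  rfl

theorem VForm.extD_postcomp {k : ℕ} (α : VForm E M k W) (L : W →L[ℝ] W) (u : M)
    (hα : DifferentiableAt ℝ (α.inChart u) (extChartAt 𝓘(ℝ, E) u u)) :
    VForm.extD (fun u => L.compContinuousAlternatingMap (α u)) u =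
      L.compContinuousAlternatingMap (α.extD u) := by
  have e : VForm.inChart (fun u => L.compContinuousAlternatingMap (α u)) u =
    fun z => L.compContinuousAlternatingMap (α.inChart u z) := by
    funext z; rfl
  have h : HasFDerivAt (fun z => L.compContinuousAlternatingMap (α.inChart u z))
     ((ContinuousLinearMap.compContinuousAlternatingMapCLM ℝ E W W (Fin k) L).comp (fderiv ℝ (α.inChart u) (extChartAt 𝓘(ℝ, E) u u))) (extChartAt 𝓘(ℝ, E) u u) :=
    ((ContinuousLinearMap.compContinuousAlternatingMapCLM ℝ E W W (Fin k) L).hasFDerivAt).comp _ hα.hasFDerivAt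
  rw [VForm.extD, e]
  unfold extDeriv
  rw [h.fderiv]
  ext v
  simp only [ContinuousAlternatingMap.alternatizeUncurryFin_apply, VForm.extD, extDeriv]
  refine Eq.trans ?_ (congrArg L (ContinuousAlternatingMap.alternatizeUncurryFin_apply
    (fderiv ℝ (α.inChart u) (extChartAt 𝓘(ℝ, E) u u)) v)).symm
  rw [map_sum]
  refine Finset.sum_congr rfl fun i _ => ?_
  rw [map_zsmul]
  rfl

/-- A one-form with values in `W` as a `1`-form. -/
def VForm.ofOne (θ : ∀ x : M, TangentSpace 𝓘(ℝ, E) x →L[ℝ] W) : VForm E M 1 W := fun x =>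
  ContinuousAlternatingMap.ofSubsingleton ℝ _ _ 0 (θ x)

theorem VForm.differentiableAt_inChart_ofOne [IsManifold 𝓘(ℝ, E) ∞ M]
    (θ : ∀ x : M, TangentSpace 𝓘(ℝ, E) x →L[ℝ] W)
    (hθ : ContMDiff 𝓘(ℝ, E).tangent 𝓘(ℝ, W) ∞
      (fun w : TangentBundle 𝓘(ℝ, E) M => (θ w.1 w.2 : W))) (u : M) :
    DifferentiableAt ℝ ((VForm.ofOne θ).inChart u) (extChartAt 𝓘(ℝ, E) u u) := by
  set φ := extChartAt 𝓘(ℝ, E) u with hφ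
  have tgt : IsOpen φ.target := isOpen_extChartAt_target u
  have h0 := (contMDiffOn_extChartAt_symm (I := 𝓘(ℝ, E)) (n := ∞) u)
  have key : ContDiffOn ℝ ∞ (fun z => ((θ (φ.symm z)).comp
      (mfderiv 𝓘(ℝ, E) 𝓘(ℝ, E) φ.symm z) : E →L[ℝ] W)) φ.target := by
    rw [contDiffOn_clm_apply]
    intro v
    rw [← contMDiffOn_iff_contDiffOn]
    have h1 := h0.contMDiffOn_tangentMapWithin (m := ∞) (by simp) tgt.uniqueMDiffOn
    have h2 : ContMDiffOn 𝓘(ℝ, E) 𝓘(ℝ, E).tangent ∞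
       (fun z => (⟨z, v⟩ : TangentBundle 𝓘(ℝ, E) E)) φ.target := by
      exact (contMDiffOn_vectorSpace_iff_contDiffOn (V := fun _ => v)).2 contDiffOn_const
    have h3 := hθ.comp_contMDiffOn (h1.comp h2 (fun z hz => hz))
    refine h3.congr ?_
    intro z hz
    simp only [Function.comp, tangentMapWithin]
    rw [mfderivWithin_of_isOpen tgt hz]
    rfl
  have k2 := (key.contDiffAt (tgt.mem_nhds (mem_extChartAt_target u))).differentiableAt (by simp)
  exact ((ContinuousLinearEquiv.differentiableAt (ContinuousAlternatingMap.ofSubsingletonLIE (𝕜 := ℝ) (E := E) (F := W) (0 : Fin 1)).toContinuousLinearEquiv)).comp _ k2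

end Forms

noncomputable section Bundle

variable {EM M EG G EP P : Type*}
  [NormedAddCommGroup EM] [NormedSpace ℝ EM] [FiniteDimensional ℝ EM]
  [TopologicalSpace M] [ChartedSpace EM M] [IsManifold 𝓘(ℝ, EM) ∞ M]
  [NormedAddCommGroup EG] [NormedSpace ℝ EG] [FiniteDimensional ℝ EG]
  [TopologicalSpace G] [ChartedSpace EG G] [Group G] [LieGroup 𝓘(ℝ, EG) ∞ G]
  [NormedAddCommGroup EP] [NormedSpace ℝ EP] [FiniteDimensional ℝ EP]
  [TopologicalSpace P] [ChartedSpace EP P] [IsManifold 𝓘(ℝ, EP) ∞ P]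

variable (EM M EG G EP P) in
/-- A smooth principal bundle `P → M` with structure group `G` acting on the right. -/
structure PrincipalBundle where
  proj : P → M
  act : P → G → P
  contMDiff_proj : ContMDiff 𝓘(ℝ, EP) 𝓘(ℝ, EM) ∞ proj
  contMDiff_act : ContMDiff (𝓘(ℝ, EP).prod 𝓘(ℝ, EG)) 𝓘(ℝ, EP) ∞ (fun q : P × G => act q.1 q.2)
  act_one : ∀ u, act u 1 = u
  act_mul : ∀ u g h, act u (g * h) = act (act u g) h
  proj_act : ∀ u g, proj (act u g) = proj u
  exists_localTriv : ∀ x : M, ∃ (U : Set M) (e : OpenPartialHomeomorph P (M × G)),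
    IsOpen U ∧ x ∈ U ∧ e.source = proj ⁻¹' U ∧ e.target = U ×ˢ Set.univ ∧
    ContMDiffOn 𝓘(ℝ, EP) (𝓘(ℝ, EM).prod 𝓘(ℝ, EG)) ∞ e e.source ∧
    ContMDiffOn (𝓘(ℝ, EM).prod 𝓘(ℝ, EG)) 𝓘(ℝ, EP) ∞ e.symm e.target ∧
    ∀ u ∈ e.source, (e u).1 = proj u ∧ ∀ g, e (act u g) = (proj u, (e u).2 * g)

namespace PrincipalBundle

variable (Q : PrincipalBundle EM M EG G EP P)

/-- The fibre of `P` over `x`. -/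
abbrev fiber (x : M) := {u : P // Q.proj u = x}

/-- The action of `G` on a fibre of `P`. -/
def fiberAct {x : M} (u : Q.fiber x) (g : G) : Q.fiber x :=
  ⟨Q.act u.1 g, (Q.proj_act u.1 g).trans u.2⟩

theorem contMDiff_act_left (g : G) : ContMDiff 𝓘(ℝ, EP) 𝓘(ℝ, EP) ∞ (fun u => Q.act u g) :=
  Q.contMDiff_act.comp (contMDiff_id.prodMk contMDiff_const)

theorem contMDiff_act_right (u : P) : ContMDiff 𝓘(ℝ, EG) 𝓘(ℝ, EP) ∞ (fun g => Q.act u g) :=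
  Q.contMDiff_act.comp (contMDiff_const.prodMk contMDiff_id)

theorem nonempty_fiber (x : M) : Nonempty (Q.fiber x) := by
  obtain ⟨U, e, -, hx, hs, ht, -, -, he⟩ := Q.exists_localTriv x
  have h1 : ((x, 1) : M × G) ∈ e.target := by rw [ht]; exact ⟨hx, trivial⟩
  refine ⟨⟨e.symm (x, 1), ?_⟩⟩
  rw [← (he _ (e.map_target h1)).1, e.right_inv h1]

/-- `G` acts transitively on the fibres of `P`. -/
theorem exists_act_eq {x : M} (u v : Q.fiber x) : ∃ g, v = Q.fiberAct u g := by
  obtain ⟨U, e, -, hx, hs, -, -, -, he⟩ := Q.exists_localTriv x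
  have mem : ∀ w : Q.fiber x, w.1 ∈ e.source := fun w => by
    rw [hs]; show Q.proj w.1 ∈ U; rw [w.2]; exact hx
  refine ⟨(e u.1).2⁻¹ * (e v.1).2, Subtype.ext (e.injOn (mem v) (mem (Q.fiberAct u _)) ?_)⟩
  show e v.1 = e (Q.act u.1 _)
  rw [(he _ (mem u)).2]
  refine Prod.ext ?_ ?_
  · rw [(he _ (mem v)).1, u.2, v.2]
  · simp

/-- The fundamental vertical vector at `u` of a Lie algebra element. -/
def vert (u : P) : GroupLieAlgebra 𝓘(ℝ, EG) G →L[ℝ] TangentSpace 𝓘(ℝ, EP) u :=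
  mfderiv 𝓘(ℝ, EG) 𝓘(ℝ, EP) (fun g => Q.act u g) 1

/-- The differential of the projection. -/
def dproj (u : P) : TangentSpace 𝓘(ℝ, EP) u →L[ℝ] TangentSpace 𝓘(ℝ, EM) (Q.proj u) :=
  mfderiv 𝓘(ℝ, EP) 𝓘(ℝ, EM) Q.proj u

/-- The differential of the right translation by `g`. -/
def dact (g : G) (u : P) : TangentSpace 𝓘(ℝ, EP) u →L[ℝ] TangentSpace 𝓘(ℝ, EP) (Q.act u g) :=
  mfderiv 𝓘(ℝ, EP) 𝓘(ℝ, EP) (fun u => Q.act u g) u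

theorem dproj_vert (u : P) (A : GroupLieAlgebra 𝓘(ℝ, EG) G) : Q.dproj u (Q.vert u A) = 0 := by
  have h := mfderiv_comp (I := 𝓘(ℝ, EG)) (I' := 𝓘(ℝ, EP)) (I'' := 𝓘(ℝ, EM)) (1 : G)
    (Q.contMDiff_proj.mdifferentiableAt (x := Q.act u 1) (by simp))
    ((Q.contMDiff_act_right u).mdifferentiableAt (by simp))
  have e : Q.proj ∘ (fun g => Q.act u g) = fun _ => Q.proj u := funext fun g => Q.proj_act u g
  rw [e, mfderiv_const] at h
  have h2 := congrArg (fun L => L A) h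
  have key : ∀ y, y = u → (0 : EM) = mfderiv 𝓘(ℝ, EP) 𝓘(ℝ, EM) Q.proj y (Q.vert u A) →
      Q.dproj u (Q.vert u A) = 0 := by
    rintro y rfl h; exact h.symm
  exact key _ (Q.act_one u) h2

theorem dproj_dact (g : G) (u : P) (w : TangentSpace 𝓘(ℝ, EP) u) :
    (Q.dproj (Q.act u g) (Q.dact g u w) : EM) = Q.dproj u w := by
  have h := mfderiv_comp (I := 𝓘(ℝ, EP)) (I' := 𝓘(ℝ, EP)) (I'' := 𝓘(ℝ, EM)) u
    (Q.contMDiff_proj.mdifferentiableAt (x := Q.act u g) (by simp))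
    ((Q.contMDiff_act_left g).mdifferentiableAt (by simp))
  have e : Q.proj ∘ (fun u => Q.act u g) = Q.proj := funext fun u => Q.proj_act u g
  rw [e] at h
  exact (congrArg (fun L => L w) h).symm

theorem dproj_surjective (u : P) : Function.Surjective (Q.dproj u) := by
  obtain ⟨U, e, hU, hx, hs, ht, h1, h2, he⟩ := Q.exists_localTriv (Q.proj u)
  have hu : u ∈ e.source := by rw [hs]; exact hx
  let s : M → P := fun y => e.symm (y, (e u).2)
  have hsx : s (Q.proj u) = u := by
    simp only [s]
    rw [← (he u hu).1, Prod.mk.eta, e.left_inv hu]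
  have hmem : (Q.proj u, (e u).2) ∈ e.target := by rw [ht]; exact ⟨hx, trivial⟩
  have ds : MDifferentiableAt 𝓘(ℝ, EM) 𝓘(ℝ, EP) s (Q.proj u) := by
    have : ContMDiffAt (𝓘(ℝ, EM).prod 𝓘(ℝ, EG)) 𝓘(ℝ, EP) ∞ e.symm (Q.proj u, (e u).2) :=
      h2.contMDiffAt (e.open_target.mem_nhds hmem)
    exact (this.comp (Q.proj u) (contMDiffAt_id.prodMk contMDiffAt_const)).mdifferentiableAt
      (by simp)
  have h := mfderiv_comp (I := 𝓘(ℝ, EM)) (I' := 𝓘(ℝ, EP)) (I'' := 𝓘(ℝ, EM)) (Q.proj u)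
    (Q.contMDiff_proj.mdifferentiableAt (x := s (Q.proj u)) (by simp)) ds
  have ev : Q.proj ∘ s =ᶠ[𝓝 (Q.proj u)] id := by
    filter_upwards [hU.mem_nhds hx] with y hy
    have hy' : (y, (e u).2) ∈ e.target := by rw [ht]; exact ⟨hy, trivial⟩
    simp only [Function.comp, s, id]
    rw [← (he _ (e.map_target hy')).1, e.right_inv hy']
  have ev2 := ev.mfderiv_eq (I := 𝓘(ℝ, EM)) (I' := 𝓘(ℝ, EM))
  rw [h, mfderiv_id] at ev2
  intro v
  have h3 := congrArg (fun L : EM →L[ℝ] EM => L v) ev2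
  have key : ∀ y (_ : y = u) (w : EP), (mfderiv 𝓘(ℝ, EP) 𝓘(ℝ, EM) Q.proj y w : EM) = v →
      ∃ a, Q.dproj u a = v := by
    rintro y rfl w h; exact ⟨w, h⟩
  exact key _ hsx _ h3

theorem exists_vert_eq (u : P) (w : TangentSpace 𝓘(ℝ, EP) u) (hw : Q.dproj u w = 0) :
    ∃ A, Q.vert u A = w := by
  obtain ⟨U, e, hU, hx, hs, ht, h1, h2, he⟩ := Q.exists_localTriv (Q.proj u)
  have hu : u ∈ e.source := by rw [hs]; exact hx
  set k : P → G := fun u' => (e u).2⁻¹ * (e u').2 with hk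
  have hku : k u = 1 := by simp [hk]
  have de : ContMDiffAt 𝓘(ℝ, EP) (𝓘(ℝ, EM).prod 𝓘(ℝ, EG)) ∞ e u :=
    h1.contMDiffAt (e.open_source.mem_nhds hu)
  have dk : MDifferentiableAt 𝓘(ℝ, EP) 𝓘(ℝ, EG) k u :=
    ContMDiffAt.mdifferentiableAt (n := ∞) (contMDiffAt_const.mul (contMDiffAt_snd.comp u de)) (by simp)
  let s : M → P := fun y => e.symm (y, (e u).2)
  have hsx : s (Q.proj u) = u := by
    simp only [s]
    rw [← (he u hu).1, Prod.mk.eta, e.left_inv hu]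
  have hmem : (Q.proj u, (e u).2) ∈ e.target := by rw [ht]; exact ⟨hx, trivial⟩
  have ds : MDifferentiableAt 𝓘(ℝ, EM) 𝓘(ℝ, EP) s (Q.proj u) := by
    have : ContMDiffAt (𝓘(ℝ, EM).prod 𝓘(ℝ, EG)) 𝓘(ℝ, EP) ∞ e.symm (Q.proj u, (e u).2) :=
      h2.contMDiffAt (e.open_target.mem_nhds hmem)
    exact (this.comp (Q.proj u) (contMDiffAt_id.prodMk contMDiffAt_const)).mdifferentiableAt
      (by simp)
  have dsp : MDifferentiableAt 𝓘(ℝ, EP) 𝓘(ℝ, EP) (s ∘ Q.proj) u :=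
    ds.comp u (Q.contMDiff_proj.mdifferentiableAt (by simp))
  have hd0 : ∀ v, (mfderiv 𝓘(ℝ, EP) 𝓘(ℝ, EP) (s ∘ Q.proj) u v : EP) =
      mfderiv 𝓘(ℝ, EM) 𝓘(ℝ, EP) s (Q.proj u) (Q.dproj u v) := by
    intro v
    rw [mfderiv_comp (I' := 𝓘(ℝ, EM)) u ds (Q.contMDiff_proj.mdifferentiableAt (by simp))]
    rfl
  have ev : (fun q : P × G => Q.act q.1 q.2) ∘ (fun u' => ((s ∘ Q.proj) u', k u')) =ᶠ[𝓝 u] id := by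
    filter_upwards [e.open_source.mem_nhds hu] with u' hu'
    have hy : Q.proj u' ∈ U := by rw [hs] at hu'; exact hu'
    have hy' : (Q.proj u', (e u).2) ∈ e.target := by rw [ht]; exact ⟨hy, trivial⟩
    have m := e.map_target hy'
    apply e.injOn _ hu'
    · simp only [Function.comp, s, hk]
      rw [(he _ m).2, ← (he _ m).1, e.right_inv hy']
      refine Prod.ext ?_ ?_
      · rw [(he _ hu').1]
      · simp
    · rw [hs]
      show Q.proj (Q.act _ _) ∈ U
      rw [Q.proj_act]
      have : e.symm (Q.proj u', (e u).2) ∈ Q.proj ⁻¹' U := hs ▸ m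
      exact this
  have ev2 := ev.mfderiv_eq (I := 𝓘(ℝ, EP)) (I' := 𝓘(ℝ, EP))
  have dF : MDifferentiableAt (𝓘(ℝ, EP).prod 𝓘(ℝ, EG)) 𝓘(ℝ, EP)
    (fun q : P × G => Q.act q.1 q.2) ((s ∘ Q.proj) u, k u) :=
    Q.contMDiff_act.mdifferentiableAt (by simp)
  rw [mfderiv_comp (I' := 𝓘(ℝ, EP).prod 𝓘(ℝ, EG)) u dF (dsp.prodMk dk), mfderiv_id] at ev2
  have h3 := congrArg (fun L : EP →L[ℝ] EP => L w) ev2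
  refine ⟨(mfderiv 𝓘(ℝ, EP) 𝓘(ℝ, EG) k u w : EG), ?_⟩
  have h5 : mfderiv 𝓘(ℝ, EP) (𝓘(ℝ, EP).prod 𝓘(ℝ, EG)) (fun u' => ((s ∘ Q.proj) u', k u')) u w
     = ((0 : EP), (mfderiv 𝓘(ℝ, EP) 𝓘(ℝ, EG) k u w : EG)) := by
    rw [mfderiv_prodMk dsp dk]
    refine Prod.ext ?_ rfl
    refine (hd0 w).trans ?_
    rw [hw, map_zero]; rfl
  have key : ∀ (y : P) (_ : y = u) (g : G) (_ : g = 1) (c : EG),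
      (mfderiv 𝓘(ℝ, EG) 𝓘(ℝ, EP) (fun g => Q.act y g) g c : EP) = Q.vert u c := by
    rintro y rfl g rfl c; rfl
  refine (key _ hsx _ hku _).symm.trans ?_
  refine Eq.trans ?_ h3
  refine Eq.trans ?_ (congrArg (mfderiv (𝓘(ℝ, EP).prod 𝓘(ℝ, EG)) 𝓘(ℝ, EP)
    (fun q : P × G => Q.act q.1 q.2) ((s ∘ Q.proj) u, k u)) h5).symm
  refine Eq.trans ?_ (mfderiv_prod_eq_add_apply dF).symm
  exact ((congrArg (· + _) (map_zero (mfderiv 𝓘(ℝ, EP) 𝓘(ℝ, EP)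
    (fun z => Q.act z (k u)) ((s ∘ Q.proj) u)))).trans (zero_add _)).symm

/-- The fibre over `x` of the adjoint bundle `ad P = P ×_G 𝔤`, realised as the space of
`G`-equivariant maps from the fibre of `P` to `𝔤`; the class of `(u, A)` is the equivariant map
with value `A` at `u`. -/
def adP (x : M) : Submodule ℝ (Q.fiber x → GroupLieAlgebra 𝓘(ℝ, EG) G) where
  carrier := {φ | ∀ u g, φ (Q.fiberAct u g) = Ad g⁻¹ (φ u)}
  add_mem' := fun {φ ψ} h k u g => by simp [h u g, k u g]
  zero_mem' := fun u g => by simp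
  smul_mem' := fun a φ h u g => by simp [h u g]

/-- The fibrewise Lie bracket of `ad P`. -/
instance lieRingAdP (x : M) : LieRing (Q.adP x) where
  bracket φ ψ := ⟨fun u => ⁅φ.1 u, ψ.1 u⁆, fun u g => by
    show ⁅φ.1 (Q.fiberAct u g), ψ.1 (Q.fiberAct u g)⁆ = Ad g⁻¹ ⁅φ.1 u, ψ.1 u⁆
    rw [φ.2 u g, ψ.2 u g, Ad_lie]⟩
  add_lie φ ψ χ := Subtype.ext (funext fun u => add_lie _ _ _)
  lie_add φ ψ χ := Subtype.ext (funext fun u => lie_add _ _ _)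
  lie_self φ := Subtype.ext (funext fun u => lie_self _)
  leibniz_lie φ ψ χ := Subtype.ext (funext fun u => leibniz_lie _ _ _)

instance lieAlgebraAdP (x : M) : LieAlgebra ℝ (Q.adP x) where
  lie_smul a φ ψ := Subtype.ext (funext fun u => lie_smul a (φ.1 u) (ψ.1 u))

/-- A chosen point of the fibre of `P` over `x`. -/
def point (x : M) : Q.fiber x := Classical.choice (Q.nonempty_fiber x)

/-- The fibrewise pairing on `ad P` induced by a pairing `c` on `𝔤`; it is computed at one point
of the fibre, and does not depend on it when `c` is `Ad`-invariant, see `pairing_eq`. -/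
def pairing (c : LinearMap.BilinForm ℝ (GroupLieAlgebra 𝓘(ℝ, EG) G)) (x : M) :
    LinearMap.BilinForm ℝ (Q.adP x) :=
  c.compl₁₂ (LinearMap.proj (Q.point x) ∘ₗ (Q.adP x).subtype)
    (LinearMap.proj (Q.point x) ∘ₗ (Q.adP x).subtype)

theorem pairing_eq (c : LinearMap.BilinForm ℝ (GroupLieAlgebra 𝓘(ℝ, EG) G))
    (hc : ∀ (g : G) A B, c (Ad g A) (Ad g B) = c A B) {x : M} (φ ψ : Q.adP x) (u : Q.fiber x) :
    Q.pairing c x φ ψ = c (φ.1 u) (ψ.1 u) := by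
  obtain ⟨g, rfl⟩ := Q.exists_act_eq (Q.point x) u
  rw [φ.2, ψ.2, hc]
  rfl

/-- Sections of `ad P`. -/
abbrev AdSection := ∀ x : M, Q.adP x

/-- The equivariant map `P → 𝔤` that corresponds to a section of `ad P`. -/
def hat (r : Q.AdSection) (u : P) : EG := (r (Q.proj u)).1 ⟨u, rfl⟩

/-- A section of `ad P` is smooth if the equivariant map `P → 𝔤` is. -/
def SmoothAd (r : Q.AdSection) : Prop := ContMDiff 𝓘(ℝ, EP) 𝓘(ℝ, EG) ∞ (Q.hat r)

/-- A connection on `P`, given by its connection form `TP → 𝔤`. -/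
structure Connection where
  form : ∀ u : P, TangentSpace 𝓘(ℝ, EP) u →L[ℝ] EG
  smooth : ContMDiff 𝓘(ℝ, EP).tangent 𝓘(ℝ, EG) ∞
    (fun w : TangentBundle 𝓘(ℝ, EP) P => (form w.1 w.2 : EG))
  form_vert : ∀ u (A : GroupLieAlgebra 𝓘(ℝ, EG) G), form u (Q.vert u A) = A
  form_act : ∀ u g w, form (Q.act u g) (Q.dact g u w) =
    Ad (g⁻¹ : G) (form u w : GroupLieAlgebra 𝓘(ℝ, EG) G)

theorem hat_act (r : Q.AdSection) (u : P) (g : G) :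
    Q.hat r (Q.act u g) = Ad (g⁻¹ : G) (Q.hat r u : GroupLieAlgebra 𝓘(ℝ, EG) G) := by
  have h := (r (Q.proj u)).2 ⟨u, rfl⟩ g
  have key : ∀ (x : M) (h : Q.proj (Q.act u g) = x),
      Q.hat r (Q.act u g) = (r x).1 ⟨Q.act u g, h⟩ := by
    rintro x rfl; rfl
  exact (key _ (Q.proj_act u g)).trans h

theorem mfderiv_hat_act (r : Q.AdSection) (u : P) (g : G) (w : TangentSpace 𝓘(ℝ, EP) u) :
    (mfderiv 𝓘(ℝ, EP) 𝓘(ℝ, EG) (Q.hat r) (Q.act u g) (Q.dact g u w) : EG) =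
      Ad (g⁻¹ : G) (mfderiv 𝓘(ℝ, EP) 𝓘(ℝ, EG) (Q.hat r) u w : EG) := by
  have adl : ∀ h : G, ∃ L : EG →L[ℝ] EG, ∀ A : EG, L A = Ad (h : G) (A : GroupLieAlgebra 𝓘(ℝ, EG) G) :=
    fun h => ⟨Ad h, fun _ => rfl⟩
  obtain ⟨L, hL⟩ := adl g⁻¹
  have e : Q.hat r ∘ (fun u => Q.act u g) = L ∘ Q.hat r := by
    funext v; exact (Q.hat_act r v g).trans (hL _).symm
  have dL : ∀ (L : EG →L[ℝ] EG) y, MDifferentiableAt 𝓘(ℝ, EG) 𝓘(ℝ, EG) L y := fun L y =>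
    L.differentiableAt.mdifferentiableAt
  by_cases hr : MDifferentiableAt 𝓘(ℝ, EP) 𝓘(ℝ, EG) (Q.hat r) u
  · have hr' : MDifferentiableAt 𝓘(ℝ, EP) 𝓘(ℝ, EG) (Q.hat r) (Q.act u g) := by
      have e2 : Q.hat r = L ∘ Q.hat r ∘ (fun u => Q.act u g⁻¹) := by
        funext v
        have := Q.hat_act r (Q.act v g⁻¹) g
        rw [← Q.act_mul, inv_mul_cancel, Q.act_one] at this
        exact this.trans (hL _).symm
      rw [e2]
      have hb : Q.act (Q.act u g) g⁻¹ = u := by rw [← Q.act_mul, mul_inv_cancel, Q.act_one]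
      refine (dL L _).comp _ (MDifferentiableAt.comp (I' := 𝓘(ℝ, EP)) _ ?_
        ((Q.contMDiff_act_left g⁻¹).mdifferentiableAt (by simp)))
      rw [hb]; exact hr
    have h1 := mfderiv_comp (I' := 𝓘(ℝ, EP)) u hr' ((Q.contMDiff_act_left g).mdifferentiableAt (by simp))
    rw [e, mfderiv_comp (I' := 𝓘(ℝ, EG)) u (dL L _) hr] at h1
    have h2 := congrArg (fun L : EP →L[ℝ] EG => L w) h1
    refine h2.symm.trans ?_
    refine Eq.trans ?_ (hL _)
    simp [mfderiv_eq_fderiv]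
    rfl
  · have hr' : ¬ MDifferentiableAt 𝓘(ℝ, EP) 𝓘(ℝ, EG) (Q.hat r) (Q.act u g) := by
      intro h
      apply hr
      obtain ⟨L', hL'⟩ := adl g
      have e2 : Q.hat r = L' ∘ Q.hat r ∘ (fun u => Q.act u g) := by
        funext v
        simp only [Function.comp, hL']
        rw [Q.hat_act]
        refine Eq.symm ((Ad_mul g g⁻¹ (Q.hat r v : EG)).symm.trans ?_)
        rw [mul_inv_cancel]
        exact Ad_one _
      rw [e2]
      exact (dL L' _).comp _ (MDifferentiableAt.comp (I' := 𝓘(ℝ, EP)) _ h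
        ((Q.contMDiff_act_left g).mdifferentiableAt (by simp)))
    rw [mfderiv_zero_of_not_mdifferentiableAt hr, mfderiv_zero_of_not_mdifferentiableAt hr']
    exact (map_zero (Ad (g⁻¹ : G))).symm

namespace Connection

variable {Q} (θ : Q.Connection)

theorem split_bijective (u : P) : Function.Bijective
    ((Q.dproj u).toLinearMap.prod (θ.form u).toLinearMap) := by
  constructor
  · rw [← LinearMap.ker_eq_bot, LinearMap.ker_eq_bot']
    intro w hw
    have h1 : Q.dproj u w = 0 := congrArg Prod.fst hw
    have h2 : θ.form u w = 0 := congrArg Prod.snd hw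
    obtain ⟨A, rfl⟩ := Q.exists_vert_eq u w h1
    rw [θ.form_vert] at h2
    rw [h2]
    exact map_zero (Q.vert u)
  · rintro ⟨v, A⟩
    obtain ⟨w, hw⟩ := Q.dproj_surjective u v
    obtain ⟨B, hB⟩ : ∃ B : GroupLieAlgebra 𝓘(ℝ, EG) G, B = (A - θ.form u w : EG) := ⟨_, rfl⟩
    refine ⟨w + Q.vert u B, Prod.ext ?_ ?_⟩
    · refine (map_add (Q.dproj u) _ _).trans ?_
      rw [Q.dproj_vert, hw, add_zero]
    · refine (map_add (θ.form u) _ _).trans ?_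
      rw [θ.form_vert]
      exact (congrArg (fun C : EG => θ.form u w + C) hB).trans (add_sub_cancel (θ.form u w) A)

/-- The horizontal lift: `θ.hor u v` is the unique vector at `u` in the kernel of the connection
form that projects to `v`. -/
def hor (u : P) : TangentSpace 𝓘(ℝ, EM) (Q.proj u) →ₗ[ℝ] TangentSpace 𝓘(ℝ, EP) u :=
  (LinearEquiv.ofBijective _ (θ.split_bijective u)).symm.toLinearMap ∘ₗ LinearMap.inl ℝ _ _

theorem split_hor (u : P) (v : TangentSpace 𝓘(ℝ, EM) (Q.proj u)) :
    ((Q.dproj u (θ.hor u v), θ.form u (θ.hor u v)) : TangentSpace 𝓘(ℝ, EM) (Q.proj u) × EG) =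
      (v, 0) :=
  (LinearEquiv.ofBijective _ (θ.split_bijective u)).apply_symm_apply (v, 0)

theorem dproj_hor (u : P) (v : TangentSpace 𝓘(ℝ, EM) (Q.proj u)) : Q.dproj u (θ.hor u v) = v :=
  congrArg Prod.fst (θ.split_hor u v)

theorem form_hor (u : P) (v : TangentSpace 𝓘(ℝ, EM) (Q.proj u)) : θ.form u (θ.hor u v) = 0 :=
  congrArg Prod.snd (θ.split_hor u v)

theorem hor_act (u : P) (g : G) (v : EM) : θ.hor (Q.act u g) v = Q.dact g u (θ.hor u v) := by
  apply (θ.split_bijective (Q.act u g)).1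
  refine (θ.split_hor (Q.act u g) v).trans (Prod.ext ?_ ?_)
  · exact ((Q.dproj_dact g u _).trans (θ.dproj_hor u v)).symm
  · refine Eq.symm ((θ.form_act u g _).trans ?_)
    exact (congrArg (Ad (g⁻¹ : G)) (θ.form_hor u v)).trans (map_zero (Ad (g⁻¹ : G)))

/-- The horizontal lift to a point `u` of the fibre over `x` of a vector at `x`. -/
def horAt {x : M} (u : Q.fiber x) : TangentSpace 𝓘(ℝ, EM) x →ₗ[ℝ] TangentSpace 𝓘(ℝ, EP) u.1 :=
  (show EM →ₗ[ℝ] EP from θ.hor u.1)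

/-- The covariant derivative `d^θ r` of a section of `ad P`: the derivative of the equivariant map
`P → 𝔤` in the direction of horizontal lifts. -/
def covDeriv (r : Q.AdSection) (x : M) : TangentSpace 𝓘(ℝ, EM) x →ₗ[ℝ] Q.adP x where
  toFun v := ⟨fun u => (mfderiv 𝓘(ℝ, EP) 𝓘(ℝ, EG) (Q.hat r) u.1 (θ.horAt u v) : EG), fun u g => by
    refine Eq.trans ?_ (Q.mfderiv_hat_act r u.1 g (θ.horAt u v))
    exact congrArg (mfderiv 𝓘(ℝ, EP) 𝓘(ℝ, EG) (Q.hat r) (Q.act u.1 g)) (θ.hor_act u.1 g v)⟩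
  map_add' v w := Subtype.ext (funext fun u => by
    simp only [map_add]; rfl)
  map_smul' a v := Subtype.ext (funext fun u => by
    simp only [map_smul]; rfl)

theorem extD_act (u : P) (g : G) (w : Fin 2 → EP) :
    ((VForm.ofOne θ.form).extD (Q.act u g) (fun i => Q.dact g u (w i)) : EG) =
      Ad (g⁻¹ : G) ((VForm.ofOne θ.form).extD u w : EG) := by
  have h1 := VForm.extD_pullback (VForm.ofOne θ.form) (fun u => Q.act u g) u
    (Q.contMDiff_act_left g) (VForm.differentiableAt_inChart_ofOne θ.form θ.smooth _)
  let L : EG →L[ℝ] EG := Ad (g⁻¹ : G)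
  have h2 := VForm.extD_postcomp (VForm.ofOne θ.form) L u
    (VForm.differentiableAt_inChart_ofOne θ.form θ.smooth _)
  have e : (fun u => (VForm.ofOne θ.form (Q.act u g)).compContinuousLinearMap
      (mfderiv 𝓘(ℝ, EP) 𝓘(ℝ, EP) (fun u => Q.act u g) u)) =
      fun u => L.compContinuousAlternatingMap (VForm.ofOne θ.form u) := by
    funext u
    ext v
    exact θ.form_act u g (v 0)
  rw [e, h2] at h1
  exact (congrArg (fun α : EP [⋀^Fin 2]→L[ℝ] EG => α w) h1).symm

/-- The curvature form `dθ + ½[θ, θ]` of the connection, evaluated on horizontal lifts (where the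
second term vanishes) to a point `u` of the fibre over `x`. -/
def curvAt {x : M} (u : Q.fiber x) : TangentSpace 𝓘(ℝ, EM) x [⋀^Fin 2]→ₗ[ℝ] EG :=
  ((VForm.ofOne θ.form).extD u.1).toAlternatingMap.compLinearMap (θ.horAt u)

/-- The curvature of the connection as a `2`-form on `M` with values in `ad P`. -/
def curv (x : M) : TangentSpace 𝓘(ℝ, EM) x [⋀^Fin 2]→ₗ[ℝ] Q.adP x where
  toFun v := ⟨fun u => (θ.curvAt u v : EG), fun u g => by
    refine Eq.trans ?_ (θ.extD_act u.1 g (fun i => θ.horAt u (v i)))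
    exact congrArg ((VForm.ofOne θ.form).extD (Q.act u.1 g))
      (funext fun i => θ.hor_act u.1 g (v i))⟩
  map_update_add' v i a b := Subtype.ext (funext fun u => (θ.curvAt u).map_update_add' v i a b)
  map_update_smul' v i a b := Subtype.ext (funext fun u => (θ.curvAt u).map_update_smul' v i a b)
  map_eq_zero_of_eq' v i j hv hij :=
    Subtype.ext (funext fun u => (θ.curvAt u).map_eq_zero_of_eq' v i j hv hij)

end Connection
end PrincipalBundle

/-- An automorphism of the vector bundle `V → M` with smooth sections singled out by `S`: a
diffeomorphism of the base and a family of linear isomorphisms of the fibres covering it, which is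
smooth, as is its inverse, in the sense that it matches smooth sections with smooth sections. -/
structure BundleAut (V : M → Type*) [∀ x, AddCommGroup (V x)] [∀ x, Module ℝ (V x)]
    (S : (∀ x, V x) → Prop) where
  base : M ≃ₘ^∞⟮𝓘(ℝ, EM), 𝓘(ℝ, EM)⟯ M
  fib : ∀ x, V x ≃ₗ[ℝ] V (base x)
  smooth : ∀ s, S (fun x => (fib x).symm (s (base x))) ↔ S s

namespace BundleAut

variable {V : M → Type*} [∀ x, AddCommGroup (V x)] [∀ x, Module ℝ (V x)]
  {S : (∀ x, V x) → Prop}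

/-- The identification of the fibres over equal points. -/
def castEquiv {x y : M} (h : x = y) : V x ≃ₗ[ℝ] V y := by
  subst h; exact LinearEquiv.refl ℝ _

variable (f g : BundleAut (EM := EM) V S)

/-- The induced map on the total space. -/
def total (p : Σ x, V x) : Σ x, V x := ⟨f.base p.1, f.fib p.1 p.2⟩

/-- The inverse action `f⁻¹ · s` on sections, `(f⁻¹ · s)(x) = f⁻¹ (s (f x))`. -/
def pull (s : ∀ x, V x) : ∀ x, V x := fun x => (f.fib x).symm (s (f.base x))

/-- The action `f · s` on sections, `(f · s)(y) = f (s (f⁻¹ y))`. -/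
def push (s : ∀ x, V x) : ∀ x, V x := fun y =>
  castEquiv (f.base.apply_symm_apply y) (f.fib (f.base.symm y) (s (f.base.symm y)))

theorem push_base (s : ∀ x, V x) (x : M) : f.push s (f.base x) = f.fib x (s x) := by
  have key : ∀ z (_ : z = x) (h : f.base z = f.base x),
      castEquiv h (f.fib z (s z)) = f.fib x (s x) := by
    rintro z rfl h; rfl
  exact key _ (f.base.symm_apply_apply x) _

theorem pull_push (s : ∀ x, V x) : f.pull (f.push s) = s := by
  funext x
  simp [pull, push_base]

theorem push_pull (s : ∀ x, V x) : f.push (f.pull s) = s := by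
  funext y
  obtain ⟨x, rfl⟩ := f.base.surjective y
  simp [pull, push_base]

theorem smooth_pull {s : ∀ x, V x} : S (f.pull s) ↔ S s := f.smooth s

theorem smooth_push {s : ∀ x, V x} : S (f.push s) ↔ S s := by
  rw [← f.smooth_pull, pull_push]

theorem total_injective : Function.Injective (total : BundleAut (EM := EM) V S → _) := by
  intro f g h
  obtain ⟨fb, ff, fs⟩ := f
  obtain ⟨gb, gf, gs⟩ := g
  have hb : fb = gb := Diffeomorph.ext fun x => congrArg Sigma.fst (congrFun h ⟨x, 0⟩)
  subst hb
  have hf : ff = gf := by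
    funext x
    ext v
    exact eq_of_heq (Sigma.mk.inj_iff.1 (congrFun h ⟨x, v⟩)).2
  subst hf
  rfl

instance : Mul (BundleAut (EM := EM) V S) where
  mul f g :=
    { base := g.base.trans f.base
      fib := fun x => (g.fib x).trans (f.fib (g.base x))
      smooth := fun s => (g.smooth (f.pull s)).trans (f.smooth s) }

instance : One (BundleAut (EM := EM) V S) where
  one :=
    { base := Diffeomorph.refl _ M ∞
      fib := fun _ => LinearEquiv.refl ℝ _
      smooth := fun _ => Iff.rfl }

instance : Inv (BundleAut (EM := EM) V S) where
  inv f :=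
    { base := f.base.symm
      fib := fun y => (castEquiv (f.base.apply_symm_apply y)).symm.trans (f.fib (f.base.symm y)).symm
      smooth := fun _ => f.smooth_push }

/-- Automorphisms form a group under composition. -/
instance : Group (BundleAut (EM := EM) V S) where
  mul_assoc f g h := total_injective rfl
  one_mul f := total_injective rfl
  mul_one f := total_injective rfl
  inv_mul_cancel f := total_injective (by
    funext ⟨x, v⟩
    have key : ∀ (z : M) (hz : z = x) (h : f.base z = f.base x),
        (⟨z, (f.fib z).symm ((castEquiv h).symm (f.fib x v))⟩ : Σ x, V x) = ⟨x, v⟩ := by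
      rintro z rfl h
      exact congrArg (Sigma.mk z) ((f.fib z).symm_apply_apply v)
    exact key _ (f.base.symm_apply_apply x) (f.base.apply_symm_apply (f.base x)))

theorem total_mul : (f * g).total = f.total ∘ g.total := rfl

theorem fib_inv (y : M) (v : V y) : f.fib (f⁻¹.base y) (f⁻¹.fib y v) =
    (castEquiv (f.base.apply_symm_apply y)).symm v :=
  (f.fib (f.base.symm y)).apply_symm_apply ((castEquiv (f.base.apply_symm_apply y)).symm v)

theorem total_inv (p : Σ x, V x) : f.total (f⁻¹.total p) = p :=
  congrFun (congrArg total (mul_inv_cancel f)) p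

theorem push_mul (s : ∀ x, V x) : (f * g).push s = f.push (g.push s) := by
  have h : (f * g).pull (f.push (g.push s)) = s := by
    show g.pull (f.pull (f.push (g.push s))) = s
    rw [pull_push, pull_push]
  rw [← h, push_pull, h]

theorem push_one (s : ∀ x, V x) : (1 : BundleAut (EM := EM) V S).push s = s :=
  push_pull (1 : BundleAut (EM := EM) V S) s

theorem push_inv (s : ∀ x, V x) : f⁻¹.push s = f.pull s := by
  have h : f⁻¹.pull (f.pull s) = s := f.push_pull s
  conv_lhs => rw [← h]
  rw [push_pull]

end BundleAut

/-- The contraction `w ↦ β(v, w)`. -/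
def contract {V W : Type*} [AddCommGroup V] [Module ℝ V] [AddCommGroup W] [Module ℝ W]
    (β : V [⋀^Fin 2]→ₗ[ℝ] W) (v : V) : V →ₗ[ℝ] W where
  toFun w := β ![v, w]
  map_add' a b := by
    have h : ∀ w, Function.update ![v, 0] 1 w = ![v, w] := fun w => by
      funext i; fin_cases i <;> rfl
    have k := β.map_update_add ![v, 0] 1 a b
    rwa [h, h, h] at k
  map_smul' t a := by
    have h : ∀ w, Function.update ![v, 0] 1 w = ![v, w] := fun w => by
      funext i; fin_cases i <;> rfl
    have k := β.map_update_smul ![v, 0] 1 t a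
    rwa [h, h] at k

/-- The contraction `w ↦ β(u, v, w)`. -/
def contract₂ {V W : Type*} [AddCommGroup V] [Module ℝ V] [AddCommGroup W] [Module ℝ W]
    (β : V [⋀^Fin 3]→ₗ[ℝ] W) (u v : V) : V →ₗ[ℝ] W where
  toFun w := β ![u, v, w]
  map_add' a b := by
    have h : ∀ w, Function.update ![u, v, 0] 2 w = ![u, v, w] := fun w => by
      funext i; fin_cases i <;> rfl
    have k := β.map_update_add ![u, v, 0] 2 a b
    rwa [h, h, h] at k
  map_smul' t a := by
    have h : ∀ w, Function.update ![u, v, 0] 2 w = ![u, v, w] := fun w => by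
      funext i; fin_cases i <;> rfl
    have k := β.map_update_smul ![u, v, 0] 2 t a
    rwa [h, h] at k

/-- The alternating form `(v, w) ↦ β(v, w) - β(w, v)`. -/
def altOfBilin {x : M} (β : LinearMap.BilinForm ℝ (TangentSpace 𝓘(ℝ, EM) x)) :
    TangentSpace 𝓘(ℝ, EM) x [⋀^Fin 2]→L[ℝ] ℝ where
  toFun m := β (m 0) (m 1) - β (m 1) (m 0)
  map_update_add' m i a b := by
    fin_cases i <;> simp [Function.update] <;> ring
  map_update_smul' m i t a := by
    fin_cases i <;> simp [Function.update] <;> ring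
  map_eq_zero_of_eq' m i j h hij := by
    fin_cases i <;> fin_cases j <;> simp_all
  cont := by
    obtain ⟨L, hL⟩ : ∃ L : EM →L[ℝ] EM →L[ℝ] ℝ,
        ∀ v w : TangentSpace 𝓘(ℝ, EM) x, β v w = L v w :=
      ⟨LinearMap.toContinuousBilinearMap (show EM →ₗ[ℝ] EM →ₗ[ℝ] ℝ from β), fun _ _ => rfl⟩
    simp only [hL]
    show Continuous (fun m : Fin 2 → EM => L (m 0) (m 1) - L (m 1) (m 0))
    fun_prop

/-- A differential form on `M` is smooth if its values on smooth vector fields are. -/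
def VForm.Smooth {k : ℕ} (α : VForm EM M k ℝ) : Prop :=
  ∀ X : Fin k → VecField EM M, (∀ i, (X i).Smooth) →
    ContMDiff 𝓘(ℝ, EM) 𝓘(ℝ, ℝ) ∞ (fun x => α x (fun i => X i x))

/-- The pull-back of a differential form. -/
def VForm.pullback {k : ℕ} (Φ : M → M) (α : VForm EM M k ℝ) : VForm EM M k ℝ := fun x =>
  (α (Φ x)).compContinuousLinearMap (mfderiv 𝓘(ℝ, EM) 𝓘(ℝ, EM) Φ x)

variable (EM M) in
/-- (Not necessarily smooth) one-forms on `M`. -/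
abbrev OneForm := ∀ x : M, TangentSpace 𝓘(ℝ, EM) x →L[ℝ] ℝ

/-- A one-form is smooth if its values on smooth vector fields are. -/
def OneForm.Smooth (ξ : OneForm EM M) : Prop :=
  ∀ X : VecField EM M, X.Smooth → ContMDiff 𝓘(ℝ, EM) 𝓘(ℝ, ℝ) ∞ (fun x => ξ x (X x))

/-- `i_X dξ`. -/
def OneForm.contractD (X : VecField EM M) (ξ : OneForm EM M) : OneForm EM M := fun x =>
  LinearMap.toContinuousLinearMap (contract ((VForm.ofOne ξ).extD x).toAlternatingMap (X x))

/-- The Lie derivative of a one-form, by Cartan's formula `L_X ξ = i_X dξ + d(ξ(X))`. -/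
def OneForm.lieDeriv (X : VecField EM M) (ξ : OneForm EM M) : OneForm EM M := fun x =>
  ξ.contractD X x +
    (show TangentSpace 𝓘(ℝ, EM) x →L[ℝ] ℝ from mfderiv 𝓘(ℝ, EM) 𝓘(ℝ, ℝ) (fun y => ξ y (X y)) x)

namespace PrincipalBundle

variable (Q : PrincipalBundle EM M EG G EP P)

/-- One-forms on `M` with values in `ad P`. -/
abbrev AdForm := ∀ x : M, TangentSpace 𝓘(ℝ, EM) x →ₗ[ℝ] Q.adP x

/-- Smoothness of one-forms with values in `ad P`. -/
def SmoothForm (a : Q.AdForm) : Prop :=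
  ∀ X : VecField EM M, X.Smooth → Q.SmoothAd (fun x => a x (X x))

/-- The fibres of the vector bundle `E = T ⊕ ad P ⊕ T^*`. -/
abbrev EFib (x : M) : Type _ :=
  TangentSpace 𝓘(ℝ, EM) x × Q.adP x × (TangentSpace 𝓘(ℝ, EM) x →L[ℝ] ℝ)

/-- Smooth sections of `E`. -/
def SmoothE (e : ∀ x, Q.EFib x) : Prop :=
  VecField.Smooth (fun x => (e x).1) ∧ Q.SmoothAd (fun x => (e x).2.1) ∧
    OneForm.Smooth (fun x => (e x).2.2)

variable (c : LinearMap.BilinForm ℝ (GroupLieAlgebra 𝓘(ℝ, EG) G))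

/-- The pairing `⟨X + r + ξ, Y + t + η⟩ = ½ (η(X) + ξ(Y)) + c(r, t)` on the fibres of `E`. -/
def pairE (x : M) (e e' : Q.EFib x) : ℝ :=
  (1 / 2) * (e'.2.2 e.1 + e.2.2 e'.1) + Q.pairing c x e.2.1 e'.2.1

variable {Q} in
/-- The Dorfman bracket on sections of `E`. -/
def dorfman (θ : Q.Connection) (H : VForm EM M 3 ℝ) (e e' : ∀ x, Q.EFib x) : ∀ x, Q.EFib x :=
  let X : VecField EM M := fun x => (e x).1
  let r : Q.AdSection := fun x => (e x).2.1
  let ξ : OneForm EM M := fun x => (e x).2.2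
  let Y : VecField EM M := fun x => (e' x).1
  let t : Q.AdSection := fun x => (e' x).2.1
  let η : OneForm EM M := fun x => (e' x).2.2
  fun x =>
    ( mlieBracket 𝓘(ℝ, EM) X Y x,
      -⁅r x, t x⁆ - θ.curv x ![X x, Y x] + θ.covDeriv t x (X x) - θ.covDeriv r x (Y x),
      η.lieDeriv X x - ξ.contractD Y x
        + LinearMap.toContinuousLinearMap
          (contract₂ (H x).toAlternatingMap (X x) (Y x)
            + (2 : ℝ) • ((Q.pairing c x).flip (t x) ∘ₗ θ.covDeriv r x)
            + (2 : ℝ) • ((Q.pairing c x).flip (t x) ∘ₗ contract (θ.curv x) (X x))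
            - (2 : ℝ) • ((Q.pairing c x).flip (r x) ∘ₗ contract (θ.curv x) (Y x))) )

variable {Q} in
/-- The group `Aut E` of automorphisms of the vector bundle `E` (covering diffeomorphisms of `M`)
that preserve the pairing and the bracket. -/
def AutE (θ : Q.Connection) (H : VForm EM M 3 ℝ) :
    Subgroup (BundleAut (EM := EM) Q.EFib Q.SmoothE) where
  carrier := {f | (∀ x (e e' : Q.EFib x),
      Q.pairE c (f.base x) (f.fib x e) (f.fib x e') = Q.pairE c x e e') ∧
    ∀ e e', Q.SmoothE e → Q.SmoothE e' →
      f.push (dorfman c θ H e e') = dorfman c θ H (f.push e) (f.push e')}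
  mul_mem' := fun {f g} hf hg => ⟨fun x e e' =>
      (hf.1 (g.base x) (g.fib x e) (g.fib x e')).trans (hg.1 x e e'), fun e e' he he' => by
    rw [f.push_mul, f.push_mul, f.push_mul, hg.2 e e' he he',
      hf.2 _ _ (g.smooth_push.2 he) (g.smooth_push.2 he')]⟩
  one_mem' := ⟨fun _ _ _ => rfl, fun e e' _ _ => by simp only [BundleAut.push_one]⟩
  inv_mem' := fun {f} hf => ⟨fun y e e' => by
      have h := hf.1 (f⁻¹.base y) (f⁻¹.fib y e) (f⁻¹.fib y e')
      refine h.symm.trans ?_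
      have key : ∀ (p q p' q' : Σ x, Q.EFib x) (_ : p = p') (_ : q = q')
          (h : p.1 = q.1) (h' : p'.1 = q'.1),
          Q.pairE c p.1 p.2 (h ▸ q.2) = Q.pairE c p'.1 p'.2 (h' ▸ q'.2) := by
        rintro p q _ _ rfl rfl h h'; rfl
      exact key (f.total (f⁻¹.total ⟨y, e⟩)) (f.total (f⁻¹.total ⟨y, e'⟩)) ⟨y, e⟩ ⟨y, e'⟩
        (f.total_inv _) (f.total_inv _) rfl rfl, fun e e' he he' => by
    rw [f.push_inv, f.push_inv, f.push_inv]
    have h := hf.2 (f.pull e) (f.pull e') (f.smooth_pull.2 he) (f.smooth_pull.2 he')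
    rw [f.push_pull, f.push_pull] at h
    rw [← h, f.pull_push]⟩

/-- The group of automorphisms of the vector bundle `ad P` (covering diffeomorphisms of `M`) that
preserve the pairing and the bracket of the fibres. -/
def AutAd : Subgroup (BundleAut (EM := EM) (fun x => Q.adP x) Q.SmoothAd) where
  carrier := {ν | (∀ x (r t : Q.adP x),
      Q.pairing c (ν.base x) (ν.fib x r) (ν.fib x t) = Q.pairing c x r t) ∧
    ∀ x (r t : Q.adP x), ν.fib x ⁅r, t⁆ = ⁅ν.fib x r, ν.fib x t⁆}
  mul_mem' := fun {f g} hf hg => ⟨fun x r t =>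
      (hf.1 (g.base x) (g.fib x r) (g.fib x t)).trans (hg.1 x r t), fun x r t =>
      (congrArg (f.fib (g.base x)) (hg.2 x r t)).trans (hf.2 _ _ _)⟩
  one_mem' := ⟨fun _ _ _ => rfl, fun _ _ _ => rfl⟩
  inv_mem' := fun {f} hf => by
    have inv : ∀ y (r : Q.adP y), f.fib (f⁻¹.base y) (f⁻¹.fib y r) =
        (BundleAut.castEquiv (V := fun x => Q.adP x) (f.base.apply_symm_apply y)).symm r := f.fib_inv
    have cast_pair : ∀ {x y : M} (h : x = y) (r t : Q.adP y), Q.pairing c x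
        ((BundleAut.castEquiv (V := fun x => Q.adP x) h).symm r) ((BundleAut.castEquiv (V := fun x => Q.adP x) h).symm t) = Q.pairing c y r t := by
      rintro x _ rfl r t; rfl
    have cast_lie : ∀ {x y : M} (h : x = y) (r t : Q.adP y),
        (BundleAut.castEquiv (V := fun x => Q.adP x) h).symm ⁅r, t⁆ =
          ⁅(BundleAut.castEquiv (V := fun x => Q.adP x) h).symm r, (BundleAut.castEquiv (V := fun x => Q.adP x) h).symm t⁆ := by
      rintro x _ rfl r t; rfl
    refine ⟨fun y r t => ?_, fun y r t => ?_⟩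
    · refine (hf.1 (f⁻¹.base y) (f⁻¹.fib y r) (f⁻¹.fib y t)).symm.trans ?_
      exact (congrArg₂ (fun a b => Q.pairing c _ a b) (inv y r) (inv y t)).trans (cast_pair _ r t)
    · apply (f.fib (f⁻¹.base y)).injective
      refine ((inv y ⁅r, t⁆).trans (cast_lie _ r t)).trans ?_
      refine Eq.symm ((hf.2 (f⁻¹.base y) (f⁻¹.fib y r) (f⁻¹.fib y t)).trans ?_)
      exact congrArg₂ (fun a b => ⁅a, b⁆) (inv y r) (inv y t)

variable {Q}

/-- The transformation `f_ν` of the total space of `E`: `dfˇ` on `T`, `ν` on `ad P` and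
`(dfˇ^*)⁻¹` on `T^*`, where `fˇ` is the diffeomorphism covered by `ν`. -/
def diagE (ν : BundleAut (EM := EM) (fun x => Q.adP x) Q.SmoothAd) (p : Σ x, Q.EFib x) :
    Σ x, Q.EFib x :=
  ⟨ν.base p.1, mfderiv 𝓘(ℝ, EM) 𝓘(ℝ, EM) ν.base p.1 p.2.1, ν.fib p.1 p.2.2.1,
    p.2.2.2.comp
      (ν.base.mfderivToContinuousLinearEquiv (by simp) p.1).symm.toContinuousLinearMap⟩

/-- The transformation `(B, a)` of the total space of `E`,
`X + r + ξ ↦ X + (a(X) + r) + (i_X B - c(a(X), a) - 2c(a, r) + ξ)`. -/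
def shearE (B : VForm EM M 2 ℝ) (a : Q.AdForm) (p : Σ x, Q.EFib x) : Σ x, Q.EFib x :=
  ⟨p.1, p.2.1, a p.1 p.2.1 + p.2.2.1,
    LinearMap.toContinuousLinearMap
      (contract (B p.1).toAlternatingMap p.2.1
        - Q.pairing c p.1 (a p.1 p.2.1) ∘ₗ a p.1
        - (2 : ℝ) • ((Q.pairing c p.1).flip p.2.2.1 ∘ₗ a p.1)) + p.2.2.2⟩

/-- The two-form `c(a ∧ b)`, `c(a ∧ b)(v, w) = c(a(v), b(w)) - c(a(w), b(v))`. -/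
def wedge (a b : Q.AdForm) : VForm EM M 2 ℝ := fun x =>
  altOfBilin ((Q.pairing c x).compl₁₂ (a x) (b x))

/-- The action `ν⁻¹ · a` on one-forms with values in `ad P`. -/
def pullForm (ν : BundleAut (EM := EM) (fun x => Q.adP x) Q.SmoothAd) (a : Q.AdForm) : Q.AdForm :=
  fun x => (ν.fib x).symm.toLinearMap ∘ₗ a (ν.base x) ∘ₗ
    (mfderiv 𝓘(ℝ, EM) 𝓘(ℝ, EM) ν.base x).toLinearMap

/-- The wedge product `c(a ∧ β)` of a one-form and a two-form with values in `ad P`, where `β` is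
given by its values on vector fields. -/
def wedge₂ (a : Q.AdForm) (β : VecField EM M → VecField EM M → Q.AdSection)
    (X Y Z : VecField EM M) (x : M) : ℝ :=
  Q.pairing c x (a x (X x)) (β Y Z x) + Q.pairing c x (a x (Y x)) (β Z X x)
    + Q.pairing c x (a x (Z x)) (β X Y x)

/-- The two-form `[a, a]`, `[a, a](X, Y) = 2[a(X), a(Y)]`. -/
def bracketForm (a : Q.AdForm) (X Y : VecField EM M) : Q.AdSection := fun x =>
  (2 : ℝ) • ⁅a x (X x), a x (Y x)⁆

/-- The values of a two-form `β` with values in `ad P` on vector fields. -/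
def evalForm (β : ∀ x : M, TangentSpace 𝓘(ℝ, EM) x [⋀^Fin 2]→ₗ[ℝ] Q.adP x)
    (X Y : VecField EM M) : Q.AdSection := fun x => β x ![X x, Y x]

namespace Connection

variable (θ : Q.Connection)

/-- The exterior covariant derivative `d^θ a`,
`(d^θ a)(X, Y) = d^θ_X (a(Y)) - d^θ_Y (a(X)) - a([X, Y])`. -/
def covDerivForm (a : Q.AdForm) (X Y : VecField EM M) : Q.AdSection := fun x =>
  θ.covDeriv (fun y => a y (Y y)) x (X x) - θ.covDeriv (fun y => a y (X y)) x (Y x)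
    - a x (mlieBracket 𝓘(ℝ, EM) X Y x)

/-- The covariant derivative of the connection `θ + a`, `d^{θ + a}_X r = d^θ_X r + [a(X), r]`. -/
def covDerivAdd (a : Q.AdForm) (X : VecField EM M) (r : Q.AdSection) : Q.AdSection := fun x =>
  θ.covDeriv r x (X x) + ⁅a x (X x), r x⁆

/-- The curvature of the connection `θ + a`, `F_{θ + a} = F + d^θ a + ½ [a, a]`. -/
def curvAdd (a : Q.AdForm) (X Y : VecField EM M) : Q.AdSection := fun x =>
  evalForm θ.curv X Y x + θ.covDerivForm a X Y x + (1 / 2 : ℝ) • bracketForm a X Y x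

/-- The equation `d^θ = ν · d^{θ + a}`. -/
def PreservesDeriv (ν : BundleAut (EM := EM) (fun x => Q.adP x) Q.SmoothAd) (a : Q.AdForm) : Prop :=
  ∀ (X : VecField EM M) (r : Q.AdSection), X.Smooth → Q.SmoothAd r → ∀ x,
    θ.covDeriv r x (X x) =
      ν.push (θ.covDerivAdd a (mpullback 𝓘(ℝ, EM) 𝓘(ℝ, EM) ν.base X) (ν.pull r)) x

/-- The equation `F = ν · F_{θ + a}`. -/
def PreservesCurv (ν : BundleAut (EM := EM) (fun x => Q.adP x) Q.SmoothAd) (a : Q.AdForm) : Prop :=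
  ∀ X Y : VecField EM M, X.Smooth → Y.Smooth → ∀ x,
    θ.curv x ![X x, Y x] =
      ν.push (θ.curvAdd a (mpullback 𝓘(ℝ, EM) 𝓘(ℝ, EM) ν.base X)
        (mpullback 𝓘(ℝ, EM) 𝓘(ℝ, EM) ν.base Y)) x

/-- The equation
`Φ^* H = H - dB + 2c(a ∧ F) + c(a ∧ d^θ a) + (1/3) c(a ∧ [a, a])`. -/
def TransformsH (H : VForm EM M 3 ℝ) (Φ : M → M) (B : VForm EM M 2 ℝ) (a : Q.AdForm) : Prop :=
  ∀ X Y Z : VecField EM M, X.Smooth → Y.Smooth → Z.Smooth → ∀ x,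
    VForm.pullback Φ H x ![X x, Y x, Z x] =
      H x ![X x, Y x, Z x] - B.extD x ![X x, Y x, Z x]
        + 2 * wedge₂ c a (evalForm θ.curv) X Y Z x
        + wedge₂ c a (θ.covDerivForm a) X Y Z x
        + (1 / 3) * wedge₂ c a (bracketForm a) X Y Z x

/-- The Bianchi identity `dH = c(F ∧ F)`. -/
def Bianchi (H : VForm EM M 3 ℝ) : Prop :=
  ∀ (x : M) (v₀ v₁ v₂ v₃ : TangentSpace 𝓘(ℝ, EM) x),
    H.extD x ![v₀, v₁, v₂, v₃] =
      2 * (Q.pairing c x (θ.curv x ![v₀, v₁]) (θ.curv x ![v₂, v₃])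
        - Q.pairing c x (θ.curv x ![v₀, v₂]) (θ.curv x ![v₁, v₃])
        + Q.pairing c x (θ.curv x ![v₀, v₃]) (θ.curv x ![v₁, v₂]))

end Connection
end PrincipalBundle
end Bundle

end TransitiveCourant

open TransitiveCourant

/-! Write φ for the diffeomorphism of `M` covered by an automorphism f of `E`. The bracket of a
section with itself is a pure covector, `[e, e] = d⟨e, e⟩` (`dorfman_self`), and every covector at a
point arises in this way (`exists_deriv_pairE_eq`). Since f preserves bracket and pairing, it must
therefore send a covector ξ to `(dφ^*)⁻¹ξ` (`aut_cotangent`). Pairing with covectors detects the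
tangent component, so by duality f acts on tangent components as dφ (`aut_tangent`). Hence f is
block triangular for `T ⊕ ad P ⊕ T^*`.

Let ν be its block on `ad P` and νa its block from `T` to `ad P`. Orthogonality of f then leaves
little freedom: ν is an isometry, the block from `ad P` to `T^*` is `-2c(a, ·)`, and the symmetric
part of the block from `T` to `T^*` is `-c(a, a)`. The alternating part that remains is `B`, so
pointwise `f = f_ν(B, a)` (`aut_eq`).

It remains to compare brackets. For sections related by `f_ν(B, a)`, the component in `ad P` of the
bracket is transported correctly as soon as ν preserves the fibre bracket, `d^θ = ν · d^{θ+a}` and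
`F = ν · F_{θ+a}` (`dorfman_ad_related`). If ν preserves the pairing and the two equations on `d^θ`
and `F` hold, the component in `T^*` is transported up to the single term `φ^*H - (H - dB + 2c(a ∧
F) + c(a ∧ d^θ a) + ⅓c(a ∧ [a, a]))` (`dorfman_cotangent_related`, whose algebraic core is
`shear_identity`). These computations give sufficiency. For necessity, the component in `ad P` is
tested on two sections of `ad P`, on a vector field and a section of `ad P`, and on two vector
fields; this yields in turn that ν preserves the bracket, the equation for `d^θ` and the equation
for `F`. The extra term must then vanish, which is the equation for `H`.

Two facts about `c` enter the calculus: `d^θ` satisfies the product rule for it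
(`Connection.deriv_pairing`), and `c([w, u], v) + c(u, [w, v]) = 0`. The second is the derivative at
the identity of `Ad`-invariance, and it requires that the derivative of `Ad` be the bracket of left
invariant fields (`hasFDerivAt_Ad`). -/

namespace TransitiveCourant

/-! ### Vector fields, Lie brackets and exterior derivatives in the preferred chart. -/

noncomputable section Cartan

variable {E M W : Type*} [NormedAddCommGroup E] [NormedSpace ℝ E] [FiniteDimensional ℝ E]
  [TopologicalSpace M] [ChartedSpace E M] [IsManifold 𝓘(ℝ, E) ∞ M]
  [NormedAddCommGroup W] [NormedSpace ℝ W]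

instance isManifoldThree : IsManifold 𝓘(ℝ, E) (minSmoothness ℝ 3) M := by
  rw [minSmoothness_of_isRCLikeNormedField]; infer_instance

theorem two_le_infty : minSmoothness ℝ 2 ≤ (∞ : WithTop ℕ∞) := by
  rw [minSmoothness_of_isRCLikeNormedField]; exact ENat.LEInfty.out

/-- The expression of a vector field in the preferred chart at `x₀`. -/
def VecField.inChart (X : VecField E M) (x₀ : M) (z : E) : E :=
  mpullback 𝓘(ℝ, E) 𝓘(ℝ, E) (extChartAt 𝓘(ℝ, E) x₀).symm X z

theorem mfderiv_extChartAt_symm_isInvertible (x₀ : M) {z : E}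
    (hz : z ∈ (extChartAt 𝓘(ℝ, E) x₀).target) :
    (mfderiv 𝓘(ℝ, E) 𝓘(ℝ, E) (extChartAt 𝓘(ℝ, E) x₀).symm z).IsInvertible := by
  have := isInvertible_mfderivWithin_extChartAt_symm (I := 𝓘(ℝ, E)) (x := x₀) hz
  simpa [mfderivWithin_univ] using this

theorem VecField.mfderiv_symm_inChart (X : VecField E M) (x₀ : M) {z : E}
    (hz : z ∈ (extChartAt 𝓘(ℝ, E) x₀).target) :
    mfderiv 𝓘(ℝ, E) 𝓘(ℝ, E) (extChartAt 𝓘(ℝ, E) x₀).symm z (X.inChart x₀ z) =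
      X ((extChartAt 𝓘(ℝ, E) x₀).symm z) := by
  obtain ⟨L, hL⟩ := mfderiv_extChartAt_symm_isInvertible x₀ hz
  simp only [VecField.inChart, mpullback_apply]
  rw [← hL]
  exact (congrArg (fun T : TangentSpace 𝓘(ℝ, E) ((extChartAt 𝓘(ℝ, E) x₀).symm z) →L[ℝ]
    TangentSpace 𝓘(ℝ, E) z => L (T (X ((extChartAt 𝓘(ℝ, E) x₀).symm z))))
    (ContinuousLinearMap.inverse_equiv L)).trans (L.apply_symm_apply _)

/-- The tangent space at `x` is the model space, identified through the preferred chart at `x`. In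
this identification the chart has identity differential at its own centre, so objects computed in
the chart at `x` can be compared with those on `M` without a change of frame. -/
theorem mfderiv_extChartAt_self (x : M) (v : TangentSpace 𝓘(ℝ, E) x) :
    (mfderiv 𝓘(ℝ, E) 𝓘(ℝ, E) (extChartAt 𝓘(ℝ, E) x) x v : E) = v := by
  have h : MDifferentiableAt 𝓘(ℝ, E) 𝓘(ℝ, E) (extChartAt 𝓘(ℝ, E) x) x :=
    (contMDiffAt_extChartAt (n := ∞)).mdifferentiableAt (by simp)
  rw [h.mfderiv]
  have e : writtenInExtChartAt 𝓘(ℝ, E) 𝓘(ℝ, E) x (extChartAt 𝓘(ℝ, E) x)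
      =ᶠ[𝓝 (extChartAt 𝓘(ℝ, E) x x)] id := by
    filter_upwards [extChartAt_target_mem_nhds (I := 𝓘(ℝ, E)) x] with z hz
    simp only [writtenInExtChartAt, Function.comp, extChartAt_self_eq, id, modelWithCornersSelf_coe]
    exact (extChartAt 𝓘(ℝ, E) x).right_inv hz
  have e2 : fderivWithin ℝ (writtenInExtChartAt 𝓘(ℝ, E) 𝓘(ℝ, E) x (extChartAt 𝓘(ℝ, E) x))
      (Set.range 𝓘(ℝ, E)) (extChartAt 𝓘(ℝ, E) x x) = ContinuousLinearMap.id ℝ E := by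
    rw [modelWithCornersSelf_coe, Set.range_id, fderivWithin_univ, e.fderiv_eq]
    exact fderiv_id
  exact congrArg (fun T : E →L[ℝ] E => T v) e2

theorem mfderiv_extChartAt_symm_self (x : M) (v : E) :
    (mfderiv 𝓘(ℝ, E) 𝓘(ℝ, E) (extChartAt 𝓘(ℝ, E) x).symm (extChartAt 𝓘(ℝ, E) x x) v : E) = v := by
  have h : MDifferentiableAt 𝓘(ℝ, E) 𝓘(ℝ, E) (extChartAt 𝓘(ℝ, E) x).symm
      (extChartAt 𝓘(ℝ, E) x x) :=
    (((contMDiffOn_extChartAt_symm (n := ∞) x).contMDiffAt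
      (extChartAt_target_mem_nhds x))).mdifferentiableAt (by simp)
  rw [h.mfderiv]
  have e : writtenInExtChartAt 𝓘(ℝ, E) 𝓘(ℝ, E) (extChartAt 𝓘(ℝ, E) x x)
      (extChartAt 𝓘(ℝ, E) x).symm =ᶠ[𝓝 (extChartAt 𝓘(ℝ, E) x x)] id := by
    filter_upwards [extChartAt_target_mem_nhds (I := 𝓘(ℝ, E)) x] with z hz
    simp only [writtenInExtChartAt, Function.comp, id, extChartAt_to_inv]
    exact (extChartAt 𝓘(ℝ, E) x).right_inv hz
  have e2 : fderivWithin ℝ (writtenInExtChartAt 𝓘(ℝ, E) 𝓘(ℝ, E) (extChartAt 𝓘(ℝ, E) x x)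
      (extChartAt 𝓘(ℝ, E) x).symm)
      (Set.range 𝓘(ℝ, E)) (extChartAt 𝓘(ℝ, E) x x) = ContinuousLinearMap.id ℝ E := by
    rw [modelWithCornersSelf_coe, Set.range_id, fderivWithin_univ, e.fderiv_eq]
    exact fderiv_id
  exact congrArg (fun T : E →L[ℝ] E => T v) e2

theorem mfderiv_eq_fderiv_extChartAt {g : M → W} {x : M}
    (hg : MDifferentiableAt 𝓘(ℝ, E) 𝓘(ℝ, W) g x) (v : TangentSpace 𝓘(ℝ, E) x) :
    (mfderiv 𝓘(ℝ, E) 𝓘(ℝ, W) g x v : W) =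
      fderiv ℝ (fun z => g ((extChartAt 𝓘(ℝ, E) x).symm z)) (extChartAt 𝓘(ℝ, E) x x) v := by
  rw [hg.mfderiv]
  have e : fderivWithin ℝ (writtenInExtChartAt 𝓘(ℝ, E) 𝓘(ℝ, W) x g) (Set.range 𝓘(ℝ, E))
      (extChartAt 𝓘(ℝ, E) x x) =
      fderiv ℝ (fun z => g ((extChartAt 𝓘(ℝ, E) x).symm z)) (extChartAt 𝓘(ℝ, E) x x) := by
    rw [modelWithCornersSelf_coe, Set.range_id, fderivWithin_univ]
    rfl
  exact congrArg (fun T : E →L[ℝ] W => T v) e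

theorem VecField.inChart_self (X : VecField E M) (x : M) :
    X.inChart x (extChartAt 𝓘(ℝ, E) x x) = X x := by
  have h := X.mfderiv_symm_inChart x (mem_extChartAt_target x)
  have h2 := mfderiv_extChartAt_symm_self x (X.inChart x (extChartAt 𝓘(ℝ, E) x x))
  have key : ∀ y, y = x → (X y : E) = X x := by rintro y rfl; rfl
  exact h2.symm.trans ((h : (_ : E) = _).trans (key _ (extChartAt_to_inv x)))

theorem VecField.differentiableAt_inChart {X : VecField E M} {x : M}
    (hX : MDifferentiableAt 𝓘(ℝ, E) 𝓘(ℝ, E).tangent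
      (fun x => (⟨x, X x⟩ : TangentBundle 𝓘(ℝ, E) M)) x) :
    DifferentiableAt ℝ (X.inChart x) (extChartAt 𝓘(ℝ, E) x x) := by
  have h := (mdifferentiableWithinAt_univ.2 hX).differentiableWithinAt_mpullbackWithin_vectorField
  simp only [modelWithCornersSelf_coe, Set.range_id, Set.preimage_univ, Set.inter_univ,
    mpullbackWithin_univ] at h
  exact differentiableWithinAt_univ.1 h

theorem mlieBracket_eq_inChart (X Y : VecField E M) (x : M) :
    (mlieBracket 𝓘(ℝ, E) X Y x : E) =
      lieBracket ℝ (X.inChart x) (Y.inChart x) (extChartAt 𝓘(ℝ, E) x x) := by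
  rw [← mlieBracketWithin_univ, mlieBracketWithin_apply]
  have e : mfderiv 𝓘(ℝ, E) 𝓘(ℝ, E) (extChartAt 𝓘(ℝ, E) x) x = ContinuousLinearMap.id ℝ E :=
    ContinuousLinearMap.ext fun v => mfderiv_extChartAt_self x v
  rw [e]
  simp only [modelWithCornersSelf_coe, Set.range_id, Set.preimage_univ, Set.inter_univ,
    mpullbackWithin_univ]
  refine (congrArg (fun T : E →L[ℝ] E => T (lieBracketWithin ℝ (X.inChart x) (Y.inChart x) Set.univ
    (extChartAt 𝓘(ℝ, E) x x))) (ContinuousLinearMap.inverse_id (R := ℝ) (M := E))).trans ?_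
  rw [lieBracketWithin_univ]
  rfl

theorem VForm.inChart_apply {k : ℕ} (α : VForm E M k W) (X : Fin k → VecField E M) (x : M) {z : E}
    (hz : z ∈ (extChartAt 𝓘(ℝ, E) x).target) :
    α.inChart x z (fun i => (X i).inChart x z) =
      α ((extChartAt 𝓘(ℝ, E) x).symm z) (fun i => X i ((extChartAt 𝓘(ℝ, E) x).symm z)) := by
  show (α ((extChartAt 𝓘(ℝ, E) x).symm z)) (fun i => _) = _
  congr 1
  funext i
  exact (X i).mfderiv_symm_inChart x hz

theorem VForm.inChart_self {k : ℕ} (α : VForm E M k W) (x : M) (v : Fin k → E) :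
    α.inChart x (extChartAt 𝓘(ℝ, E) x x) v = α x v := by
  refine Eq.trans ?_ (VForm.apply_congr α (extChartAt_to_inv (I := 𝓘(ℝ, E)) x) v)
  show (α ((extChartAt 𝓘(ℝ, E) x).symm (extChartAt 𝓘(ℝ, E) x x))) (fun i => _) = _
  congr 1
  funext i
  exact mfderiv_extChartAt_symm_self x (v i)

/-- The derivative of a function along a vector field. -/
def VecField.deriv (X : VecField E M) (g : M → ℝ) (x : M) : ℝ :=
  mfderiv 𝓘(ℝ, E) 𝓘(ℝ, ℝ) g x (X x)

/-- The invariant formula for the exterior derivative on vector fields. -/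
theorem VForm.extD_apply_vecField {k : ℕ} {α : VForm E M (k + 1) ℝ} {x : M}
    (hα : DifferentiableAt ℝ (α.inChart x) (extChartAt 𝓘(ℝ, E) x x))
    (X : Fin (k + 2) → VecField E M) (hX : ∀ i, (X i).Smooth)
    (hd : ∀ i : Fin (k + 2), MDifferentiableAt 𝓘(ℝ, E) 𝓘(ℝ, ℝ)
      (fun y => α y (i.removeNth (X · y))) x) :
    α.extD x (X · x) =
      (∑ i, (-1) ^ i.val • (X i).deriv (fun y => α y (i.removeNth (X · y))) x) -
        ∑ i : Fin (k + 1), ∑ j ≥ i,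
          (-1) ^ (i + j : ℕ) •
            α x (Matrix.vecCons (mlieBracket 𝓘(ℝ, E) (X i.castSucc) (X j.succ) x)
              (j.removeNth <| i.castSucc.removeNth (X · x))) := by
  have h := extDeriv_apply_vectorField (V := fun i => (X i).inChart x) hα
    (fun i => VecField.differentiableAt_inChart ((hX i).mdifferentiableAt (by simp)))
  have e0 : (fun i => (X i).inChart x (extChartAt 𝓘(ℝ, E) x x)) = fun i => (X i x : E) :=
    funext fun i => (X i).inChart_self x
  have l : α.extD x (X · x) = extDeriv (α.inChart x) (extChartAt 𝓘(ℝ, E) x x)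
      (fun i => (X i).inChart x (extChartAt 𝓘(ℝ, E) x x)) := by rw [e0]; rfl
  refine (l.trans h).trans (congrArg₂ _ ?_ ?_)
  · refine Finset.sum_congr rfl fun i _ => congrArg _ ?_
    rw [VecField.deriv, mfderiv_eq_fderiv_extChartAt (hd i), (X i).inChart_self x]
    congr 1
    -- The vector space formula differentiates chart expressions. On a whole neighbourhood these
    -- coincide with the function obtained by evaluating the form on the fields, so the derivatives
    -- agree as well.
    apply Filter.EventuallyEq.fderiv_eq
    filter_upwards [extChartAt_target_mem_nhds (I := 𝓘(ℝ, E)) x] with z hz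
    exact α.inChart_apply (fun j => X (i.succAbove j)) x hz
  · refine Finset.sum_congr rfl fun i _ => Finset.sum_congr rfl fun j _ => congrArg _ ?_
    rw [α.inChart_self x, ← mlieBracket_eq_inChart, e0]
    rfl

end Cartan

/-! ### Extending pointwise data to global smooth fields and functions. -/

noncomputable section Extension

variable {E M W : Type*} [NormedAddCommGroup E] [NormedSpace ℝ E] [FiniteDimensional ℝ E]
  [TopologicalSpace M] [ChartedSpace E M] [IsManifold 𝓘(ℝ, E) ∞ M]

theorem mfderiv_extChartAt_comp_symm (x₀ : M) {z : E} (hz : z ∈ (extChartAt 𝓘(ℝ, E) x₀).target)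
    (v : E) :
    (mfderiv 𝓘(ℝ, E) 𝓘(ℝ, E) (extChartAt 𝓘(ℝ, E) x₀) ((extChartAt 𝓘(ℝ, E) x₀).symm z)
      (mfderiv 𝓘(ℝ, E) 𝓘(ℝ, E) (extChartAt 𝓘(ℝ, E) x₀).symm z v) : E) = v := by
  have h := mfderiv_extChartAt_comp_mfderivWithin_extChartAt_symm (I := 𝓘(ℝ, E)) hz
  rw [modelWithCornersSelf_coe, Set.range_id, mfderivWithin_univ] at h
  exact congrArg (fun T : E →L[ℝ] E => T v) h

variable [T2Space M]

theorem exists_bump {x₀ : M} {U : Set M} (hU : U ∈ 𝓝 x₀) :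
    ∃ ψ : M → ℝ, ContMDiff 𝓘(ℝ, E) 𝓘(ℝ, ℝ) ∞ ψ ∧ tsupport ψ ⊆ U ∧ ∀ᶠ y in 𝓝 x₀, ψ y = 1 := by
  obtain ⟨f, -, hf⟩ := (SmoothBumpFunction.nhds_basis_tsupport (I := 𝓘(ℝ, E)) x₀).mem_iff.1 hU
  exact ⟨f, f.contMDiff, hf, f.eventuallyEq_one⟩

/-- A smooth vector field that is constant in the preferred chart near a point. -/
theorem VecField.exists_eventually_inChart (x₀ : M) (v : E) :
    ∃ V : VecField E M, V.Smooth ∧ ∀ᶠ z in 𝓝 (extChartAt 𝓘(ℝ, E) x₀ x₀), V.inChart x₀ z = v := by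
  have hs : (chartAt E x₀).source ∈ 𝓝 x₀ := chart_source_mem_nhds E x₀
  obtain ⟨ψ, h1, h2, h3⟩ := exists_bump (E := E) hs
  -- The pull-back of a constant field is smooth on the chart domain only; the bump function extends
  -- it by zero and leaves it unchanged near `x₀`.
  let V₀ : VecField E M := mpullback 𝓘(ℝ, E) 𝓘(ℝ, E) (extChartAt 𝓘(ℝ, E) x₀) (fun _ => v)
  have hV₀ : ContMDiffOn 𝓘(ℝ, E) 𝓘(ℝ, E).tangent ∞
      (fun x => (⟨x, V₀ x⟩ : TangentBundle 𝓘(ℝ, E) M)) (chartAt E x₀).source := fun y hy =>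
    (ContMDiffAt.mpullback_vectorField_preimage (n := ∞) (m := ∞)
      (contMDiffAt_vectorSpace_iff_contDiffAt.2 contDiffAt_const)
      (contMDiffAt_extChartAt' hy)
      (isInvertible_mfderiv_extChartAt (by simpa using hy)) (by simp)).contMDiffWithinAt
  refine ⟨fun y => ψ y • V₀ y,
    ContMDiffOn.smul_section_of_tsupport h1.contMDiffOn (chartAt E x₀).open_source h2 hV₀, ?_⟩
  have t : ∀ᶠ z in 𝓝 (extChartAt 𝓘(ℝ, E) x₀ x₀), ψ ((extChartAt 𝓘(ℝ, E) x₀).symm z) = 1 := by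
    have c := continuousAt_extChartAt_symm (I := 𝓘(ℝ, E)) x₀
    rw [ContinuousAt, extChartAt_to_inv] at c
    exact c h3
  filter_upwards [extChartAt_target_mem_nhds (I := 𝓘(ℝ, E)) x₀, t] with z hz ht
  refine (mfderiv_extChartAt_comp_symm x₀ hz _).symm.trans ?_
  rw [VecField.mfderiv_symm_inChart _ _ hz]
  simp only [ht]
  have hy : (extChartAt 𝓘(ℝ, E) x₀).symm z ∈ (extChartAt 𝓘(ℝ, E) x₀).source :=
    (extChartAt 𝓘(ℝ, E) x₀).map_target hz
  obtain ⟨L, hL⟩ := isInvertible_mfderiv_extChartAt (I := 𝓘(ℝ, E)) hy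
  have e : V₀ ((extChartAt 𝓘(ℝ, E) x₀).symm z) = (mfderiv 𝓘(ℝ, E) 𝓘(ℝ, E) (extChartAt 𝓘(ℝ, E) x₀)
      ((extChartAt 𝓘(ℝ, E) x₀).symm z)).inverse v := rfl
  rw [one_smul, e, ← hL]
  exact (congrArg (fun T : E →L[ℝ] TangentSpace 𝓘(ℝ, E) ((extChartAt 𝓘(ℝ, E) x₀).symm z) =>
    L (T v)) (ContinuousLinearMap.inverse_equiv L)).trans (L.apply_symm_apply _)

theorem VecField.exists_eq (x : M) (v : TangentSpace 𝓘(ℝ, E) x) :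
    ∃ V : VecField E M, V.Smooth ∧ V x = v := by
  obtain ⟨V, h1, h2⟩ := VecField.exists_eventually_inChart (E := E) x v
  exact ⟨V, h1, (V.inChart_self x).symm.trans h2.self_of_nhds⟩

/-- A smooth function with a prescribed differential that vanishes at a point. -/
theorem exists_mfderiv_eq (x : M) (ξ : TangentSpace 𝓘(ℝ, E) x →L[ℝ] ℝ) :
    ∃ h : M → ℝ, ContMDiff 𝓘(ℝ, E) 𝓘(ℝ, ℝ) ∞ h ∧ h x = 0 ∧
      ∀ v, (mfderiv 𝓘(ℝ, E) 𝓘(ℝ, ℝ) h x v : ℝ) = ξ v := by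
  have hs : (chartAt E x).source ∈ 𝓝 x := chart_source_mem_nhds E x
  obtain ⟨f, -, hf⟩ := (SmoothBumpFunction.nhds_basis_tsupport (I := 𝓘(ℝ, E)) x).mem_iff.1 hs
  let ξ' : E →L[ℝ] ℝ := ξ
  let g : M → ℝ := fun y => ξ' (extChartAt 𝓘(ℝ, E) x y - extChartAt 𝓘(ℝ, E) x x)
  have hg : ContMDiffOn 𝓘(ℝ, E) 𝓘(ℝ, ℝ) ∞ g (chartAt E x).source := by
    have h1 : ContDiff ℝ ∞ (fun z : E => ξ' (z - extChartAt 𝓘(ℝ, E) x x)) := by fun_prop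
    exact h1.contMDiff.comp_contMDiffOn contMDiffOn_extChartAt
  have hh := f.contMDiff_smul hg
  have ev : (fun y => f y • g y) =ᶠ[𝓝 x] g := by
    filter_upwards [f.eventuallyEq_one] with y hy
    simp [hy]
  refine ⟨fun y => f y • g y, hh, by simp [g], fun v => ?_⟩
  rw [mfderiv_eq_fderiv_extChartAt (hh.mdifferentiableAt (by simp))]
  have ev2 : (fun z => f ((extChartAt 𝓘(ℝ, E) x).symm z) • g ((extChartAt 𝓘(ℝ, E) x).symm z))
      =ᶠ[𝓝 (extChartAt 𝓘(ℝ, E) x x)] fun z => ξ' (z - extChartAt 𝓘(ℝ, E) x x) := by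
    have c := continuousAt_extChartAt_symm (I := 𝓘(ℝ, E)) x
    rw [ContinuousAt, extChartAt_to_inv] at c
    filter_upwards [extChartAt_target_mem_nhds (I := 𝓘(ℝ, E)) x, c ev] with z hz h2
    exact (h2 : _).trans (congrArg (fun t => ξ' (t - extChartAt 𝓘(ℝ, E) x x))
      ((extChartAt 𝓘(ℝ, E) x).right_inv hz))
  rw [ev2.fderiv_eq]
  have h3 : HasFDerivAt (fun z => ξ' (z - extChartAt 𝓘(ℝ, E) x x)) ξ' (extChartAt 𝓘(ℝ, E) x x) :=
    ξ'.hasFDerivAt.comp _ ((hasFDerivAt_id _).sub_const _)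
  rw [h3.fderiv]
  rfl

/-- Smoothness of a form is tested on global fields, whereas the exterior derivative differentiates
its chart expression. Fields that are locally constant in the chart recover each coefficient of the
form in a basis, and the form depends linearly on these finitely many coefficients. -/
theorem VForm.Smooth.differentiableAt_inChart {k : ℕ} {α : VForm E M k ℝ} (hα : α.Smooth) (x : M) :
    DifferentiableAt ℝ (α.inChart x) (extChartAt 𝓘(ℝ, E) x x) := by
  let b := Module.finBasis ℝ E
  let ev : (E [⋀^Fin k]→L[ℝ] ℝ) →ₗ[ℝ] ((Fin k → Fin (Module.finrank ℝ E)) → ℝ) :=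
    { toFun := fun β m => β (fun i => b (m i))
      map_add' := fun _ _ => rfl
      map_smul' := fun _ _ => rfl }
  have inj : LinearMap.ker ev = ⊥ := by
    rw [LinearMap.ker_eq_bot']
    intro β hβ
    apply ContinuousAlternatingMap.toAlternatingMap_injective
    exact Module.Basis.ext_alternating b fun m _ => congrFun hβ m
  -- `L` reconstructs an alternating form from its values on basis vectors.
  obtain ⟨L, hL⟩ := ev.exists_leftInverse_of_injective inj
  have d : DifferentiableAt ℝ (fun z => ev (α.inChart x z)) (extChartAt 𝓘(ℝ, E) x x) := by
    rw [differentiableAt_pi]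
    intro m
    choose V hV hV' using fun i => VecField.exists_eventually_inChart x (b (m i))
    have c := (hα V hV).mdifferentiableAt (x := x) (by simp)
    have c2 := c.comp_of_eq (y := x) (f := (extChartAt 𝓘(ℝ, E) x).symm) (I := 𝓘(ℝ, E))
      (x := extChartAt 𝓘(ℝ, E) x x) (((contMDiffOn_extChartAt_symm (n := ∞) x).contMDiffAt
      (extChartAt_target_mem_nhds x)).mdifferentiableAt (by simp)) (extChartAt_to_inv x)
    refine c2.differentiableAt.congr_of_eventuallyEq ?_
    filter_upwards [Filter.eventually_all.2 hV', extChartAt_target_mem_nhds (I := 𝓘(ℝ, E)) x]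
      with z hz hz2
    refine Eq.trans ?_ (α.inChart_apply V x hz2)
    exact congrArg (α.inChart x z) (funext fun i => (hz i).symm)
  have e : α.inChart x = fun z => LinearMap.toContinuousLinearMap L (ev (α.inChart x z)) :=
    funext fun z => (congrArg (fun T => T (α.inChart x z)) hL).symm
  rw [e]
  exact (LinearMap.toContinuousLinearMap L).differentiableAt.comp _ d

end Extension

/-! ### Derivatives along vector fields, and Cartan's formula in degrees one and two. -/

noncomputable section Derivations

variable {E M : Type*} [NormedAddCommGroup E] [NormedSpace ℝ E] [FiniteDimensional ℝ E]
  [TopologicalSpace M] [ChartedSpace E M] [IsManifold 𝓘(ℝ, E) ∞ M]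

namespace VecField

variable {X Y Z : VecField E M} {g h : M → ℝ} {x : M}

theorem deriv_add (X : VecField E M) (hg : MDifferentiableAt 𝓘(ℝ, E) 𝓘(ℝ, ℝ) g x)
    (hh : MDifferentiableAt 𝓘(ℝ, E) 𝓘(ℝ, ℝ) h x) :
    X.deriv (fun y => g y + h y) x = X.deriv g x + X.deriv h x :=
  congrArg (fun T => T (X x)) (mfderiv_add hg hh)

theorem deriv_sub (X : VecField E M) (hg : MDifferentiableAt 𝓘(ℝ, E) 𝓘(ℝ, ℝ) g x)
    (hh : MDifferentiableAt 𝓘(ℝ, E) 𝓘(ℝ, ℝ) h x) :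
    X.deriv (fun y => g y - h y) x = X.deriv g x - X.deriv h x :=
  congrArg (fun T => T (X x)) (mfderiv_sub hg hh)

theorem deriv_const_mul (X : VecField E M) (hg : MDifferentiableAt 𝓘(ℝ, E) 𝓘(ℝ, ℝ) g x) (t : ℝ) :
    X.deriv (fun y => t * g y) x = t * X.deriv g x :=
  congrArg (fun T => T (X x)) (const_smul_mfderiv hg t)

theorem deriv_mul (X : VecField E M) (hg : MDifferentiableAt 𝓘(ℝ, E) 𝓘(ℝ, ℝ) g x)
    (hh : MDifferentiableAt 𝓘(ℝ, E) 𝓘(ℝ, ℝ) h x) :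
    X.deriv (fun y => g y * h y) x = g x * X.deriv h x + X.deriv g x * h x := by
  have h1 := congrArg (fun T => T (X x)) (hg.hasMFDerivAt.mul hh.hasMFDerivAt).mfderiv
  refine h1.trans ?_
  show g x * X.deriv h x + h x * X.deriv g x = _
  rw [mul_comm (h x)]

theorem Smooth.mlieBracket (hX : X.Smooth) (hY : Y.Smooth) :
    VecField.Smooth (mlieBracket 𝓘(ℝ, E) X Y) :=
  haveI : IsManifold 𝓘(ℝ, E) (((⊤ : ℕ∞) : WithTop ℕ∞) + 1) M :=
    inferInstanceAs (IsManifold 𝓘(ℝ, E) ∞ M)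
  ContDiff.mlieBracket_vectorField (m := ⊤) (n := ⊤) hX hY (by
    rw [minSmoothness_of_isRCLikeNormedField]; exact le_rfl)

theorem Smooth.deriv (hX : X.Smooth) (hg : ContMDiff 𝓘(ℝ, E) 𝓘(ℝ, ℝ) ∞ g) :
    ContMDiff 𝓘(ℝ, E) 𝓘(ℝ, ℝ) ∞ (X.deriv g) := by
  have h1 := (hg.contMDiff_tangentMap (m := ∞) (by simp)).comp hX
  exact (contMDiff_snd_tangentBundle_modelSpace ℝ 𝓘(ℝ, ℝ)).comp h1

end VecField

variable [T2Space M]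

theorem VForm.extD_ofOne {ξ : OneForm E M} (hξ : ξ.Smooth) {X Y : VecField E M} (hX : X.Smooth)
    (hY : Y.Smooth) (x : M) :
    (VForm.ofOne ξ).extD x ![X x, Y x] = X.deriv (fun y => ξ y (Y y)) x -
      Y.deriv (fun y => ξ y (X y)) x - ξ x (mlieBracket 𝓘(ℝ, E) X Y x) := by
  have hs : VForm.Smooth (VForm.ofOne ξ) := fun X hX => hξ (X 0) (hX 0)
  have h := VForm.extD_apply_vecField (hs.differentiableAt_inChart x) ![X, Y]
    (fun i => by fin_cases i <;> assumption)
    (fun i => by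
      fin_cases i
      · exact (hξ Y hY).mdifferentiableAt (by simp)
      · exact (hξ X hX).mdifferentiableAt (by simp))
  have e : (fun i => (![X, Y] : Fin 2 → VecField E M) i x) = ![X x, Y x] := by
    funext i; fin_cases i <;> rfl
  rw [← e, h]
  rw [Fin.sum_univ_two, Fin.sum_univ_succ, Fin.sum_univ_zero, add_zero,
    show Finset.Ici (0 : Fin 1) = {0} by decide, Finset.sum_singleton]
  show (-1 : ℤ) ^ 0 • X.deriv (fun y => ξ y (Y y)) x + (-1 : ℤ) ^ 1 • Y.deriv (fun y => ξ y (X y)) x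
    - (-1 : ℤ) ^ 0 • ξ x (mlieBracket 𝓘(ℝ, E) X Y x) = _
  simp only [pow_zero, pow_one, one_smul, neg_smul]
  ring

theorem VForm.extD_two {B : VForm E M 2 ℝ} (hB : B.Smooth) {X Y Z : VecField E M} (hX : X.Smooth)
    (hY : Y.Smooth) (hZ : Z.Smooth) (x : M) :
    B.extD x ![X x, Y x, Z x] = X.deriv (fun y => B y ![Y y, Z y]) x -
      Y.deriv (fun y => B y ![X y, Z y]) x + Z.deriv (fun y => B y ![X y, Y y]) x
      - B x ![mlieBracket 𝓘(ℝ, E) X Y x, Z x] + B x ![mlieBracket 𝓘(ℝ, E) X Z x, Y x]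
      - B x ![mlieBracket 𝓘(ℝ, E) Y Z x, X x] := by
  have e2 : ∀ X Y : VecField E M, (fun y => B y (fun i => (![X, Y] : Fin 2 → VecField E M) i y)) =
      fun y => B y ![X y, Y y] := fun X Y => funext fun y => congrArg (B y) (by
    funext i; fin_cases i <;> rfl)
  have sm : ∀ X Y : VecField E M, X.Smooth → Y.Smooth →
      MDifferentiableAt 𝓘(ℝ, E) 𝓘(ℝ, ℝ) (fun y => B y ![X y, Y y]) x := fun X Y hX hY => by
    rw [← e2]
    exact (hB ![X, Y] (fun i => by fin_cases i <;> assumption)).mdifferentiableAt (by simp)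
  have r0 : (fun y => B y (Fin.removeNth (0 : Fin 3) fun i => (![X, Y, Z] : Fin 3 → VecField E M) i y)) =
      fun y => B y ![Y y, Z y] := funext fun y => congrArg (B y) (by
    funext i; fin_cases i <;> rfl)
  have r1 : (fun y => B y (Fin.removeNth (1 : Fin 3) fun i => (![X, Y, Z] : Fin 3 → VecField E M) i y)) =
      fun y => B y ![X y, Z y] := funext fun y => congrArg (B y) (by
    funext i; fin_cases i <;> rfl)
  have r2 : (fun y => B y (Fin.removeNth (2 : Fin 3) fun i => (![X, Y, Z] : Fin 3 → VecField E M) i y)) =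
      fun y => B y ![X y, Y y] := funext fun y => congrArg (B y) (by
    funext i; fin_cases i <;> rfl)
  have h := VForm.extD_apply_vecField (hB.differentiableAt_inChart x) ![X, Y, Z]
    (fun i => by fin_cases i <;> assumption)
    (fun i => by
      fin_cases i
      · exact r0 ▸ sm Y Z hY hZ
      · exact r1 ▸ sm X Z hX hZ
      · exact r2 ▸ sm X Y hX hY)
  have e : (fun i => (![X, Y, Z] : Fin 3 → VecField E M) i x) = ![X x, Y x, Z x] := by
    funext i; fin_cases i <;> rfl
  have v : ∀ (w : TangentSpace 𝓘(ℝ, E) x) (m : Fin 1 → TangentSpace 𝓘(ℝ, E) x),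
      (Matrix.vecCons w m : Fin 2 → TangentSpace 𝓘(ℝ, E) x) = ![w, m 0] := fun w m => by
    funext i; fin_cases i <;> rfl
  rw [← e, h, Fin.sum_univ_three, r0, r1, r2, Fin.sum_univ_two,
    show Finset.Ici (0 : Fin 2) = {0, 1} by decide, show Finset.Ici (1 : Fin 2) = {1} by decide,
    Finset.sum_singleton, Finset.sum_pair (by decide)]
  -- In the bracket terms the index `j` is counted after `i` has been removed. The pairs (0,0),
  -- (0,1), (1,1) leave the third, second and first field as the other argument.
  have q : ∀ (w : TangentSpace 𝓘(ℝ, E) x) (i : Fin 2) (j : Fin 2) (U : VecField E M),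
      j.removeNth (i.castSucc.removeNth (fun i => (![X, Y, Z] : Fin 3 → VecField E M) i x)) 0 = U x →
      B x (Matrix.vecCons w (j.removeNth (i.castSucc.removeNth
        (fun i => (![X, Y, Z] : Fin 3 → VecField E M) i x)))) = B x ![w, U x] := fun w i j U h => by
    rw [v, h]
  rw [q _ 0 0 Z rfl, q _ 0 1 Y rfl, q _ 1 1 X rfl]
  show (-1 : ℤ) ^ 0 • X.deriv (fun y => B y ![Y y, Z y]) x
    + (-1 : ℤ) ^ 1 • Y.deriv (fun y => B y ![X y, Z y]) x
    + (-1 : ℤ) ^ 2 • Z.deriv (fun y => B y ![X y, Y y]) x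
    - ((-1 : ℤ) ^ 0 • B x ![mlieBracket 𝓘(ℝ, E) X Y x, Z x]
      + (-1 : ℤ) ^ 1 • B x ![mlieBracket 𝓘(ℝ, E) X Z x, Y x]
      + (-1 : ℤ) ^ 2 • B x ![mlieBracket 𝓘(ℝ, E) Y Z x, X x]) = _
  simp only [pow_zero, pow_one, one_smul, neg_smul, even_two, Even.neg_pow, one_pow]
  ring

end Derivations

/-! ### Infinitesimal invariance of an `Ad`-invariant form. -/

noncomputable section AdInvariance

variable {E G : Type*} [NormedAddCommGroup E] [NormedSpace ℝ E] [FiniteDimensional ℝ E]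
  [TopologicalSpace G] [ChartedSpace E G] [Group G] [LieGroup 𝓘(ℝ, E) ∞ G]

variable (E G) in
/-- The multiplication of a Lie group in the preferred chart at `1`. -/
def chartMul (p : E × E) : E :=
  extChartAt 𝓘(ℝ, E) (1 : G)
    ((extChartAt 𝓘(ℝ, E) (1 : G)).symm p.1 * (extChartAt 𝓘(ℝ, E) (1 : G)).symm p.2)

variable (E G) in
/-- The coordinates of `1`. -/
def chartOne : E := extChartAt 𝓘(ℝ, E) (1 : G) 1

theorem contDiffAt_chartMul : ContDiffAt ℝ ∞ (chartMul E G) (chartOne E G, chartOne E G) := by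
  rw [← contMDiffAt_iff_contDiffAt]
  have hs : ContMDiffAt 𝓘(ℝ, E) 𝓘(ℝ, E) ∞ (extChartAt 𝓘(ℝ, E) (1 : G)).symm (chartOne E G) :=
    (contMDiffOn_extChartAt_symm (n := ∞) (1 : G)).contMDiffAt (extChartAt_target_mem_nhds (1 : G))
  have h1 : ContMDiffAt 𝓘(ℝ, E × E) 𝓘(ℝ, E) ∞
      (fun p : E × E => (extChartAt 𝓘(ℝ, E) (1 : G)).symm p.1) (chartOne E G, chartOne E G) :=
    ContMDiffAt.comp (I' := 𝓘(ℝ, E)) (chartOne E G, chartOne E G) hs contDiff_fst.contMDiff.contMDiffAt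
  have h2 : ContMDiffAt 𝓘(ℝ, E × E) 𝓘(ℝ, E) ∞
      (fun p : E × E => (extChartAt 𝓘(ℝ, E) (1 : G)).symm p.2) (chartOne E G, chartOne E G) :=
    ContMDiffAt.comp (I' := 𝓘(ℝ, E)) (chartOne E G, chartOne E G) hs contDiff_snd.contMDiff.contMDiffAt
  refine ContMDiffAt.comp_of_eq (I' := 𝓘(ℝ, E)) (y := (1 : G)) contMDiffAt_extChartAt (h1.mul h2) ?_
  show (extChartAt 𝓘(ℝ, E) (1 : G)).symm (chartOne E G) * (extChartAt 𝓘(ℝ, E) (1 : G)).symm (chartOne E G) = 1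
  rw [chartOne, extChartAt_to_inv, one_mul]

theorem mulInvariantVectorField_one' (v : GroupLieAlgebra 𝓘(ℝ, E) G) :
    (mulInvariantVectorField v (1 : G) : E) = v := by
  have : (fun k : G => 1 * k) = id := by funext k; simp
  have key : ∀ (f : G → G) (hf : f = id), (mfderiv 𝓘(ℝ, E) 𝓘(ℝ, E) f 1 v : E) = v := by
    rintro f rfl; simp [mfderiv_id]
  exact key _ this

/-- Differentiate `(g h g⁻¹) g = g h` at `h = 1`: right translation by `g` carries `Ad g v` to the
left translate of `v`. This is the link between `Ad` and left invariant fields. -/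
theorem mfderiv_mul_right_Ad (g : G) (v : GroupLieAlgebra 𝓘(ℝ, E) G) :
    (mfderiv 𝓘(ℝ, E) 𝓘(ℝ, E) (fun h : G => h * g) 1 (Ad g v) : E) = mulInvariantVectorField v g := by
  have e : (fun h : G => h * g) ∘ (fun h : G => g * h * g⁻¹) = fun h => g * h := by
    funext h; simp
  have d1 : MDifferentiableAt 𝓘(ℝ, E) 𝓘(ℝ, E) (fun h : G => g * h * g⁻¹) 1 :=
    (contMDiff_conj g).mdifferentiableAt (by simp)
  have d2 : ∀ k : G, MDifferentiableAt 𝓘(ℝ, E) 𝓘(ℝ, E) (fun h : G => h * g) k := fun k =>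
    (contMDiff_id.mul contMDiff_const :
      ContMDiff 𝓘(ℝ, E) 𝓘(ℝ, E) ∞ (fun h : G => h * g)).mdifferentiableAt (by simp)
  have h2 := mfderiv_comp (I' := 𝓘(ℝ, E)) (1 : G) (d2 (g * 1 * g⁻¹)) d1
  rw [e] at h2
  have h3 := congrArg (fun L : E →L[ℝ] E => L v) h2
  have key : ∀ y : G, y = 1 → ∀ w : E, (mfderiv 𝓘(ℝ, E) 𝓘(ℝ, E) (fun h : G => h * g) y w : E) =
      mfderiv 𝓘(ℝ, E) 𝓘(ℝ, E) (fun h : G => h * g) 1 w := by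
    rintro y rfl w; rfl
  exact (key (g * 1 * g⁻¹) (by simp) (Ad g v)).symm.trans h3.symm

theorem inChart_mulInvariantVectorField (v : GroupLieAlgebra 𝓘(ℝ, E) G) {z : E}
    (hz : z ∈ (extChartAt 𝓘(ℝ, E) (1 : G)).target) :
    VecField.inChart (fun g : G => mulInvariantVectorField v g) 1 z =
      mfderiv 𝓘(ℝ, E) 𝓘(ℝ, E) (extChartAt 𝓘(ℝ, E) (1 : G)) ((extChartAt 𝓘(ℝ, E) (1 : G)).symm z)
        (mulInvariantVectorField v ((extChartAt 𝓘(ℝ, E) (1 : G)).symm z)) := by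
  rw [← VecField.mfderiv_symm_inChart (fun g : G => mulInvariantVectorField v g) 1 hz]
  exact (mfderiv_extChartAt_comp_symm (1 : G) hz _).symm

theorem mdifferentiableAt_extChartAt_symm_target {z : E}
    (hz : z ∈ (extChartAt 𝓘(ℝ, E) (1 : G)).target) :
    MDifferentiableAt 𝓘(ℝ, E) 𝓘(ℝ, E) (extChartAt 𝓘(ℝ, E) (1 : G))
      ((extChartAt 𝓘(ℝ, E) (1 : G)).symm z) := by
  have : (extChartAt 𝓘(ℝ, E) (1 : G)).symm z ∈ (chartAt E (1 : G)).source := by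
    simpa using (extChartAt 𝓘(ℝ, E) (1 : G)).map_target hz
  exact (contMDiffAt_extChartAt' (n := ∞) this).mdifferentiableAt (by simp)

/-- The partial derivative in the second variable at the identity is left translation, and left
translates of `v` form the invariant field. -/
theorem fderiv_chartMul_right (v : GroupLieAlgebra 𝓘(ℝ, E) G) {z : E}
    (hz : z ∈ (extChartAt 𝓘(ℝ, E) (1 : G)).target)
    (hd : DifferentiableAt ℝ (chartMul E G) (z, chartOne E G)) :
    fderiv ℝ (chartMul E G) (z, chartOne E G) (0, v) =
      VecField.inChart (fun g : G => mulInvariantVectorField v g) 1 z := by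
  set g : G := (extChartAt 𝓘(ℝ, E) (1 : G)).symm z with hg
  have h1 : fderiv ℝ (chartMul E G) (z, chartOne E G) (0, v) =
      fderiv ℝ (fun y => chartMul E G (z, y)) (chartOne E G) v := by
    have hc : HasFDerivAt (fun y : E => (z, y)) (ContinuousLinearMap.inr ℝ E E) (chartOne E G) :=
      hasFDerivAt_prodMk_right z (chartOne E G)
    have := (hd.hasFDerivAt.comp (chartOne E G) hc).fderiv
    exact (congrArg (fun T : E →L[ℝ] E => T v) this).symm
  have dl : MDifferentiableAt 𝓘(ℝ, E) 𝓘(ℝ, E) (fun h : G => g * h) 1 :=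
    (contMDiff_const.mul contMDiff_id :
      ContMDiff 𝓘(ℝ, E) 𝓘(ℝ, E) ∞ (fun h : G => g * h)).mdifferentiableAt (by simp)
  have dx : ∀ y : G, y = g → MDifferentiableAt 𝓘(ℝ, E) 𝓘(ℝ, E) (extChartAt 𝓘(ℝ, E) (1 : G)) y := by
    rintro y rfl; exact mdifferentiableAt_extChartAt_symm_target hz
  have h2 := mfderiv_eq_fderiv_extChartAt (g := extChartAt 𝓘(ℝ, E) (1 : G) ∘ fun h : G => g * h)
    (x := (1 : G)) ((dx _ (mul_one g)).comp (1 : G) dl) v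
  rw [mfderiv_comp (I' := 𝓘(ℝ, E)) (1 : G) (dx _ (mul_one g)) dl] at h2
  have key : ∀ y : G, y = g → ∀ w : E, (mfderiv 𝓘(ℝ, E) 𝓘(ℝ, E) (extChartAt 𝓘(ℝ, E) (1 : G)) y w : E) =
      mfderiv 𝓘(ℝ, E) 𝓘(ℝ, E) (extChartAt 𝓘(ℝ, E) (1 : G)) g w := by
    rintro y rfl w; rfl
  rw [h1, inChart_mulInvariantVectorField v hz]
  exact h2.symm.trans (key _ (mul_one g) _)

/-- The partial derivative in the first variable at the identity is right translation. Together with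
`fderiv_chartMul_right` this expresses `Ad` through the first derivatives of the multiplication
alone. -/
theorem fderiv_chartMul_left (v : GroupLieAlgebra 𝓘(ℝ, E) G) {z : E}
    (hz : z ∈ (extChartAt 𝓘(ℝ, E) (1 : G)).target)
    (hd : DifferentiableAt ℝ (chartMul E G) (chartOne E G, z)) :
    fderiv ℝ (chartMul E G) (chartOne E G, z) (Ad ((extChartAt 𝓘(ℝ, E) (1 : G)).symm z) v, 0) =
      VecField.inChart (fun g : G => mulInvariantVectorField v g) 1 z := by
  set g : G := (extChartAt 𝓘(ℝ, E) (1 : G)).symm z with hg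
  have h1 : fderiv ℝ (chartMul E G) (chartOne E G, z) (Ad g v, 0) =
      fderiv ℝ (fun y => chartMul E G (y, z)) (chartOne E G) (Ad g v) := by
    have hc : HasFDerivAt (fun y : E => (y, z)) (ContinuousLinearMap.inl ℝ E E) (chartOne E G) :=
      hasFDerivAt_prodMk_left (chartOne E G) z
    have := (hd.hasFDerivAt.comp (chartOne E G) hc).fderiv
    exact (congrArg (fun T : E →L[ℝ] E => T (Ad g v)) this).symm
  have dl : MDifferentiableAt 𝓘(ℝ, E) 𝓘(ℝ, E) (fun h : G => h * g) 1 :=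
    (contMDiff_id.mul contMDiff_const :
      ContMDiff 𝓘(ℝ, E) 𝓘(ℝ, E) ∞ (fun h : G => h * g)).mdifferentiableAt (by simp)
  have dx : ∀ y : G, y = g → MDifferentiableAt 𝓘(ℝ, E) 𝓘(ℝ, E) (extChartAt 𝓘(ℝ, E) (1 : G)) y := by
    rintro y rfl; exact mdifferentiableAt_extChartAt_symm_target hz
  have h2 := mfderiv_eq_fderiv_extChartAt (g := extChartAt 𝓘(ℝ, E) (1 : G) ∘ fun h : G => h * g)
    (x := (1 : G)) ((dx _ (one_mul g)).comp (1 : G) dl) (Ad g v)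
  rw [mfderiv_comp (I' := 𝓘(ℝ, E)) (1 : G) (dx _ (one_mul g)) dl] at h2
  have key : ∀ y : G, y = g → ∀ w w' : E, w = w' →
      (mfderiv 𝓘(ℝ, E) 𝓘(ℝ, E) (extChartAt 𝓘(ℝ, E) (1 : G)) y w : E) =
      mfderiv 𝓘(ℝ, E) 𝓘(ℝ, E) (extChartAt 𝓘(ℝ, E) (1 : G)) g w' := by
    rintro y rfl w w' rfl; rfl
  rw [h1, inChart_mulInvariantVectorField v hz]
  exact h2.symm.trans (key _ (one_mul g) _ _ (mfderiv_mul_right_Ad g v))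

/-- The derivative of the adjoint representation at `1`, in the preferred chart, is the bracket. -/
theorem hasFDerivAt_Ad (v : GroupLieAlgebra 𝓘(ℝ, E) G) : ∃ L : E →L[ℝ] E,
    HasFDerivAt (fun z => (Ad ((extChartAt 𝓘(ℝ, E) (1 : G)).symm z) v : E)) L (chartOne E G) ∧
      ∀ w : GroupLieAlgebra 𝓘(ℝ, E) G, L w = (⁅w, v⁆ : GroupLieAlgebra 𝓘(ℝ, E) G) := by
  set o := chartOne E G with ho
  set m := chartMul E G with hm
  set χ := extChartAt 𝓘(ℝ, E) (1 : G) with hχ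
  have cd : ContDiffAt ℝ ∞ m (o, o) := contDiffAt_chartMul
  have ev : ∀ᶠ p in 𝓝 (o, o), DifferentiableAt ℝ m p :=
    ((cd.of_le (m := 1) (by exact_mod_cast le_top)).eventually (by simp)).mono
      fun p hp => hp.differentiableAt (by simp)
  have tgt : ∀ᶠ z in 𝓝 o, z ∈ χ.target := extChartAt_target_mem_nhds (1 : G)
  have evr : ∀ᶠ z in 𝓝 o, DifferentiableAt ℝ m (z, o) := by
    have : Filter.Tendsto (fun z : E => (z, o)) (𝓝 o) (𝓝 (o, o)) := by
      have : Continuous (fun z : E => (z, o)) := by fun_prop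
      exact this.tendsto o
    exact this.eventually ev
  have evl : ∀ᶠ z in 𝓝 o, DifferentiableAt ℝ m (o, z) := by
    have : Filter.Tendsto (fun z : E => (o, z)) (𝓝 o) (𝓝 (o, o)) := by
      have : Continuous (fun z : E => (o, z)) := by fun_prop
      exact this.tendsto o
    exact this.eventually ev
  have cd1 : DifferentiableAt ℝ (fderiv ℝ m) (o, o) :=
    (cd.fderiv_right (m := 1) (by rw [one_add_one_eq_two]; exact ENat.LEInfty.out)).differentiableAt (by simp)
  set D := fderiv ℝ (fderiv ℝ m) (o, o) with hD
  -- Symmetry of the second derivative will match a mixed term coming from right translations with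
  -- one coming from left translations.
  have symm : ∀ p q : E × E, D p q = D q p := by
    have := cd.isSymmSndFDerivAt two_le_infty
    exact this
  -- left invariant fields
  have V : ∀ u : GroupLieAlgebra 𝓘(ℝ, E) G,
      VecField.inChart (fun g : G => mulInvariantVectorField u g) 1 =ᶠ[𝓝 o]
        fun z => fderiv ℝ m (z, o) (0, u) := fun u => by
    filter_upwards [tgt, evr] with z hz hz2
    exact (fderiv_chartMul_right u hz hz2).symm
  have dr : ∀ u : E, HasFDerivAt (fun z => fderiv ℝ m (z, o) (0, u))
      (((ContinuousLinearMap.apply ℝ E ((0, u) : E × E)).comp D).comp (ContinuousLinearMap.inl ℝ E E)) o :=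
    fun u => ((ContinuousLinearMap.apply ℝ E ((0, u) : E × E)).hasFDerivAt.comp (o, o)
      cd1.hasFDerivAt).comp (f := fun z : E => (z, o)) o (hasFDerivAt_prodMk_left o o)
  have V0 : ∀ u : GroupLieAlgebra 𝓘(ℝ, E) G,
      VecField.inChart (fun g : G => mulInvariantVectorField u g) 1 o = u := fun u =>
    (VecField.inChart_self (fun g : G => mulInvariantVectorField u g) 1).trans
      (mulInvariantVectorField_one' u)
  -- The bracket is the antisymmetrised mixed second derivative of the multiplication at the
  -- identity.
  have br : ∀ u w : GroupLieAlgebra 𝓘(ℝ, E) G, (⁅u, w⁆ : GroupLieAlgebra 𝓘(ℝ, E) G) =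
      D (u, 0) (0, w) - D (w, 0) (0, u) := fun u w => by
    rw [GroupLieAlgebra.bracket_def]
    refine (mlieBracket_eq_inChart (fun g : G => mulInvariantVectorField u g)
      (fun g : G => mulInvariantVectorField w g) 1).trans ?_
    rw [lieBracket_eq]
    show fderiv ℝ _ o _ - fderiv ℝ _ o _ = _
    rw [(V u).fderiv_eq, (V w).fderiv_eq, (dr u).fderiv, (dr w).fderiv]
    show D ((VecField.inChart (fun g : G => mulInvariantVectorField u g) 1 o : E), 0) (0, w)
      - D ((VecField.inChart (fun g : G => mulInvariantVectorField w g) 1 o : E), 0) (0, u) = _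
    rw [V0, V0]
  -- right translations
  let T : E → E →L[ℝ] E := fun z => (fderiv ℝ m (o, z)).comp (ContinuousLinearMap.inl ℝ E E)
  let T' : E →L[ℝ] E →L[ℝ] E :=
    (((ContinuousLinearMap.compL ℝ E (E × E) E).flip (ContinuousLinearMap.inl ℝ E E)).comp D).comp
      (ContinuousLinearMap.inr ℝ E E)
  have dT : HasFDerivAt T T' o :=
    (((ContinuousLinearMap.compL ℝ E (E × E) E).flip
      (ContinuousLinearMap.inl ℝ E E)).hasFDerivAt.comp (o, o) cd1.hasFDerivAt).comp
      (f := fun z : E => (o, z)) o (hasFDerivAt_prodMk_right o o)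
  have eT : ∀ u : GroupLieAlgebra 𝓘(ℝ, E) G, ∀ᶠ z in 𝓝 o, T z (Ad (χ.symm z) u) =
      VecField.inChart (fun g : G => mulInvariantVectorField u g) 1 z := fun u => by
    filter_upwards [tgt, evl] with z hz hz2
    exact fderiv_chartMul_left u hz hz2
  have e1 : χ.symm o = 1 := extChartAt_to_inv (1 : G)
  have T1 : T o = 1 := ContinuousLinearMap.ext fun (u : GroupLieAlgebra 𝓘(ℝ, E) G) => by
    have h := (eT u).self_of_nhds
    rw [e1] at h
    exact ((congrArg (T o) (Ad_one (G := G) u).symm).trans h).trans (V0 u)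
  have hinv : HasFDerivAt (fun z => Ring.inverse (T z)) (-T') o := by
    have h1 := hasFDerivAt_ringInverse (𝕜 := ℝ) (1 : (E →L[ℝ] E)ˣ)
    rw [Units.val_one, ← T1] at h1
    refine (h1.comp o dT).congr_fderiv ?_
    ext w u
    simp
  have unit : ∀ᶠ z in 𝓝 o, IsUnit (T z) := by
    have : ∀ᶠ S in 𝓝 (T o), IsUnit S := by
      rw [T1]; exact (Units.isOpen (R := E →L[ℝ] E)).mem_nhds isUnit_one
    exact dT.continuousAt.eventually this
  have eA : (fun z => (Ad (χ.symm z) v : E)) =ᶠ[𝓝 o]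
      fun z => Ring.inverse (T z) (fderiv ℝ m (z, o) (0, v)) := by
    filter_upwards [unit, eT v, V v] with z h1 h2 h3
    have h4 := congrArg (fun S : E →L[ℝ] E => S (Ad (χ.symm z) v)) (Ring.inverse_mul_cancel (T z) h1)
    refine h4.symm.trans ?_
    exact congrArg (fun y => (Ring.inverse (T z) : E →L[ℝ] E) y) (h2.trans h3)
  refine ⟨_, ((hinv.clm_apply (dr v)).congr_of_eventuallyEq eA), fun w => ?_⟩
  rw [br]
  have e0 : fderiv ℝ m (o, o) (0, v) = v := ((V v).self_of_nhds.symm.trans (V0 v))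
  have e2 : Ring.inverse (T o) = 1 := by rw [T1, Ring.inverse_one]
  -- The product rule has two terms: the derivative of the invariant field and that of the inverse
  -- of `T`. After one use of symmetry their sum is the formula `br` for `⁅w, v⁆`.
  show Ring.inverse (T o) (D (w, 0) (0, v)) + -(D (0, w) (fderiv ℝ m (o, o) (0, v), 0)) = _
  rw [symm (0, w), sub_eq_add_neg, e0, e2]
  rfl

/-- In the chart at the identity, `c(Ad u, Ad v)` is a constant function of the group element; its
derivative in the direction `w` is the left-hand side by `hasFDerivAt_Ad`. -/
theorem bilin_lie_of_Ad_invariant (c : LinearMap.BilinForm ℝ (GroupLieAlgebra 𝓘(ℝ, E) G))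
    (hc : ∀ (g : G) u v, c (Ad g u) (Ad g v) = c u v) (w u v : GroupLieAlgebra 𝓘(ℝ, E) G) :
    c ⁅w, u⁆ v + c u ⁅w, v⁆ = 0 := by
  obtain ⟨b, hb⟩ : ∃ b : E →L[ℝ] E →L[ℝ] ℝ, ∀ u v : GroupLieAlgebra 𝓘(ℝ, E) G, c u v = b u v :=
    ⟨LinearMap.toContinuousBilinearMap (show E →ₗ[ℝ] E →ₗ[ℝ] ℝ from c), fun _ _ => rfl⟩
  obtain ⟨L₁, h1, h1'⟩ := hasFDerivAt_Ad u
  obtain ⟨L₂, h2, h2'⟩ := hasFDerivAt_Ad v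
  have h := (b.hasFDerivAt.comp (chartOne E G) h1).clm_apply h2
  have e : (fun z => b (Ad ((extChartAt 𝓘(ℝ, E) (1 : G)).symm z) u : E)
      (Ad ((extChartAt 𝓘(ℝ, E) (1 : G)).symm z) v : E)) = fun _ => c u v := by
    funext z
    exact (hb _ _).symm.trans (hc _ u v)
  have h3 := (h.congr_of_eventuallyEq (f₁ := fun _ => c u v) (by
    exact Filter.Eventually.of_forall fun z => (congrFun e z).symm)).unique (hasFDerivAt_const (c u v) _)
  have h4 := congrArg (fun S : E →L[ℝ] ℝ => S w) h3
  have a0 : ∀ u : GroupLieAlgebra 𝓘(ℝ, E) G,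
      (Ad ((extChartAt 𝓘(ℝ, E) (1 : G)).symm (chartOne E G)) u : E) = u := fun u => by
    have e1 : (extChartAt 𝓘(ℝ, E) (1 : G)).symm (chartOne E G) = 1 := extChartAt_to_inv (1 : G)
    rw [e1]
    exact Ad_one u
  refine Eq.trans ?_ h4
  show _ = b (Ad ((extChartAt 𝓘(ℝ, E) (1 : G)).symm (chartOne E G)) u) (L₂ w)
    + b (L₁ w) (Ad ((extChartAt 𝓘(ℝ, E) (1 : G)).symm (chartOne E G)) v)
  rw [h1', h2', hb, hb, add_comm]
  exact congrArg₂ (fun s t : E => b s (⁅w, v⁆ : GroupLieAlgebra 𝓘(ℝ, E) G)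
    + b (⁅w, u⁆ : GroupLieAlgebra 𝓘(ℝ, E) G) t) (a0 u).symm (a0 v).symm

end AdInvariance

/-! ### Smooth dependence of `Ad` on the group element. -/

noncomputable section AdSmooth

variable {E G : Type*} [NormedAddCommGroup E] [NormedSpace ℝ E] [FiniteDimensional ℝ E]
  [TopologicalSpace G] [ChartedSpace E G] [Group G] [LieGroup 𝓘(ℝ, E) ∞ G]

/-- `Ad g A` is the image of the vector `(0, A)` at `(g, 1)` under the tangent map of `(g, h) ↦ g h
g⁻¹`. That tangent map is smooth, and so is the section of tangent vectors fed into it. -/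
theorem contMDiff_Ad (A : GroupLieAlgebra 𝓘(ℝ, E) G) :
    ContMDiff (M' := E) 𝓘(ℝ, E) 𝓘(ℝ, E) ∞ (fun g : G => Ad g A) := by
  let k : G × G → G := fun p => p.1 * p.2 * p.1⁻¹
  have hk : ContMDiff (𝓘(ℝ, E).prod 𝓘(ℝ, E)) 𝓘(ℝ, E) ∞ k :=
    (contMDiff_fst.mul contMDiff_snd).mul contMDiff_fst.inv
  let F₁ : G → TangentBundle 𝓘(ℝ, E) G × TangentBundle 𝓘(ℝ, E) G := fun g =>
    (⟨g, 0⟩, ⟨1, A⟩)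
  have S₁ : ContMDiff 𝓘(ℝ, E) (𝓘(ℝ, E).tangent.prod 𝓘(ℝ, E).tangent) ∞ F₁ :=
    (Bundle.contMDiff_zeroSection _ _).prodMk contMDiff_const
  let S : G → TangentBundle 𝓘(ℝ, E) G := tangentMap (𝓘(ℝ, E).prod 𝓘(ℝ, E)) 𝓘(ℝ, E) k ∘
    (equivTangentBundleProd 𝓘(ℝ, E) G 𝓘(ℝ, E) G).symm ∘ F₁
  have hS : ContMDiff 𝓘(ℝ, E) 𝓘(ℝ, E).tangent ∞ S :=
    (hk.contMDiff_tangentMap (m := ∞) (by simp)).comp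
      (contMDiff_equivTangentBundleProd_symm.comp S₁)
  have hS2 : ∀ g, ((S g).2 : E) = Ad g A := fun g => by
    let A' : E := A
    have h1 := mfderiv_prod_eq_add_apply (f := k) (p := (g, 1)) (v := ((0 : E), A'))
      (hk.mdifferentiableAt (by simp))
    refine Eq.trans h1 ?_
    exact (congrArg (· + _) (map_zero (mfderiv 𝓘(ℝ, E) 𝓘(ℝ, E) (fun z : G => k (z, 1)) g))).trans
      (zero_add _)
  -- All the vectors `S g` lie over `1`, where the trivialization centred at `1` does not alter the
  -- fibre component.
  have key : ∀ (q : G) (_ : q = 1) (p : TangentBundle 𝓘(ℝ, E) G) (_ : p.1 = 1),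
      (trivializationAt E (TangentSpace 𝓘(ℝ, E)) q p).2 = p.2 := by
    rintro _ rfl ⟨_, v⟩ rfl
    exact (tangentBundleCore 𝓘(ℝ, E) G).coordChange_self _ _ (mem_chart_source E _) v
  intro g
  refine (Bundle.contMDiffAt_totalSpace.1 (hS g)).2.congr_of_eventuallyEq
    (Filter.Eventually.of_forall fun h => ?_)
  refine (hS2 h).symm.trans (key _ ?_ _ ?_).symm
  · show g * 1 * g⁻¹ = 1
    simp
  · show h * 1 * h⁻¹ = 1
    simp

end AdSmooth

/-! ### Sections of `ad P`: smoothness, covariant derivative, pairing and extension. -/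

noncomputable section AdBundle

variable {EM M EG G EP P : Type*}
  [NormedAddCommGroup EM] [NormedSpace ℝ EM] [FiniteDimensional ℝ EM]
  [TopologicalSpace M] [ChartedSpace EM M] [IsManifold 𝓘(ℝ, EM) ∞ M]
  [NormedAddCommGroup EG] [NormedSpace ℝ EG] [FiniteDimensional ℝ EG]
  [TopologicalSpace G] [ChartedSpace EG G] [Group G] [LieGroup 𝓘(ℝ, EG) ∞ G]
  [NormedAddCommGroup EP] [NormedSpace ℝ EP] [FiniteDimensional ℝ EP]
  [TopologicalSpace P] [ChartedSpace EP P] [IsManifold 𝓘(ℝ, EP) ∞ P]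

namespace PrincipalBundle

variable {Q : PrincipalBundle EM M EG G EP P}

theorem SmoothAd.zero : Q.SmoothAd (fun _ => 0) := contMDiff_const

theorem SmoothAd.add {r t : Q.AdSection} (hr : Q.SmoothAd r) (ht : Q.SmoothAd t) :
    Q.SmoothAd (fun x => r x + t x) :=
  ContMDiff.add (G := EG) hr ht

theorem SmoothAd.neg {r : Q.AdSection} (hr : Q.SmoothAd r) : Q.SmoothAd (fun x => -r x) := by
  have h : ContMDiff 𝓘(ℝ, EG) 𝓘(ℝ, EG) ∞ (fun z : EG => -z) := contDiff_neg.contMDiff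
  exact h.comp hr

theorem SmoothAd.sub {r t : Q.AdSection} (hr : Q.SmoothAd r) (ht : Q.SmoothAd t) :
    Q.SmoothAd (fun x => r x - t x) := by
  simp only [sub_eq_add_neg]
  exact hr.add ht.neg

theorem Connection.covDeriv_add (θ : Q.Connection) {r t : Q.AdSection} (hr : Q.SmoothAd r)
    (ht : Q.SmoothAd t) (x : M) (v : TangentSpace 𝓘(ℝ, EM) x) :
    θ.covDeriv (fun y => r y + t y) x v = θ.covDeriv r x v + θ.covDeriv t x v :=
  Subtype.ext (funext fun u => congrArg (fun T : EP →L[ℝ] EG => T (θ.horAt u v))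
    (mfderiv_add (ContMDiff.mdifferentiableAt hr (by simp))
      (ContMDiff.mdifferentiableAt ht (by simp)) (z := u.1)))

theorem Connection.covDeriv_zero (θ : Q.Connection) (x : M) (v : TangentSpace 𝓘(ℝ, EM) x) :
    θ.covDeriv (fun _ => 0) x v = 0 :=
  Subtype.ext (funext fun u => congrArg (fun T : EP →L[ℝ] EG => T (θ.horAt u v))
    (mfderiv_const (c := (0 : EG)) (x := u.1)))

section Pairing

variable (c : LinearMap.BilinForm ℝ (GroupLieAlgebra 𝓘(ℝ, EG) G))

theorem pairing_symm (hc : c.IsSymm) (x : M) (r t : Q.adP x) :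
    Q.pairing c x r t = Q.pairing c x t r := hc.eq _ _

variable (hc : ∀ (g : G) A B, c (Ad g A) (Ad g B) = c A B)
include hc

theorem pairing_lie (x : M) (w r t : Q.adP x) :
    Q.pairing c x ⁅w, r⁆ t + Q.pairing c x r ⁅w, t⁆ = 0 :=
  bilin_lie_of_Ad_invariant c hc _ _ _

/-- Smooth sections of `ad P` are smooth maps on `P`; composing them with the local section of `P`
with group coordinate `1` brings the pairing down to `M`. -/
theorem contMDiff_pairing {r t : Q.AdSection} (hr : Q.SmoothAd r) (ht : Q.SmoothAd t) :
    ContMDiff 𝓘(ℝ, EM) 𝓘(ℝ, ℝ) ∞ (fun x => Q.pairing c x (r x) (t x)) := by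
  obtain ⟨b, hb⟩ : ∃ b : EG →L[ℝ] EG →L[ℝ] ℝ, ∀ u v : GroupLieAlgebra 𝓘(ℝ, EG) G, c u v = b u v :=
    ⟨LinearMap.toContinuousBilinearMap (show EG →ₗ[ℝ] EG →ₗ[ℝ] ℝ from c), fun _ _ => rfl⟩
  intro x
  obtain ⟨U, e, hU, hx, hs, htg, h1, h2, he⟩ := Q.exists_localTriv x
  have m1 : ∀ y ∈ U, (y, (1 : G)) ∈ e.target := fun y hy => by rw [htg]; exact ⟨hy, trivial⟩
  have ds : ContMDiffAt 𝓘(ℝ, EM) 𝓘(ℝ, EP) ∞ (fun y => e.symm (y, (1 : G))) x :=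
    ContMDiffAt.comp (I' := 𝓘(ℝ, EM).prod 𝓘(ℝ, EG)) x
      (h2.contMDiffAt (e.open_target.mem_nhds (m1 x hx))) (contMDiffAt_id.prodMk contMDiffAt_const)
  have dr := ContMDiffAt.comp x (hr _) ds
  have dt := ContMDiffAt.comp x (ht _) ds
  have hbs : ContDiff ℝ ∞ (fun p : EG × EG => b p.1 p.2) := by fun_prop
  have := hbs.contMDiff.contMDiffAt.comp x (dr.prodMk_space dt)
  refine this.congr_of_eventuallyEq ?_
  filter_upwards [hU.mem_nhds hx] with y hy
  have hp : Q.proj (e.symm (y, (1 : G))) = y := by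
    rw [← (he _ (e.map_target (m1 y hy))).1, e.right_inv (m1 y hy)]
  have key : ∀ (y : M) (u : P) (h : Q.proj u = y),
      Q.pairing c y (r y) (t y) = b (Q.hat r u) (Q.hat t u) := by
    rintro _ u rfl
    exact (Q.pairing_eq c hc _ _ ⟨u, rfl⟩).trans (hb _ _)
  exact key y _ hp

/-- On `P` the pairing becomes a fixed bilinear form of two 𝔤-valued maps. The ordinary product rule
along the horizontal lift of `X` gives the covariant derivatives, and the lift projects back to `X`.
-/
theorem Connection.deriv_pairing (θ : Q.Connection) {r t : Q.AdSection} (hr : Q.SmoothAd r)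
    (ht : Q.SmoothAd t) (X : VecField EM M) (x : M) :
    X.deriv (fun y => Q.pairing c y (r y) (t y)) x =
      Q.pairing c x (θ.covDeriv r x (X x)) (t x) + Q.pairing c x (r x) (θ.covDeriv t x (X x)) := by
  obtain ⟨b, hb⟩ : ∃ b : EG →L[ℝ] EG →L[ℝ] ℝ, ∀ u v : GroupLieAlgebra 𝓘(ℝ, EG) G, c u v = b u v :=
    ⟨LinearMap.toContinuousBilinearMap (show EG →ₗ[ℝ] EG →ₗ[ℝ] ℝ from c), fun _ _ => rfl⟩
  have key : ∀ u : Q.fiber x, X.deriv (fun y => Q.pairing c y (r y) (t y)) x =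
      b ((θ.covDeriv r x (X x)).1 u) ((t x).1 u) + b ((r x).1 u) ((θ.covDeriv t x (X x)).1 u) := by
    rintro ⟨u, rfl⟩
    have e : (fun y => Q.pairing c y (r y) (t y)) ∘ Q.proj = fun u => b (Q.hat r u) (Q.hat t u) :=
      funext fun u => (Q.pairing_eq c hc _ _ ⟨u, rfl⟩).trans (hb _ _)
    have d1 := mfderiv_comp (I' := 𝓘(ℝ, EM)) u
      ((contMDiff_pairing c hc hr ht).mdifferentiableAt (x := Q.proj u) (by simp))
      (Q.contMDiff_proj.mdifferentiableAt (by simp))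
    have hr' : MDifferentiableAt 𝓘(ℝ, EP) 𝓘(ℝ, EG) (Q.hat r) u := ContMDiff.mdifferentiableAt hr (by simp)
    have ht' : MDifferentiableAt 𝓘(ℝ, EP) 𝓘(ℝ, EG) (Q.hat t) u := ContMDiff.mdifferentiableAt ht (by simp)
    have hF := (b.hasFDerivAt.comp_hasFDerivWithinAt _ hr'.hasMFDerivAt.2).clm_apply
      ht'.hasMFDerivAt.2
    have hc : ContinuousAt (fun u => b (Q.hat r u) (Q.hat t u)) u :=
      ((b.continuous.continuousAt.comp hr'.continuousAt).clm_apply ht'.continuousAt)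
    have d2 : mfderiv 𝓘(ℝ, EP) 𝓘(ℝ, ℝ) (fun u => b (Q.hat r u) (Q.hat t u)) u = _ :=
      HasMFDerivAt.mfderiv ⟨hc, hF⟩
    have d3 : ∀ k : P → ℝ, k = (fun u => b (Q.hat r u) (Q.hat t u)) →
        (mfderiv 𝓘(ℝ, EP) 𝓘(ℝ, ℝ) k u : EP →L[ℝ] ℝ) =
          mfderiv 𝓘(ℝ, EP) 𝓘(ℝ, ℝ) (fun u => b (Q.hat r u) (Q.hat t u)) u := by
      rintro _ rfl; rfl
    have d4 := congrArg (fun T : EP →L[ℝ] ℝ => T (θ.hor u (X (Q.proj u))))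
      (d1.symm.trans ((d3 _ e).trans d2))
    have l : (mfderiv 𝓘(ℝ, EM) 𝓘(ℝ, ℝ) (fun y => Q.pairing c y (r y) (t y)) (Q.proj u)
      (Q.dproj u (θ.hor u (X (Q.proj u)))) : ℝ) =
      X.deriv (fun y => Q.pairing c y (r y) (t y)) (Q.proj u) := by
      rw [θ.dproj_hor]; rfl
    refine l.symm.trans (d4.trans ?_)
    have wr : writtenInExtChartAt 𝓘(ℝ, EP) 𝓘(ℝ, EG) u (Q.hat r) (extChartAt 𝓘(ℝ, EP) u u) =
        Q.hat r u := congrArg (Q.hat r) (extChartAt_to_inv (I := 𝓘(ℝ, EP)) u)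
    have wt : writtenInExtChartAt 𝓘(ℝ, EP) 𝓘(ℝ, EG) u (Q.hat t) (extChartAt 𝓘(ℝ, EP) u u) =
        Q.hat t u := congrArg (Q.hat t) (extChartAt_to_inv (I := 𝓘(ℝ, EP)) u)
    rw [add_comm]
    show b _ (writtenInExtChartAt 𝓘(ℝ, EP) 𝓘(ℝ, EG) u (Q.hat t) (extChartAt 𝓘(ℝ, EP) u u)) +
      b (writtenInExtChartAt 𝓘(ℝ, EP) 𝓘(ℝ, EG) u (Q.hat r) (extChartAt 𝓘(ℝ, EP) u u)) _ = _
    rw [wr, wt]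
    rfl
  rw [key (Q.point x), ← hb, ← hb]
  rfl

end Pairing

/-- Where a trivialization has group coordinate `k`, the map `u ↦ Ad (k(u)⁻¹) A` is equivariant for
every `A`; a bump function on the base extends it by zero. -/
theorem exists_smoothAd_eq [T2Space M] (x : M) (r₀ : Q.adP x) :
    ∃ r : Q.AdSection, Q.SmoothAd r ∧ r x = r₀ := by
  obtain ⟨U, e, hU, hx, hs, htg, h1, h2, he⟩ := Q.exists_localTriv x
  obtain ⟨ψ, p1, p2, p3⟩ := exists_bump (E := EM) (hU.mem_nhds hx)
  have mem : ∀ {y : M} (u : Q.fiber y), y ∈ U → u.1 ∈ e.source := fun u hy => by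
    rw [hs]; show Q.proj u.1 ∈ U; rw [u.2]; exact hy
  let u₀ := Q.point x
  -- This choice makes the equivariant map equal to `r₀` at `u₀`, hence on the whole fibre by
  -- transitivity of the action.
  let A : GroupLieAlgebra 𝓘(ℝ, EG) G := Ad (e u₀.1).2 (r₀.1 u₀)
  have p0 : ∀ y, y ∉ U → ψ y = 0 := fun y hy =>
    image_eq_zero_of_notMem_tsupport fun h => hy (p2 h)
  let r : Q.AdSection := fun y => ⟨fun u => ψ y • Ad (e u.1).2⁻¹ A, fun u g => by
    by_cases hy : y ∈ U
    · show ψ y • Ad (e (Q.act u.1 g)).2⁻¹ A = Ad g⁻¹ (ψ y • Ad (e u.1).2⁻¹ A)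
      rw [map_smul, ← Ad_mul g⁻¹, (he _ (mem u hy)).2, mul_inv_rev]
    · simp only [p0 y hy, zero_smul, map_zero]⟩
  refine ⟨r, ?_, Subtype.ext (funext fun u => ?_)⟩
  · let L : G → EG := fun g => Ad g A
    have hat_eq : Q.hat r = fun u => ψ (Q.proj u) • L (e u).2⁻¹ := rfl
    show ContMDiff _ _ _ (Q.hat r)
    rw [hat_eq]
    apply contMDiff_of_tsupport
    intro u hu
    have hu1 : u ∈ e.source := by
      rw [hs]
      apply p2
      have h3 : u ∈ tsupport (fun u => ψ (Q.proj u)) := tsupport_smul_subset_left _ _ hu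
      exact tsupport_comp_subset_preimage ψ Q.contMDiff_proj.continuous h3
    have d1 : ContMDiffAt 𝓘(ℝ, EP) (𝓘(ℝ, EM).prod 𝓘(ℝ, EG)) ∞ e u :=
      h1.contMDiffAt (e.open_source.mem_nhds hu1)
    have d2 : ContMDiffAt 𝓘(ℝ, EP) 𝓘(ℝ, EG) ∞ (fun u => (e u).2⁻¹) u :=
      (contMDiffAt_snd.comp u d1).inv
    have d3 : ContMDiffAt 𝓘(ℝ, EP) 𝓘(ℝ, EG) ∞ (fun u => L (e u).2⁻¹) u :=
      ContMDiffAt.comp (g := L) u (contMDiff_Ad A _) d2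
    exact ContMDiffAt.smul (p1.comp Q.contMDiff_proj).contMDiffAt d3
  · obtain ⟨g, rfl⟩ := Q.exists_act_eq u₀ u
    rw [r₀.2]
    show ψ x • Ad (e (Q.act u₀.1 g)).2⁻¹ (Ad (e u₀.1).2 (r₀.1 u₀)) = _
    rw [p3.self_of_nhds, one_smul, ← Ad_mul, (he _ (mem u₀ hx)).2, mul_inv_rev, mul_assoc,
      inv_mul_cancel, mul_one]

end PrincipalBundle

end AdBundle

/-! ### Vector fields related by a diffeomorphism. -/

noncomputable section Naturality

variable {E M : Type*} [NormedAddCommGroup E] [NormedSpace ℝ E] [FiniteDimensional ℝ E]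
  [TopologicalSpace M] [ChartedSpace E M] [IsManifold 𝓘(ℝ, E) ∞ M]
  (φ : M ≃ₘ^∞⟮𝓘(ℝ, E), 𝓘(ℝ, E)⟯ M)

/-- The differential of a diffeomorphism as a continuous linear equivalence. -/
def dEquiv (x : M) : TangentSpace 𝓘(ℝ, E) x ≃L[ℝ] TangentSpace 𝓘(ℝ, E) (φ x) :=
  φ.mfderivToContinuousLinearEquiv (by simp) x

theorem mpullback_apply_dEquiv (X : VecField E M) (x : M) :
    mpullback 𝓘(ℝ, E) 𝓘(ℝ, E) φ X x = (dEquiv φ x).symm (X (φ x)) :=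
  congrArg (fun T : TangentSpace 𝓘(ℝ, E) (φ x) →L[ℝ] TangentSpace 𝓘(ℝ, E) x => T (X (φ x)))
    (ContinuousLinearMap.inverse_equiv (dEquiv φ x))

theorem dEquiv_mpullback (X : VecField E M) (x : M) :
    dEquiv φ x (mpullback 𝓘(ℝ, E) 𝓘(ℝ, E) φ X x) = X (φ x) := by
  rw [mpullback_apply_dEquiv, ContinuousLinearEquiv.apply_symm_apply]

theorem mpullback_eq_of_related {X X' : VecField E M} (h : ∀ x, dEquiv φ x (X x) = X' (φ x)) :
    mpullback 𝓘(ℝ, E) 𝓘(ℝ, E) φ X' = X :=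
  funext fun x => by rw [mpullback_apply_dEquiv, ← h, ContinuousLinearEquiv.symm_apply_apply]

theorem VecField.Smooth.mpullback {X : VecField E M} (hX : X.Smooth) :
    VecField.Smooth (mpullback 𝓘(ℝ, E) 𝓘(ℝ, E) φ X) :=
  ContMDiff.mpullback_vectorField (n := ∞) (m := ∞) hX φ.contMDiff
    (fun x => ⟨dEquiv φ x, rfl⟩) (by simp)

/-- Push-forward of smooth vector fields. -/
theorem VecField.Smooth.exists_related {X : VecField E M} (hX : X.Smooth) :
    ∃ X' : VecField E M, X'.Smooth ∧ ∀ x, dEquiv φ x (X x) = X' (φ x) := by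
  refine ⟨VectorField.mpullback 𝓘(ℝ, E) 𝓘(ℝ, E) φ.symm X, hX.mpullback φ.symm, fun x => ?_⟩
  have e : φ.symm ∘ φ = id := funext fun x => φ.symm_apply_apply x
  have h1 := mfderiv_comp (I' := 𝓘(ℝ, E)) x (φ.symm.contMDiff.mdifferentiableAt (x := φ x) (by simp))
    (φ.contMDiff.mdifferentiableAt (x := x) (by simp))
  rw [e, mfderiv_id] at h1
  have h2 := congrArg (fun T : E →L[ℝ] E => T (X x)) h1
  have key : ∀ y, y = x → (X y : E) = X x := by rintro y rfl; rfl
  have h3 : (dEquiv φ.symm (φ x) (dEquiv φ x (X x)) : E) = X (φ.symm (φ x)) :=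
    h2.symm.trans (key _ (φ.symm_apply_apply x)).symm
  rw [mpullback_apply_dEquiv]
  exact ((ContinuousLinearEquiv.symm_apply_eq _).2 h3.symm).symm

variable {φ} {X X' Y Y' : VecField E M}

theorem mlieBracket_related (hX' : X'.Smooth) (hY' : Y'.Smooth)
    (hX : ∀ x, dEquiv φ x (X x) = X' (φ x)) (hY : ∀ x, dEquiv φ x (Y x) = Y' (φ x)) (x : M) :
    dEquiv φ x (mlieBracket 𝓘(ℝ, E) X Y x) = mlieBracket 𝓘(ℝ, E) X' Y' (φ x) := by
  have h := mpullback_mlieBracket (I := 𝓘(ℝ, E)) (I' := 𝓘(ℝ, E)) (n := ∞) (x₀ := x) (f := φ)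
    (V := X') (W := Y') (hX'.mdifferentiableAt (by simp)) (hY'.mdifferentiableAt (by simp))
    φ.contMDiff.contMDiffAt two_le_infty
  rw [mpullback_eq_of_related φ hX, mpullback_eq_of_related φ hY, mpullback_apply_dEquiv] at h
  rw [← h, ContinuousLinearEquiv.apply_symm_apply]

theorem deriv_related (hX : ∀ x, dEquiv φ x (X x) = X' (φ x)) {g : M → ℝ} (x : M)
    (hg : MDifferentiableAt 𝓘(ℝ, E) 𝓘(ℝ, ℝ) g (φ x)) :
    X'.deriv g (φ x) = X.deriv (fun y => g (φ y)) x := by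
  have h := mfderiv_comp (I' := 𝓘(ℝ, E)) x hg (φ.contMDiff.mdifferentiableAt (by simp))
  have h2 := congrArg (fun T : E →L[ℝ] ℝ => T (X x)) h
  refine Eq.trans ?_ h2.symm
  rw [VecField.deriv, ← hX]
  rfl

end Naturality

/-! ### The cotangent component of the bracket, evaluated on fields. -/

noncomputable section DorfmanValues

variable {EM M EG G EP P : Type*}
  [NormedAddCommGroup EM] [NormedSpace ℝ EM] [FiniteDimensional ℝ EM]
  [TopologicalSpace M] [ChartedSpace EM M] [IsManifold 𝓘(ℝ, EM) ∞ M]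
  [NormedAddCommGroup EG] [NormedSpace ℝ EG] [FiniteDimensional ℝ EG]
  [TopologicalSpace G] [ChartedSpace EG G] [Group G] [LieGroup 𝓘(ℝ, EG) ∞ G]
  [NormedAddCommGroup EP] [NormedSpace ℝ EP] [FiniteDimensional ℝ EP]
  [TopologicalSpace P] [ChartedSpace EP P] [IsManifold 𝓘(ℝ, EP) ∞ P]

namespace PrincipalBundle

variable {Q : PrincipalBundle EM M EG G EP P}
  (c : LinearMap.BilinForm ℝ (GroupLieAlgebra 𝓘(ℝ, EG) G))
  (θ : Q.Connection) (H : VForm EM M 3 ℝ)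

/-- The cotangent part of the Dorfman bracket evaluated on a vector field. -/
theorem dorfman_cotangent [T2Space M] {e e' : ∀ x, Q.EFib x} (he : Q.SmoothE e) (he' : Q.SmoothE e')
    {Z : VecField EM M} (hZ : Z.Smooth) (x : M) :
    (dorfman c θ H e e' x).2.2 (Z x) =
      VecField.deriv (fun y => (e y).1) (fun y => (e' y).2.2 (Z y)) x
        - (e' x).2.2 (mlieBracket 𝓘(ℝ, EM) (fun y => (e y).1) Z x)
        - VecField.deriv (fun y => (e' y).1) (fun y => (e y).2.2 (Z y)) x
        + Z.deriv (fun y => (e y).2.2 (e' y).1) x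
        + (e x).2.2 (mlieBracket 𝓘(ℝ, EM) (fun y => (e' y).1) Z x)
        + H x ![(e x).1, (e' x).1, Z x]
        + 2 * Q.pairing c x (θ.covDeriv (fun y => (e y).2.1) x (Z x)) (e' x).2.1
        + 2 * Q.pairing c x (θ.curv x ![(e x).1, Z x]) (e' x).2.1
        - 2 * Q.pairing c x (θ.curv x ![(e' x).1, Z x]) (e x).2.1 := by
  -- With X, Y the tangent components and ξ, η the cotangent ones, Cartan's formula expands both
  -- `i_X dη` and `i_Y dξ`. The term `d(η(X))` of the Lie derivative cancels against part of the
  -- first.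
  have h1 := VForm.extD_ofOne he'.2.2 he.1 hZ x
  have h2 := VForm.extD_ofOne he.2.2 he'.1 hZ x
  have h : (dorfman c θ H e e' x).2.2 (Z x) =
      ((VForm.ofOne (fun y => (e' y).2.2)).extD x ![(e x).1, Z x]
        + Z.deriv (fun y => (e' y).2.2 (e y).1) x)
      - (VForm.ofOne (fun y => (e y).2.2)).extD x ![(e' x).1, Z x]
      + (H x ![(e x).1, (e' x).1, Z x]
        + 2 * Q.pairing c x (θ.covDeriv (fun y => (e y).2.1) x (Z x)) (e' x).2.1
        + 2 * Q.pairing c x (θ.curv x ![(e x).1, Z x]) (e' x).2.1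
        - 2 * Q.pairing c x (θ.curv x ![(e' x).1, Z x]) (e x).2.1) := rfl
  rw [h, h1, h2]
  ring

end PrincipalBundle

end DorfmanValues

/-- The identity behind the transformation law of the three-form. -/
theorem shear_identity {V : Type*} [LieRing V] [LieAlgebra ℝ V] (p : V →ₗ[ℝ] V →ₗ[ℝ] ℝ)
    (symm : ∀ u v : V, p u v = p v u) (inv : ∀ w u v : V, p ⁅w, u⁆ v + p u ⁅w, v⁆ = 0)
    (A B C r t dXB dXC dYA dYC dZA dZB dXt dYr dZr FXY FXZ FYZ aXY aXZ aYZ : V) :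
    -(p dXB C + p B dXC) - 2 * (p dXC t + p C dXt) + p B aXZ + 2 * p aXZ t
      + (p dYA C + p A dYC) + 2 * (p dYC r + p C dYr)
      - (p dZA B + p A dZB) - 2 * (p dZB r + p B dZr) - p A aYZ - 2 * p aYZ r
      + 2 * p (dZA + dZr + ⁅C, A + r⁆) (B + t)
      + 2 * p (FXZ + (dXC - dZA - aXZ) + (1 / 2 : ℝ) • (2 : ℝ) • ⁅A, C⁆) (B + t)
      - 2 * p (FYZ + (dYC - dZB - aYZ) + (1 / 2 : ℝ) • (2 : ℝ) • ⁅B, C⁆) (A + r)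
      - (2 * p dZr t + 2 * p FXZ t - 2 * p FYZ r - p aXY C - 2 * p C (-⁅r, t⁆ - FXY + dXt - dYr))
    = -(2 * (p A FYZ + p B (-FXZ) + p C FXY)
      + (p A (dYC - dZB - aYZ) + p B (dZA - dXC + aXZ) + p C (dXB - dYA - aXY))
      + (1 / 3) * (p A ((2 : ℝ) • ⁅B, C⁆) + p B ((2 : ℝ) • ⁅C, A⁆) + p C ((2 : ℝ) • ⁅A, B⁆))) := by
  -- Here `A`, `B`, `C` stand for `a(X)`, `a(Y)`, `a(Z)`, `dXB` for `d^θ_X(a(Y))`, `FXY` for `F(X,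
  -- Y)`, `aXY` for `a([X, Y])`, and `r`, `t` for the components in `ad P` of the two sections.
  have sk : ∀ u v w : V, p u ⁅v, w⁆ = - p u ⁅w, v⁆ := fun u v w => by rw [← lie_skew, map_neg]
  -- By invariance and symmetry, `p(u, [v, w])` is totally antisymmetric. The cubic terms can thus
  -- be reordered, and the rest is linear arithmetic in the values of `p`.
  have cyc : ∀ u v w : V, p u ⁅v, w⁆ = p v ⁅w, u⁆ := fun u v w => by
    have h1 := inv w v u
    have h2 := symm ⁅w, v⁆ u
    have h3 := sk u w v
    linarith
  have hs : ∀ u v : V, (1 / 2 : ℝ) • (2 : ℝ) • ⁅u, v⁆ = ⁅u, v⁆ := fun u v => by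
    rw [smul_smul]; norm_num
  have l : ∀ u v w : V, p ⁅u, v⁆ w = p w ⁅u, v⁆ := fun u v w => symm _ _
  simp only [hs, lie_add, map_add, map_sub, map_neg, map_smul, smul_eq_mul, LinearMap.add_apply,
    LinearMap.sub_apply, l]
  have s1 := symm dXB C
  have s2 := symm B dXC
  have s3 := symm dYA C
  have s4 := symm A dYC
  have s5 := symm dZA B
  have s6 := symm A dZB
  have s7 := symm FXZ B
  have s8 := symm FYZ A
  have s9 := symm aXZ B
  have s10 := symm aYZ A
  have s11 := symm aXY C
  have s12 := symm dZr B
  have c1 := cyc A B C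
  have c2 := cyc B C A
  have c3 := sk B C A
  have c4 := sk A B C
  have c5 := cyc r B C
  have c6 := cyc B C r
  have c7 := sk B r C
  have c8 := cyc t C A
  have c9 := sk t A C
  have c10 := cyc t C r
  have c11 := cyc C r t
  linarith

/-! ### Brackets of images under `f_ν(B, a)`: the component in `ad P`. -/

noncomputable section Intertwining

variable {EM M EG G EP P : Type*}
  [NormedAddCommGroup EM] [NormedSpace ℝ EM] [FiniteDimensional ℝ EM]
  [TopologicalSpace M] [ChartedSpace EM M] [IsManifold 𝓘(ℝ, EM) ∞ M]
  [NormedAddCommGroup EG] [NormedSpace ℝ EG] [FiniteDimensional ℝ EG]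
  [TopologicalSpace G] [ChartedSpace EG G] [Group G] [LieGroup 𝓘(ℝ, EG) ∞ G]
  [NormedAddCommGroup EP] [NormedSpace ℝ EP] [FiniteDimensional ℝ EP]
  [TopologicalSpace P] [ChartedSpace EP P] [IsManifold 𝓘(ℝ, EP) ∞ P]

theorem BundleAut.pull_eq_of_related {V : M → Type*} [∀ x, AddCommGroup (V x)]
    [∀ x, Module ℝ (V x)] {S : (∀ x, V x) → Prop} (f : BundleAut (EM := EM) V S)
    {s s' : ∀ x, V x} (h : ∀ x, s' (f.base x) = f.fib x (s x)) : f.pull s' = s :=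
  funext fun x => (LinearEquiv.symm_apply_eq _).2 (h x)

theorem linearEquiv_combination {V W : Type*} [AddCommGroup V] [Module ℝ V] [AddCommGroup W]
    [Module ℝ W] (L : V ≃ₗ[ℝ] W) (p q r s : V) : -L p - L q + L r - L s = L (-p - q + r - s) := by
  rw [map_sub, map_add, map_sub, map_neg]

namespace PrincipalBundle

variable {Q : PrincipalBundle EM M EG G EP P}
  (c : LinearMap.BilinForm ℝ (GroupLieAlgebra 𝓘(ℝ, EG) G))
  (θ : Q.Connection) (H : VForm EM M 3 ℝ)
  (ν : BundleAut (EM := EM) (fun x => Q.adP x) Q.SmoothAd) (B : VForm EM M 2 ℝ) (a : Q.AdForm)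

/-- The section `e'` is the image of the section `e` under `f_ν(B, a)`. -/
structure ShearRelated (e e' : ∀ x, Q.EFib x) : Prop where
  tangent : ∀ x, dEquiv ν.base x (e x).1 = (e' (ν.base x)).1
  ad : ∀ x, (e' (ν.base x)).2.1 = ν.fib x (a x (e x).1 + (e x).2.1)
  cotangent : ∀ x w, (e' (ν.base x)).2.2 (dEquiv ν.base x w) =
    (e x).2.2 w + B x ![(e x).1, w] - Q.pairing c x (a x (e x).1) (a x w)
      - 2 * Q.pairing c x (a x w) (e x).2.1

variable {c θ H ν B a}

/-- A covector over the image point is tested only on vectors dφ(w), which removes the inverse of dφ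
from the formula. All later comparisons with `f_ν(B, a)` go through this form. -/
theorem eq_diagE_shearE {x : M} {e : Q.EFib x} {e' : Q.EFib (ν.base x)} :
    (e' = (diagE ν (shearE c B a ⟨x, e⟩)).2) ↔
      (dEquiv ν.base x e.1 = e'.1 ∧ e'.2.1 = ν.fib x (a x e.1 + e.2.1) ∧
      ∀ w, e'.2.2 (dEquiv ν.base x w) =
        e.2.2 w + B x ![e.1, w] - Q.pairing c x (a x e.1) (a x w)
          - 2 * Q.pairing c x (a x w) e.2.1) := by
  have key : ∀ w, (diagE ν (shearE c B a ⟨x, e⟩)).2.2.2 (dEquiv ν.base x w) =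
      e.2.2 w + B x ![e.1, w] - Q.pairing c x (a x e.1) (a x w)
          - 2 * Q.pairing c x (a x w) e.2.1 := fun w => by
    have h : (diagE ν (shearE c B a ⟨x, e⟩)).2.2.2 (dEquiv ν.base x w) =
      (fun w => B x ![e.1, w] - Q.pairing c x (a x e.1) (a x w)
          - 2 * Q.pairing c x (a x w) e.2.1 + e.2.2 w) ((dEquiv ν.base x).symm (dEquiv ν.base x w)) :=
      rfl
    rw [h, ContinuousLinearEquiv.symm_apply_apply]
    ring
  constructor
  · rintro rfl
    exact ⟨rfl, rfl, key⟩
  · rintro ⟨h1, h2, h3⟩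
    refine Prod.ext h1.symm (Prod.ext h2 (ContinuousLinearMap.ext fun v => ?_))
    obtain ⟨w, rfl⟩ := (dEquiv ν.base x).surjective v
    exact (h3 w).trans (key w).symm

theorem shearRelated_iff {e e' : ∀ x, Q.EFib x} : ShearRelated c ν B a e e' ↔
    ∀ x, e' (ν.base x) = (diagE ν (shearE c B a ⟨x, e x⟩)).2 :=
  ⟨fun h x => eq_diagE_shearE.2 ⟨h.1 x, h.2 x, h.3 x⟩, fun h =>
    ⟨fun x => (eq_diagE_shearE.1 (h x)).1, fun x => (eq_diagE_shearE.1 (h x)).2.1,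
      fun x => (eq_diagE_shearE.1 (h x)).2.2⟩⟩

/-- For related fields and sections the pull-backs in the hypothesis are the unprimed objects
themselves, so the equation can be read at `ν.base x` with no inverse maps. -/
theorem Connection.PreservesDeriv.related (hD : θ.PreservesDeriv ν a) {X X' : VecField EM M}
    (hX' : X'.Smooth) {r r' : Q.AdSection} (hr' : Q.SmoothAd r')
    (hX : ∀ x, dEquiv ν.base x (X x) = X' (ν.base x)) (hr : ∀ x, r' (ν.base x) = ν.fib x (r x))
    (x : M) :
    θ.covDeriv r' (ν.base x) (X' (ν.base x)) =
      ν.fib x (θ.covDeriv r x (X x) + ⁅a x (X x), r x⁆) := by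
  have h := hD X' r' hX' hr' (ν.base x)
  rw [mpullback_eq_of_related _ hX, ν.pull_eq_of_related hr, ν.push_base] at h
  exact h

theorem Connection.PreservesCurv.related (hF : θ.PreservesCurv ν a) {X X' Y Y' : VecField EM M}
    (hX' : X'.Smooth) (hY' : Y'.Smooth) (hX : ∀ x, dEquiv ν.base x (X x) = X' (ν.base x))
    (hY : ∀ x, dEquiv ν.base x (Y x) = Y' (ν.base x)) (x : M) :
    θ.curv (ν.base x) ![X' (ν.base x), Y' (ν.base x)] = ν.fib x (θ.curvAdd a X Y x) := by
  have h := hF X' Y' hX' hY' (ν.base x)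
  rw [mpullback_eq_of_related _ hX, mpullback_eq_of_related _ hY, ν.push_base] at h
  exact h

/-- The bracket of the images under `f_ν(B, a)`: component in `ad P`. -/
theorem dorfman_ad_related (hb : ∀ x (r t : Q.adP x), ν.fib x ⁅r, t⁆ = ⁅ν.fib x r, ν.fib x t⁆)
    (ha : Q.SmoothForm a) (hD : θ.PreservesDeriv ν a) (hF : θ.PreservesCurv ν a)
    {e e' e₂ e₂' : ∀ x, Q.EFib x} (he : Q.SmoothE e) (he' : Q.SmoothE e') (he₂ : Q.SmoothE e₂)
    (he₂' : Q.SmoothE e₂') (h : ShearRelated c ν B a e e₂) (h' : ShearRelated c ν B a e' e₂')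
    (x : M) :
    (dorfman c θ H e₂ e₂' (ν.base x)).2.1 =
      ν.fib x (a x (dorfman c θ H e e' x).1 + (dorfman c θ H e e' x).2.1) := by
  have h1 := hD.related he₂.1 he₂'.2.1 h.1 h'.2 x
  have h2 := hD.related he₂'.1 he₂.2.1 h'.1 h.2 x
  have h3 := hF.related he₂.1 he₂'.1 h.1 h'.1 x
  have h4 : ⁅(e₂ (ν.base x)).2.1, (e₂' (ν.base x)).2.1⁆ =
      ν.fib x ⁅a x (e x).1 + (e x).2.1, a x (e' x).1 + (e' x).2.1⁆ := by
    rw [h.2, h'.2, hb]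
  have h5 := θ.covDeriv_add (ha _ he.1) he.2.1 x (e' x).1
  have h6 := θ.covDeriv_add (ha _ he'.1) he'.2.1 x (e x).1
  have e1 : (dorfman c θ H e₂ e₂' (ν.base x)).2.1 =
    -⁅(e₂ (ν.base x)).2.1, (e₂' (ν.base x)).2.1⁆
      - θ.curv (ν.base x) ![(e₂ (ν.base x)).1, (e₂' (ν.base x)).1]
      + θ.covDeriv (fun y => (e₂' y).2.1) (ν.base x) (e₂ (ν.base x)).1
      - θ.covDeriv (fun y => (e₂ y).2.1) (ν.base x) (e₂' (ν.base x)).1 := rfl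
  have e2 : (dorfman c θ H e e' x).2.1 = -⁅(e x).2.1, (e' x).2.1⁆
      - θ.curv x ![(e x).1, (e' x).1]
      + θ.covDeriv (fun y => (e' y).2.1) x (e x).1
      - θ.covDeriv (fun y => (e y).2.1) x (e' x).1 := rfl
  have e3 : θ.curvAdd a (fun y => (e y).1) (fun y => (e' y).1) x =
    θ.curv x ![(e x).1, (e' x).1] + (θ.covDeriv (fun y => a y (e' y).1) x (e x).1
      - θ.covDeriv (fun y => a y (e y).1) x (e' x).1 - a x (dorfman c θ H e e' x).1)
      + (1 / 2 : ℝ) • (2 : ℝ) • ⁅a x (e x).1, a x (e' x).1⁆ := rfl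
  rw [e3] at h3
  have hs : (1 / 2 : ℝ) • (2 : ℝ) • ⁅a x (e x).1, a x (e' x).1⁆ = ⁅a x (e x).1, a x (e' x).1⁆ := by
    rw [smul_smul]; norm_num
  -- Here `A = a(X)`, `B = a(Y)`, and `S`, `S'`, `D` are the three terms of `d^θ a`. All brackets
  -- containing `A` or `B` cancel among the fibre bracket, the curvature of `θ + a` and the two
  -- covariant derivatives; only `[r, t]` survives.
  have alg : ∀ A B r t D F S T S' T' : Q.adP x,
      -⁅A + r, B + t⁆ - (F + (S - S' - D) + ⁅A, B⁆) + (S + T + ⁅A, B + t⁆)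
        - (S' + T' + ⁅B, A + r⁆) = D + (-⁅r, t⁆ - F + T - T') := fun A B r t D F S T S' T' => by
    have sk : ⁅B, r⁆ = -⁅r, B⁆ := (lie_skew _ _).symm
    have sk' : ⁅B, A⁆ = -⁅A, B⁆ := (lie_skew _ _).symm
    simp only [lie_add, add_lie, sk, sk']
    abel
  have lin : ∀ p q r s : Q.adP x, -ν.fib x p - ν.fib x q + ν.fib x r - ν.fib x s =
      ν.fib x (-p - q + r - s) := linearEquiv_combination (ν.fib x)
  rw [hs] at h3
  rw [h6] at h1
  rw [h5] at h2
  rw [e1, e2, h1, h2, h3, h4]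
  exact (lin _ _ _ _).trans (congrArg (ν.fib x) (alg _ _ _ _ _ _ _ _ _ _))

variable [T2Space M]

/-- The derivative of the cotangent component of the image under the shear. -/
theorem deriv_shear (hc : ∀ (g : G) A B, c (Ad g A) (Ad g B) = c A B)
    (θ : Q.Connection) (hB : B.Smooth) (ha : Q.SmoothForm a) {e : ∀ x, Q.EFib x} (he : Q.SmoothE e)
    {Z : VecField EM M} (hZ : Z.Smooth) (W : VecField EM M) (x : M) :
    W.deriv (fun y => (e y).2.2 (Z y) + B y ![(e y).1, Z y]
        - Q.pairing c y (a y (e y).1) (a y (Z y)) - 2 * Q.pairing c y (a y (Z y)) (e y).2.1) x =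
      W.deriv (fun y => (e y).2.2 (Z y)) x + W.deriv (fun y => B y ![(e y).1, Z y]) x
      - (Q.pairing c x (θ.covDeriv (fun y => a y (e y).1) x (W x)) (a x (Z x))
        + Q.pairing c x (a x (e x).1) (θ.covDeriv (fun y => a y (Z y)) x (W x)))
      - 2 * (Q.pairing c x (θ.covDeriv (fun y => a y (Z y)) x (W x)) (e x).2.1
        + Q.pairing c x (a x (Z x)) (θ.covDeriv (fun y => (e y).2.1) x (W x))) := by
  have m1 : MDifferentiableAt 𝓘(ℝ, EM) 𝓘(ℝ, ℝ) (fun y => (e y).2.2 (Z y)) x :=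
    (he.2.2 Z hZ).mdifferentiableAt (by simp)
  have m2 : MDifferentiableAt 𝓘(ℝ, EM) 𝓘(ℝ, ℝ) (fun y => B y ![(e y).1, Z y]) x := by
    have := hB ![fun y => (e y).1, Z] (by intro i; fin_cases i; exacts [he.1, hZ])
    have e1 : (fun y => B y ![(e y).1, Z y]) = fun y => B y (fun i => (![fun y => (e y).1, Z] : Fin 2 → VecField EM M) i y) := by
      funext y; congr 1; funext i; fin_cases i <;> rfl
    rw [e1]
    exact this.mdifferentiableAt (by simp)
  have m3 : MDifferentiableAt 𝓘(ℝ, EM) 𝓘(ℝ, ℝ)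
      (fun y => Q.pairing c y (a y (e y).1) (a y (Z y))) x :=
    (contMDiff_pairing c hc (ha _ he.1) (ha _ hZ)).mdifferentiableAt (by simp)
  have m4 : MDifferentiableAt 𝓘(ℝ, EM) 𝓘(ℝ, ℝ)
      (fun y => Q.pairing c y (a y (Z y)) (e y).2.1) x :=
    (contMDiff_pairing c hc (ha _ hZ) he.2.1).mdifferentiableAt (by simp)
  have m5 : MDifferentiableAt 𝓘(ℝ, EM) 𝓘(ℝ, ℝ)
      (fun y => 2 * Q.pairing c y (a y (Z y)) (e y).2.1) x :=
    (contMDiff_const.mul (contMDiff_pairing c hc (ha _ hZ) he.2.1)).mdifferentiableAt (by simp)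
  have m6 : MDifferentiableAt 𝓘(ℝ, EM) 𝓘(ℝ, ℝ)
      (fun y => (e y).2.2 (Z y) + B y ![(e y).1, Z y]) x := m1.add m2
  have m7 : MDifferentiableAt 𝓘(ℝ, EM) 𝓘(ℝ, ℝ) (fun y => (e y).2.2 (Z y) + B y ![(e y).1, Z y]
      - Q.pairing c y (a y (e y).1) (a y (Z y))) x := m6.sub m3
  rw [VecField.deriv_sub W m7 m5, VecField.deriv_sub W m6 m3,
    VecField.deriv_add W m1 m2, VecField.deriv_const_mul W m4,
    θ.deriv_pairing c hc (ha _ he.1) (ha _ hZ), θ.deriv_pairing c hc (ha _ hZ) he.2.1]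

end PrincipalBundle
end Intertwining

/-! ### Brackets of images under `f_ν(B, a)`: the component in `T^*` and its defect. -/

noncomputable section Intertwining

variable {EM M EG G EP P : Type*}
  [NormedAddCommGroup EM] [NormedSpace ℝ EM] [FiniteDimensional ℝ EM]
  [TopologicalSpace M] [T2Space M] [ChartedSpace EM M] [IsManifold 𝓘(ℝ, EM) ∞ M]
  [NormedAddCommGroup EG] [NormedSpace ℝ EG] [FiniteDimensional ℝ EG]
  [TopologicalSpace G] [ChartedSpace EG G] [Group G] [LieGroup 𝓘(ℝ, EG) ∞ G]
  [NormedAddCommGroup EP] [NormedSpace ℝ EP] [FiniteDimensional ℝ EP]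
  [TopologicalSpace P] [ChartedSpace EP P] [IsManifold 𝓘(ℝ, EP) ∞ P]

theorem VForm.apply_swap (B : VForm EM M 2 ℝ) (x : M) (u v : TangentSpace 𝓘(ℝ, EM) x) :
    B x ![u, v] = -B x ![v, u] := by
  refine Eq.trans (congrArg (B x) (funext fun i => ?_))
    ((B x).toAlternatingMap.map_swap ![v, u] (show (0 : Fin 2) ≠ 1 by decide))
  fin_cases i <;> rfl

namespace PrincipalBundle

variable {Q : PrincipalBundle EM M EG G EP P}
  {c : LinearMap.BilinForm ℝ (GroupLieAlgebra 𝓘(ℝ, EG) G)}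
  {θ : Q.Connection} {H : VForm EM M 3 ℝ}
  {ν : BundleAut (EM := EM) (fun x => Q.adP x) Q.SmoothAd} {B : VForm EM M 2 ℝ} {a : Q.AdForm}

theorem ShearRelated.deriv_cotangent (hc : ∀ (g : G) A B, c (Ad g A) (Ad g B) = c A B)
    (θ : Q.Connection) (hB : B.Smooth) (ha : Q.SmoothForm a)
    {e e₂ : ∀ x, Q.EFib x} (he : Q.SmoothE e) (he₂ : Q.SmoothE e₂) (h : ShearRelated c ν B a e e₂)
    {W W' Z Z' : VecField EM M} (hW : ∀ x, dEquiv ν.base x (W x) = W' (ν.base x))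
    (hZs : Z.Smooth) (hZs' : Z'.Smooth) (hZ : ∀ x, dEquiv ν.base x (Z x) = Z' (ν.base x)) (x : M) :
    W'.deriv (fun y => (e₂ y).2.2 (Z' y)) (ν.base x) =
      W.deriv (fun y => (e y).2.2 (Z y)) x + W.deriv (fun y => B y ![(e y).1, Z y]) x
      - (Q.pairing c x (θ.covDeriv (fun y => a y (e y).1) x (W x)) (a x (Z x))
        + Q.pairing c x (a x (e x).1) (θ.covDeriv (fun y => a y (Z y)) x (W x)))
      - 2 * (Q.pairing c x (θ.covDeriv (fun y => a y (Z y)) x (W x)) (e x).2.1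
        + Q.pairing c x (a x (Z x)) (θ.covDeriv (fun y => (e y).2.1) x (W x))) := by
  rw [deriv_related hW x ((he₂.2.2 Z' hZs').mdifferentiableAt (by simp)),
    ← deriv_shear hc θ hB ha he hZs W x]
  congr 1
  funext y
  rw [← hZ, h.cotangent]

set_option maxHeartbeats 1000000 in
/-- The bracket of the images under `f_ν(B, a)`: component in `T^*`. -/
theorem dorfman_cotangent_related (hs : c.IsSymm)
    (hc : ∀ (g : G) A B, c (Ad g A) (Ad g B) = c A B)
    (hp : ∀ x (r t : Q.adP x), Q.pairing c (ν.base x) (ν.fib x r) (ν.fib x t) = Q.pairing c x r t)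
    (hB : B.Smooth) (ha : Q.SmoothForm a) (hD : θ.PreservesDeriv ν a) (hF : θ.PreservesCurv ν a)
    {e e' e₂ e₂' : ∀ x, Q.EFib x} (he : Q.SmoothE e) (he' : Q.SmoothE e') (he₂ : Q.SmoothE e₂)
    (he₂' : Q.SmoothE e₂') (h : ShearRelated c ν B a e e₂) (h' : ShearRelated c ν B a e' e₂')
    {Z Z' : VecField EM M} (hZs : Z.Smooth) (hZs' : Z'.Smooth)
    (hZ : ∀ x, dEquiv ν.base x (Z x) = Z' (ν.base x)) (x : M) :
    (dorfman c θ H e₂ e₂' (ν.base x)).2.2 (Z' (ν.base x)) =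
      (dorfman c θ H e e' x).2.2 (Z x) + B x ![(dorfman c θ H e e' x).1, Z x]
        - Q.pairing c x (a x (dorfman c θ H e e' x).1) (a x (Z x))
        - 2 * Q.pairing c x (a x (Z x)) (dorfman c θ H e e' x).2.1
      + (VForm.pullback ν.base H x ![(e x).1, (e' x).1, Z x]
        - (H x ![(e x).1, (e' x).1, Z x] - B.extD x ![(e x).1, (e' x).1, Z x]
        + 2 * wedge₂ c a (evalForm θ.curv) (fun y => (e y).1) (fun y => (e' y).1) Z x
        + wedge₂ c a (θ.covDerivForm a) (fun y => (e y).1) (fun y => (e' y).1) Z x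
        + (1 / 3) * wedge₂ c a (bracketForm a) (fun y => (e y).1) (fun y => (e' y).1) Z x)) := by
  -- Both sides are expanded on fields. The rest of the proof rewrites each term at `ν.base x` by
  -- data at `x`, using relatedness and the two hypotheses on the connection.
  rw [dorfman_cotangent c θ H he₂ he₂' hZs' (ν.base x), dorfman_cotangent c θ H he he' hZs x]
  have d1 := h'.deriv_cotangent hc θ hB ha he' he₂'
    (W := fun y => (e y).1) (W' := fun y => (e₂ y).1) h.1 hZs hZs' hZ x
  have d2 := h.deriv_cotangent hc θ hB ha he he₂
    (W := fun y => (e' y).1) (W' := fun y => (e₂' y).1) h'.1 hZs hZs' hZ x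
  have d3 := h.deriv_cotangent hc θ hB ha he he₂ hZ (Z := fun y => (e' y).1) (Z' := fun y => (e₂' y).1) he'.1 he₂'.1 h'.1 x
  have b1 := h'.cotangent x (mlieBracket 𝓘(ℝ, EM) (fun y => (e y).1) Z x)
  rw [mlieBracket_related (X := fun y => (e y).1) (X' := fun y => (e₂ y).1)
    he₂.1 hZs' h.1 hZ x] at b1
  have b2 := h.cotangent x (mlieBracket 𝓘(ℝ, EM) (fun y => (e' y).1) Z x)
  rw [mlieBracket_related (X := fun y => (e' y).1) (X' := fun y => (e₂' y).1)
    he₂'.1 hZs' h'.1 hZ x] at b2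
  have v0 : VForm.pullback ν.base H x ![(e x).1, (e' x).1, Z x] =
      H (ν.base x) ![(e₂ (ν.base x)).1, (e₂' (ν.base x)).1, Z' (ν.base x)] := by
    rw [← h.1, ← h'.1, ← hZ]
    refine congrArg (H (ν.base x)) (funext fun i => ?_)
    fin_cases i <;> rfl
  have p1 : Q.pairing c (ν.base x)
      (θ.covDeriv (fun y => (e₂ y).2.1) (ν.base x) (Z' (ν.base x))) (e₂' (ν.base x)).2.1 =
      Q.pairing c x (θ.covDeriv (fun y => a y (e y).1) x (Z x)
        + θ.covDeriv (fun y => (e y).2.1) x (Z x) + ⁅a x (Z x), a x (e x).1 + (e x).2.1⁆)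
        (a x (e' x).1 + (e' x).2.1) := by
    rw [hD.related hZs' he₂.2.1 hZ h.2 x, h'.2, hp, θ.covDeriv_add (ha _ he.1) he.2.1]
  have p2 : Q.pairing c (ν.base x)
      (θ.curv (ν.base x) ![(e₂ (ν.base x)).1, Z' (ν.base x)]) (e₂' (ν.base x)).2.1 =
      Q.pairing c x (θ.curvAdd a (fun y => (e y).1) Z x) (a x (e' x).1 + (e' x).2.1) := by
    rw [hF.related he₂.1 hZs' h.1 hZ x, h'.2, hp]
  have p3 : Q.pairing c (ν.base x)
      (θ.curv (ν.base x) ![(e₂' (ν.base x)).1, Z' (ν.base x)]) (e₂ (ν.base x)).2.1 =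
      Q.pairing c x (θ.curvAdd a (fun y => (e' y).1) Z x) (a x (e x).1 + (e x).2.1) := by
    rw [hF.related he₂'.1 hZs' h'.1 hZ x, h.2, hp]
  -- The derivatives of `B` and its values on brackets assemble into `dB(X, Y, Z)` and the term
  -- `B([X, Y], Z)` already present on the right.
  have cartan := VForm.extD_two hB he.1 he'.1 hZs x
  have sw : ∀ u v : TangentSpace 𝓘(ℝ, EM) x, B x ![u, v] = -B x ![v, u] := fun u v =>
    VForm.apply_swap B x u v
  rw [sw (mlieBracket 𝓘(ℝ, EM) (fun y => (e y).1) Z x),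
    sw (mlieBracket 𝓘(ℝ, EM) (fun y => (e' y).1) Z x)] at cartan
  have cs : θ.curv x ![Z x, (e x).1] = -θ.curv x ![(e x).1, Z x] := by
    rw [← (θ.curv x).map_swap _ (show (0 : Fin 2) ≠ 1 by decide)]
    refine congrArg (θ.curv x) (funext fun i => ?_)
    fin_cases i <;> rfl
  have ls : a x (mlieBracket 𝓘(ℝ, EM) Z (fun y => (e y).1) x) =
      -a x (mlieBracket 𝓘(ℝ, EM) (fun y => (e y).1) Z x) := by
    rw [mlieBracket_swap_apply, map_neg]
  have w1 : wedge₂ c a (evalForm θ.curv) (fun y => (e y).1) (fun y => (e' y).1) Z x =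
      Q.pairing c x (a x (e x).1) (θ.curv x ![(e' x).1, Z x])
      + Q.pairing c x (a x (e' x).1) (-θ.curv x ![(e x).1, Z x])
      + Q.pairing c x (a x (Z x)) (θ.curv x ![(e x).1, (e' x).1]) := by
    rw [← cs]; rfl
  have w2 : wedge₂ c a (θ.covDerivForm a) (fun y => (e y).1) (fun y => (e' y).1) Z x =
      Q.pairing c x (a x (e x).1) (θ.covDeriv (fun y => a y (Z y)) x (e' x).1
        - θ.covDeriv (fun y => a y (e' y).1) x (Z x)
        - a x (mlieBracket 𝓘(ℝ, EM) (fun y => (e' y).1) Z x))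
      + Q.pairing c x (a x (e' x).1) (θ.covDeriv (fun y => a y (e y).1) x (Z x)
        - θ.covDeriv (fun y => a y (Z y)) x (e x).1
        + a x (mlieBracket 𝓘(ℝ, EM) (fun y => (e y).1) Z x))
      + Q.pairing c x (a x (Z x)) (θ.covDeriv (fun y => a y (e' y).1) x (e x).1
        - θ.covDeriv (fun y => a y (e y).1) x (e' x).1
        - a x (mlieBracket 𝓘(ℝ, EM) (fun y => (e y).1) (fun y => (e' y).1) x)) := by
    rw [← neg_neg (a x (mlieBracket 𝓘(ℝ, EM) (fun y => (e y).1) Z x)), ← ls, ← sub_eq_add_neg]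
    rfl
  have w3 : wedge₂ c a (bracketForm a) (fun y => (e y).1) (fun y => (e' y).1) Z x =
      Q.pairing c x (a x (e x).1) ((2 : ℝ) • ⁅a x (e' x).1, a x (Z x)⁆)
      + Q.pairing c x (a x (e' x).1) ((2 : ℝ) • ⁅a x (Z x), a x (e x).1⁆)
      + Q.pairing c x (a x (Z x)) ((2 : ℝ) • ⁅a x (e x).1, a x (e' x).1⁆) := rfl
  have q1 : θ.curvAdd a (fun y => (e y).1) Z x = θ.curv x ![(e x).1, Z x]
      + (θ.covDeriv (fun y => a y (Z y)) x (e x).1 - θ.covDeriv (fun y => a y (e y).1) x (Z x)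
        - a x (mlieBracket 𝓘(ℝ, EM) (fun y => (e y).1) Z x))
      + (1 / 2 : ℝ) • (2 : ℝ) • ⁅a x (e x).1, a x (Z x)⁆ := rfl
  have q2 : θ.curvAdd a (fun y => (e' y).1) Z x = θ.curv x ![(e' x).1, Z x]
      + (θ.covDeriv (fun y => a y (Z y)) x (e' x).1 - θ.covDeriv (fun y => a y (e' y).1) x (Z x)
        - a x (mlieBracket 𝓘(ℝ, EM) (fun y => (e' y).1) Z x))
      + (1 / 2 : ℝ) • (2 : ℝ) • ⁅a x (e' x).1, a x (Z x)⁆ := rfl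
  have q3 : (dorfman c θ H e e' x).1 =
    mlieBracket 𝓘(ℝ, EM) (fun y => (e y).1) (fun y => (e' y).1) x := rfl
  have q4 : (dorfman c θ H e e' x).2.1 = -⁅(e x).2.1, (e' x).2.1⁆
      - θ.curv x ![(e x).1, (e' x).1]
      + θ.covDeriv (fun y => (e' y).2.1) x (e x).1
      - θ.covDeriv (fun y => (e y).2.1) x (e' x).1 := rfl
  have main := shear_identity (Q.pairing c x) (pairing_symm c hs x) (pairing_lie c hc x)
    (a x (e x).1) (a x (e' x).1) (a x (Z x)) (e x).2.1 (e' x).2.1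
    (θ.covDeriv (fun y => a y (e' y).1) x (e x).1) (θ.covDeriv (fun y => a y (Z y)) x (e x).1)
    (θ.covDeriv (fun y => a y (e y).1) x (e' x).1) (θ.covDeriv (fun y => a y (Z y)) x (e' x).1)
    (θ.covDeriv (fun y => a y (e y).1) x (Z x)) (θ.covDeriv (fun y => a y (e' y).1) x (Z x))
    (θ.covDeriv (fun y => (e' y).2.1) x (e x).1) (θ.covDeriv (fun y => (e y).2.1) x (e' x).1)
    (θ.covDeriv (fun y => (e y).2.1) x (Z x))
    (θ.curv x ![(e x).1, (e' x).1]) (θ.curv x ![(e x).1, Z x]) (θ.curv x ![(e' x).1, Z x])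
    (a x (mlieBracket 𝓘(ℝ, EM) (fun y => (e y).1) (fun y => (e' y).1) x))
    (a x (mlieBracket 𝓘(ℝ, EM) (fun y => (e y).1) Z x))
    (a x (mlieBracket 𝓘(ℝ, EM) (fun y => (e' y).1) Z x))
  rw [q1] at p2
  rw [q2] at p3
  rw [d1, d2, d3, b1, b2, v0, p1, p2, p3, cartan, w1, w2, w3, q3, q4]
  -- The terms with `B`, `H` and the original covectors match directly; everything involving the
  -- pairing of `ad P` is `main`.
  linear_combination main

end PrincipalBundle
end Intertwining

/-! ### Automorphisms act on covectors and tangent vectors through the base map. -/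

noncomputable section AnchorPreserved

variable {EM M EG G EP P : Type*}
  [NormedAddCommGroup EM] [NormedSpace ℝ EM] [FiniteDimensional ℝ EM]
  [TopologicalSpace M] [T2Space M] [ChartedSpace EM M] [IsManifold 𝓘(ℝ, EM) ∞ M]
  [NormedAddCommGroup EG] [NormedSpace ℝ EG] [FiniteDimensional ℝ EG]
  [TopologicalSpace G] [ChartedSpace EG G] [Group G] [LieGroup 𝓘(ℝ, EG) ∞ G]
  [NormedAddCommGroup EP] [NormedSpace ℝ EP] [FiniteDimensional ℝ EP]
  [TopologicalSpace P] [ChartedSpace EP P] [IsManifold 𝓘(ℝ, EP) ∞ P]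

theorem VecField.Smooth.zero : VecField.Smooth (fun _ => 0 : VecField EM M) :=
  Bundle.contMDiff_zeroSection ℝ (TangentSpace 𝓘(ℝ, EM) : M → Type _)

theorem OneForm.Smooth.zero : OneForm.Smooth (fun _ => 0 : OneForm EM M) :=
  fun _ _ => contMDiff_const

theorem exists_related_eq (φ : M ≃ₘ^∞⟮𝓘(ℝ, EM), 𝓘(ℝ, EM)⟯ M) (x : M)
    (w : TangentSpace 𝓘(ℝ, EM) x) : ∃ Z Z' : VecField EM M, Z.Smooth ∧ Z'.Smooth ∧
      (∀ y, dEquiv φ y (Z y) = Z' (φ y)) ∧ Z x = w := by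
  obtain ⟨Z, hZ, hw⟩ := VecField.exists_eq x w
  obtain ⟨Z', hZ', hr⟩ := hZ.exists_related φ
  exact ⟨Z, Z', hZ, hZ', hr, hw⟩

namespace PrincipalBundle

variable {Q : PrincipalBundle EM M EG G EP P}
  {c : LinearMap.BilinForm ℝ (GroupLieAlgebra 𝓘(ℝ, EG) G)}
  {θ : Q.Connection} {H : VForm EM M 3 ℝ}

theorem SmoothE.ofTangent {X : VecField EM M} (hX : X.Smooth) :
    Q.SmoothE (fun x => (X x, 0, 0)) := ⟨hX, SmoothAd.zero, OneForm.Smooth.zero⟩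

theorem SmoothE.ofAd {r : Q.AdSection} (hr : Q.SmoothAd r) :
    Q.SmoothE (fun x => (0, r x, 0)) := ⟨VecField.Smooth.zero, hr, OneForm.Smooth.zero⟩

/-- The bracket of a section with itself is the differential of its square. -/
theorem dorfman_self (hs : c.IsSymm) (hc : ∀ (g : G) A B, c (Ad g A) (Ad g B) = c A B)
    {e : ∀ x, Q.EFib x} (he : Q.SmoothE e) (x : M) :
    (dorfman c θ H e e x).1 = 0 ∧ (dorfman c θ H e e x).2.1 = 0 ∧
      ∀ Z : VecField EM M, Z.Smooth →
        (dorfman c θ H e e x).2.2 (Z x) = Z.deriv (fun y => Q.pairE c y (e y) (e y)) x := by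
  refine ⟨congrFun (mlieBracket_self (I := 𝓘(ℝ, EM)) (V := fun y => (e y).1)) x, ?_, fun Z hZ => ?_⟩
  · have h1 : θ.curv x ![(e x).1, (e x).1] = 0 :=
      (θ.curv x).map_eq_zero_of_eq _ (show ![(e x).1, (e x).1] 0 = ![(e x).1, (e x).1] 1 from rfl)
        (by decide)
    have h2 : (dorfman c θ H e e x).2.1 = -⁅(e x).2.1, (e x).2.1⁆
      - θ.curv x ![(e x).1, (e x).1]
      + θ.covDeriv (fun y => (e y).2.1) x (e x).1
      - θ.covDeriv (fun y => (e y).2.1) x (e x).1 := rfl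
    rw [h2, h1, lie_self]
    abel
  · have h1 : H x ![(e x).1, (e x).1, Z x] = 0 :=
      (H x).map_eq_zero_of_eq _
        (show ![(e x).1, (e x).1, Z x] 0 = ![(e x).1, (e x).1, Z x] 1 from rfl) (by decide)
    have h2 : (fun y => Q.pairE c y (e y) (e y)) =
        fun y => (e y).2.2 (e y).1 + Q.pairing c y (e y).2.1 (e y).2.1 := by
      funext y
      simp only [pairE]
      ring
    rw [dorfman_cotangent c θ H he he hZ, h1, h2,
      VecField.deriv_add Z ((he.2.2 _ he.1).mdifferentiableAt (by simp))
        ((contMDiff_pairing c hc he.2.1 he.2.1).mdifferentiableAt (by simp)),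
      θ.deriv_pairing c hc he.2.1 he.2.1 Z x, pairing_symm c hs x (e x).2.1]
    ring

/-- Every covector is the differential of the square of a section. -/
theorem exists_deriv_pairE_eq (Q : PrincipalBundle EM M EG G EP P)
    (c : LinearMap.BilinForm ℝ (GroupLieAlgebra 𝓘(ℝ, EG) G)) (x : M)
    (ξ : TangentSpace 𝓘(ℝ, EM) x →L[ℝ] ℝ) :
    ∃ e : ∀ x, Q.EFib x, Q.SmoothE e ∧ ∀ Z : VecField EM M,
      Z.deriv (fun y => Q.pairE c y (e y) (e y)) x = ξ (Z x) := by
  obtain ⟨v, hv⟩ : ∃ v, ξ v = 1 ∨ ξ = 0 := by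
    by_cases h0 : ξ = 0
    · exact ⟨0, Or.inr h0⟩
    obtain ⟨v, hv⟩ : ∃ v, ξ v ≠ 0 := by
      by_contra! h
      exact h0 (ContinuousLinearMap.ext h)
    exact ⟨(ξ v)⁻¹ • v, Or.inl (by rw [map_smul, smul_eq_mul, inv_mul_cancel₀ hv])⟩
  obtain ⟨X, hX, hXx⟩ := VecField.exists_eq x v
  obtain ⟨h, hh, hx, hd⟩ := exists_mfderiv_eq x ξ
  -- The section is `X + h dh` with `h(x) = 0`, `dh = ξ` at `x` and `X(x) = v`. Its square is `h ·
  -- X(h)`, whose differential at `x` is `ξ(v) ξ`; this is ξ because either `ξ(v) = 1` or `ξ = 0`.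
  refine ⟨fun y => (X y, 0, h y • (show TangentSpace 𝓘(ℝ, EM) y →L[ℝ] ℝ from
    mfderiv 𝓘(ℝ, EM) 𝓘(ℝ, ℝ) h y)), ⟨hX, SmoothAd.zero, fun Z hZ => hh.mul (hZ.deriv hh)⟩,
    fun Z => ?_⟩
  have hpair : (fun y => Q.pairE c y (X y, 0, h y • (show TangentSpace 𝓘(ℝ, EM) y →L[ℝ] ℝ from
      mfderiv 𝓘(ℝ, EM) 𝓘(ℝ, ℝ) h y)) (X y, 0, h y • (show TangentSpace 𝓘(ℝ, EM) y →L[ℝ] ℝ from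
      mfderiv 𝓘(ℝ, EM) 𝓘(ℝ, ℝ) h y))) = fun y => h y * X.deriv h y := by
    funext y
    refine Eq.trans (b := (1 / 2) * (h y * X.deriv h y + h y * X.deriv h y)
      + Q.pairing c y 0 0) rfl ?_
    rw [map_zero]
    ring
  have hξX : X.deriv h x = ξ v := (hd (X x)).trans (by rw [hXx])
  have hξZ : Z.deriv h x = ξ (Z x) := hd (Z x)
  rw [hpair, VecField.deriv_mul Z (hh.mdifferentiableAt (by simp))
    ((hX.deriv hh).mdifferentiableAt (by simp)), hx, hξX, hξZ]
  rcases hv with hv | rfl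
  · rw [hv]; ring
  · simp

theorem contMDiff_pairE (hc : ∀ (g : G) A B, c (Ad g A) (Ad g B) = c A B)
    {e : ∀ x, Q.EFib x} (he : Q.SmoothE e) :
    ContMDiff 𝓘(ℝ, EM) 𝓘(ℝ, ℝ) ∞ (fun y => Q.pairE c y (e y) (e y)) :=
  (contMDiff_const.mul ((he.2.2 _ he.1).add (he.2.2 _ he.1))).add
    (contMDiff_pairing c hc he.2.1 he.2.1)

variable {f : BundleAut (EM := EM) Q.EFib Q.SmoothE}

set_option maxHeartbeats 1000000 in
/-- Automorphisms act on covectors through their base map. -/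
theorem aut_cotangent (hs : c.IsSymm) (hc : ∀ (g : G) A B, c (Ad g A) (Ad g B) = c A B)
    (hf : f ∈ AutE c θ H) (x : M) (ξ : TangentSpace 𝓘(ℝ, EM) x →L[ℝ] ℝ) :
    (f.fib x (0, 0, ξ)).1 = 0 ∧ (f.fib x (0, 0, ξ)).2.1 = 0 ∧
      ∀ w, (f.fib x (0, 0, ξ)).2.2 (dEquiv f.base x w) = ξ w := by
  -- ξ is the value at `x` of `[e, e]`, so its image is the value of `[f·e, f·e] = d⟨f·e, f·e⟩`.
  -- Since f preserves the pairing, this square pulls back under `f.base` to `⟨e, e⟩`.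
  obtain ⟨e, he, hD⟩ := exists_deriv_pairE_eq Q c x ξ
  have hself := dorfman_self (θ := θ) (H := H) hs hc he x
  have hval : dorfman c θ H e e x = (0, 0, ξ) := by
    refine Prod.ext hself.1 (Prod.ext hself.2.1 (ContinuousLinearMap.ext fun w => ?_))
    obtain ⟨Z, hZ, rfl⟩ := VecField.exists_eq x w
    exact (hself.2.2 Z hZ).trans (hD Z)
  have hpush := congrFun (hf.2 e e he he) (f.base x)
  rw [f.push_base, hval] at hpush
  have hself' := dorfman_self (θ := θ) (H := H) hs hc (f.smooth_push.2 he) (f.base x)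
  rw [← hpush] at hself'
  refine ⟨hself'.1, hself'.2.1, fun w => ?_⟩
  obtain ⟨Z, Z', hZ, hZ', hr, rfl⟩ := exists_related_eq f.base x w
  rw [hr, hself'.2.2 Z' hZ', deriv_related hr x
    ((contMDiff_pairE hc (f.smooth_push.2 he)).mdifferentiableAt (by simp)), ← hD Z]
  congr 1
  funext y
  rw [f.push_base]
  exact hf.1 y _ _

/-- Automorphisms preserve the anchor. -/
theorem aut_tangent (hs : c.IsSymm) (hc : ∀ (g : G) A B, c (Ad g A) (Ad g B) = c A B)
    (hf : f ∈ AutE c θ H) (x : M) (e : Q.EFib x) : (f.fib x e).1 = dEquiv f.base x e.1 := by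
  rw [← ContinuousLinearEquiv.symm_apply_eq]
  refine sub_eq_zero.1 ((Module.forall_dual_apply_eq_zero_iff ℝ _).1 fun ξ => ?_)
  rw [map_sub, sub_eq_zero]
  -- Pairing with a covector sees half its value on the tangent component, and `aut_cotangent`
  -- describes the image of ξ. Hence no ξ separates the two vectors.
  have h := hf.1 x (0, 0, LinearMap.toContinuousLinearMap ξ) e
  obtain ⟨h1, h2, h3⟩ := aut_cotangent hs hc hf x (LinearMap.toContinuousLinearMap ξ)
  have h4 := h3 ((dEquiv f.base x).symm (f.fib x e).1)
  rw [ContinuousLinearEquiv.apply_symm_apply] at h4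
  simp only [pairE, h1, h2, h4, map_zero, LinearMap.zero_apply] at h
  have h5 : LinearMap.toContinuousLinearMap ξ ((dEquiv f.base x).symm (f.fib x e).1) =
    LinearMap.toContinuousLinearMap ξ e.1 := by linarith
  exact h5

end PrincipalBundle
end AnchorPreserved

/-! ### The block decomposition, and the extraction of ν, `a` and `B`. -/

noncomputable section Decomposition

variable {EM M EG G EP P : Type*}
  [NormedAddCommGroup EM] [NormedSpace ℝ EM] [FiniteDimensional ℝ EM]
  [TopologicalSpace M] [T2Space M] [ChartedSpace EM M] [IsManifold 𝓘(ℝ, EM) ∞ M]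
  [NormedAddCommGroup EG] [NormedSpace ℝ EG] [FiniteDimensional ℝ EG]
  [TopologicalSpace G] [ChartedSpace EG G] [Group G] [LieGroup 𝓘(ℝ, EG) ∞ G]
  [NormedAddCommGroup EP] [NormedSpace ℝ EP] [FiniteDimensional ℝ EP]
  [TopologicalSpace P] [ChartedSpace EP P] [IsManifold 𝓘(ℝ, EP) ∞ P]

section Blocks

variable {V V' A A' D : Type*} [AddCommGroup V] [Module ℝ V] [AddCommGroup V'] [Module ℝ V']
  [AddCommGroup A] [Module ℝ A] [AddCommGroup A'] [Module ℝ A'] [AddCommGroup D] [Module ℝ D]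

theorem linearEquiv_prod_decompose (L : (V × A × D) ≃ₗ[ℝ] V') (e : V × A × D) :
    L e = L (e.1, 0, 0) + L (0, e.2.1, 0) + L (0, 0, e.2.2) := by
  rw [← map_add, ← map_add]
  congr 1
  refine Prod.ext ?_ (Prod.ext ?_ ?_) <;> simp

variable {D' : Type*} [AddCommGroup D'] [Module ℝ D']

/-- The middle block of a linear map between threefold products. -/
def middleBlock (L : (V × A × D) ≃ₗ[ℝ] V' × A' × D') : A →ₗ[ℝ] A' :=
  LinearMap.fst ℝ _ _ ∘ₗ LinearMap.snd ℝ _ _ ∘ₗ L.toLinearMap ∘ₗ LinearMap.inr ℝ _ _ ∘ₗ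
    LinearMap.inl ℝ _ _

/-- The block from the first to the middle factor of a linear map between threefold products. -/
def leftMiddleBlock (L : (V × A × D) ≃ₗ[ℝ] V' × A' × D') : V →ₗ[ℝ] A' :=
  LinearMap.fst ℝ _ _ ∘ₗ LinearMap.snd ℝ _ _ ∘ₗ L.toLinearMap ∘ₗ LinearMap.inl ℝ _ _

/-- The block from the first to the dual factor, as a bilinear form. -/
def leftRightBlock [TopologicalSpace V'] (L : (V × A × D) ≃ₗ[ℝ] V' × A' × (V' →L[ℝ] ℝ))
    (φ : V ≃ₗ[ℝ] V') : LinearMap.BilinForm ℝ V :=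
  LinearMap.mk₂ ℝ (fun v w => (L (v, 0, 0)).2.2 (φ w))
    (fun r t w => by
      have h : ((r + t, 0, 0) : V × A × D) = (r, 0, 0) + (t, 0, 0) := by simp
      rw [h, map_add]; rfl)
    (fun k r w => by
      have h : ((k • r, 0, 0) : V × A × D) = k • (r, 0, 0) := by simp
      rw [h, map_smul]; rfl)
    (fun v w w' => by rw [map_add, map_add])
    (fun k v w => by rw [map_smul, map_smul])

end Blocks

namespace PrincipalBundle

variable {Q : PrincipalBundle EM M EG G EP P}
  {c : LinearMap.BilinForm ℝ (GroupLieAlgebra 𝓘(ℝ, EG) G)}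
  {θ : Q.Connection} {H : VForm EM M 3 ℝ}

/-- The block of a bundle map of `E` that maps `ad P` to `ad P`. -/
def adBlock (f : BundleAut (EM := EM) Q.EFib Q.SmoothE) (x : M) :
    Q.adP x →ₗ[ℝ] Q.adP (f.base x) := middleBlock (f.fib x)

/-- The block of a bundle map of `E` that maps `T` to `ad P`. -/
def tangentAdBlock (f : BundleAut (EM := EM) Q.EFib Q.SmoothE) (x : M) :
    TangentSpace 𝓘(ℝ, EM) x →ₗ[ℝ] Q.adP (f.base x) := leftMiddleBlock (f.fib x)

/-- The block of a bundle map of `E` that maps `T` to `T^*`, as a bilinear form. -/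
def tangentCotangentBlock (f : BundleAut (EM := EM) Q.EFib Q.SmoothE) (x : M) :
    LinearMap.BilinForm ℝ (TangentSpace 𝓘(ℝ, EM) x) :=
  leftRightBlock (f.fib x) (dEquiv f.base x).toLinearEquiv

theorem fib_decompose (f : BundleAut (EM := EM) Q.EFib Q.SmoothE) (x : M) (e : Q.EFib x) :
    f.fib x e = f.fib x (e.1, 0, 0) + f.fib x (0, e.2.1, 0) + f.fib x (0, 0, e.2.2) :=
  linearEquiv_prod_decompose (f.fib x) e

variable {f : BundleAut (EM := EM) Q.EFib Q.SmoothE}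

section
variable (hs : c.IsSymm) (hc : ∀ (g : G) A B, c (Ad g A) (Ad g B) = c A B) (hf : f ∈ AutE c θ H)
include hs hc hf

theorem aut_ad_eq (x : M) (e : Q.EFib x) :
    (f.fib x e).2.1 = tangentAdBlock f x e.1 + adBlock f x e.2.1 := by
  rw [fib_decompose]
  refine Eq.trans (congrArg (fun t => tangentAdBlock f x e.1 + adBlock f x e.2.1 + t)
    (aut_cotangent hs hc hf x e.2.2).2.1) (add_zero _)

theorem aut_pairE (x : M) (e e' : Q.EFib x) :
    1 / 2 * ((f.fib x e').2.2 (dEquiv f.base x e.1) + (f.fib x e).2.2 (dEquiv f.base x e'.1))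
      + Q.pairing c (f.base x) (f.fib x e).2.1 (f.fib x e').2.1 = Q.pairE c x e e' := by
  refine Eq.trans (congrArg₂ (fun u v => 1 / 2 * ((f.fib x e').2.2 u + (f.fib x e).2.2 v)
    + Q.pairing c (f.base x) (f.fib x e).2.1 (f.fib x e').2.1) ?_ ?_) (hf.1 x e e')
  · exact (aut_tangent hs hc hf x e).symm
  · exact (aut_tangent hs hc hf x e').symm

/-- Triangularity is what makes the diagonal block invertible. If `r` is killed by the block, its
image under f is a covector, which is already the image of a covector, so `r = 0`. A preimage of
`(0, t, 0)` has zero tangent component, so its component in `ad P` maps to `t`. -/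
theorem adBlock_bijective (x : M) : Function.Bijective (adBlock f x) := by
  constructor
  · refine (injective_iff_map_eq_zero (adBlock f x)).2 fun r hr => ?_
    obtain ⟨h1, h2, h3⟩ := aut_cotangent hs hc hf x
      ((f.fib x (0, r, 0)).2.2.comp (dEquiv f.base x).toContinuousLinearMap)
    have h4 : f.fib x (0, r, 0) = f.fib x (0, 0,
        (f.fib x (0, r, 0)).2.2.comp (dEquiv f.base x).toContinuousLinearMap) := by
      refine Prod.ext ?_ (Prod.ext (hr.trans h2.symm) (ContinuousLinearMap.ext fun v => ?_))
      · exact ((aut_tangent hs hc hf x (0, r, 0)).trans (map_zero (dEquiv f.base x))).trans h1.symm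
      · obtain ⟨w, rfl⟩ := (dEquiv f.base x).surjective v
        exact (h3 w).symm
    exact congrArg (fun e => e.2.1) ((f.fib x).injective h4)
  · intro t
    obtain ⟨e, he⟩ := (f.fib x).surjective (0, t, 0)
    have h2 : (0 : TangentSpace 𝓘(ℝ, EM) (f.base x)) = dEquiv f.base x e.1 :=
      (congrArg Prod.fst he).symm.trans (aut_tangent hs hc hf x e)
    have h3 : t = tangentAdBlock f x e.1 + adBlock f x e.2.1 :=
      (congrArg (fun e => e.2.1) he).symm.trans (aut_ad_eq hs hc hf x e)
    have h4 : e.1 = 0 := (dEquiv f.base x).injective (h2.symm.trans (map_zero _).symm)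
    rw [h4, map_zero, zero_add] at h3
    exact ⟨_, h3.symm⟩

/-- The inverse of the block is the corresponding component of the inverse of f, so smoothness of
the induced map of `ad P` can be read off from f. -/
theorem adBlock_pull (s : Q.AdSection) (x : M) :
    adBlock f x (f.pull (fun y => (0, s y, 0)) x).2.1 = s (f.base x) := by
  have h1 : f.fib x (f.pull (fun y => (0, s y, 0)) x) = (0, s (f.base x), 0) :=
    (f.fib x).apply_symm_apply _
  have h2 := aut_tangent hs hc hf x (f.pull (fun y => (0, s y, 0)) x)
  have h3 := aut_ad_eq hs hc hf x (f.pull (fun y => (0, s y, 0)) x)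
  rw [h1] at h2 h3
  have h4 : (f.pull (fun y => (0, s y, 0)) x).1 = 0 :=
    (dEquiv f.base x).injective (h2.symm.trans (map_zero _).symm)
  rw [h4, map_zero, zero_add] at h3
  exact h3.symm
end

/-- The automorphism of `ad P` induced by an automorphism of `E`. -/
def autAd (hs : c.IsSymm) (hc : ∀ (g : G) A B, c (Ad g A) (Ad g B) = c A B) (hf : f ∈ AutE c θ H) :
    BundleAut (EM := EM) (fun x => Q.adP x) Q.SmoothAd where
  base := f.base
  fib x := LinearEquiv.ofBijective (adBlock f x) (adBlock_bijective hs hc hf x)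
  smooth s := by
    have h1 : (fun x => (LinearEquiv.ofBijective (adBlock f x)
        (adBlock_bijective hs hc hf x)).symm (s (f.base x))) =
        fun x => (f.pull (fun y => (0, s y, 0)) x).2.1 := by
      funext x
      rw [LinearEquiv.symm_apply_eq]
      exact (adBlock_pull hs hc hf s x).symm
    rw [h1]
    constructor
    · intro h
      -- Pushing forward the component in `ad P` of the pulled-back section returns `s` in that
      -- component, even though the covector parts have been discarded.
      have h2 := (f.smooth_push.2 (SmoothE.ofAd h)).2.1
      have h3 : (fun y => (f.push (fun x => (0, (f.pull (fun y => (0, s y, 0)) x).2.1, 0)) y).2.1)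
          = s := by
        funext y
        obtain ⟨x, rfl⟩ := f.base.surjective y
        exact (congrArg (fun e => e.2.1) (f.push_base
          (fun x => (0, (f.pull (fun y => (0, s y, 0)) x).2.1, 0)) x)).trans
          (adBlock_pull hs hc hf s x)
      rwa [h3] at h2
    · intro h
      exact (f.smooth_pull.2 (SmoothE.ofAd h)).2.1

section
variable (hs : c.IsSymm) (hc : ∀ (g : G) A B, c (Ad g A) (Ad g B) = c A B) (hf : f ∈ AutE c θ H)

/-- The one-form with values in `ad P` attached to an automorphism of `E`. -/
def autForm : Q.AdForm := fun x => ((autAd hs hc hf).fib x).symm.toLinearMap ∘ₗ tangentAdBlock f x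

theorem autAd_autForm (x : M) (v : TangentSpace 𝓘(ℝ, EM) x) :
    (autAd hs hc hf).fib x (autForm hs hc hf x v) = tangentAdBlock f x v :=
  ((autAd hs hc hf).fib x).apply_symm_apply _

/-- The two-form attached to an automorphism of `E`. -/
def autTwoForm : VForm EM M 2 ℝ := fun x => altOfBilin ((1 / 2 : ℝ) • (tangentCotangentBlock f x
  + (Q.pairing c x).compl₁₂ (autForm hs hc hf x) (autForm hs hc hf x)))

theorem autAd_pairing (x : M) (r t : Q.adP x) : Q.pairing c (f.base x)
    ((autAd hs hc hf).fib x r) ((autAd hs hc hf).fib x t) = Q.pairing c x r t := by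
  have h := hf.1 x (0, r, 0) (0, t, 0)
  have h1 : (f.fib x (0, r, 0)).1 = 0 := (aut_tangent hs hc hf x _).trans (map_zero _)
  have h2 : (f.fib x (0, t, 0)).1 = 0 := (aut_tangent hs hc hf x _).trans (map_zero _)
  simp only [pairE, h1, h2, map_zero, add_zero, mul_zero,
    zero_add] at h
  exact h

/-- This is the isometry condition on two tangent vectors, whose pairing is zero. -/
theorem tangentCotangentBlock_symm (x : M) (v w : TangentSpace 𝓘(ℝ, EM) x) :
    tangentCotangentBlock f x w v + tangentCotangentBlock f x v w
      + 2 * Q.pairing c x (autForm hs hc hf x v) (autForm hs hc hf x w) = 0 := by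
  have h := aut_pairE hs hc hf x (v, 0, 0) (w, 0, 0)
  have h3 := autAd_pairing hs hc hf x (autForm hs hc hf x v) (autForm hs hc hf x w)
  rw [autAd_autForm, autAd_autForm] at h3
  have h4 : Q.pairE c x (v, 0, 0) (w, 0, 0) = 1 / 2 * (0 + 0) + Q.pairing c x 0 0 := rfl
  have h5 : Q.pairing c x 0 0 = 0 := by rw [map_zero]
  have h6 : 1 / 2 * (tangentCotangentBlock f x w v + tangentCotangentBlock f x v w)
    + Q.pairing c (f.base x) (tangentAdBlock f x v) (tangentAdBlock f x w) =
      Q.pairE c x (v, 0, 0) (w, 0, 0) := h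
  rw [h3, h4, h5] at h6
  linarith

/-- By `tangentCotangentBlock_symm`, the block plus `c(a, a)` is already alternating;
antisymmetrising with the factor ½ leaves it unchanged. -/
theorem autTwoForm_apply (x : M) (v w : TangentSpace 𝓘(ℝ, EM) x) :
    autTwoForm hs hc hf x ![v, w] = tangentCotangentBlock f x v w
      + Q.pairing c x (autForm hs hc hf x v) (autForm hs hc hf x w) := by
  have h1 : autTwoForm hs hc hf x ![v, w] = (1 / 2) * (tangentCotangentBlock f x v w
      + Q.pairing c x (autForm hs hc hf x v) (autForm hs hc hf x w))
    - (1 / 2) * (tangentCotangentBlock f x w v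
      + Q.pairing c x (autForm hs hc hf x w) (autForm hs hc hf x v)) := rfl
  have h2 := tangentCotangentBlock_symm hs hc hf x v w
  have h3 := pairing_symm c hs x (autForm hs hc hf x v) (autForm hs hc hf x w)
  rw [h1]
  linarith

theorem autForm_smooth : Q.SmoothForm (autForm hs hc hf) := by
  intro X hX
  have h1 := (f.smooth_push.2 (SmoothE.ofTangent hX)).2.1
  refine (congrArg Q.SmoothAd ((autAd hs hc hf).pull_eq_of_related fun x => ?_)).mp
    ((autAd hs hc hf).smooth_pull.2 h1)
  rw [autAd_autForm]
  exact congrArg (fun e => e.2.1) (f.push_base (fun x => (X x, 0, 0)) x)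

theorem autTwoForm_smooth : (autTwoForm hs hc hf).Smooth := by
  intro X hX
  obtain ⟨Z', hZ', hr⟩ := (hX 1).exists_related f.base
  have h1 := ((f.smooth_push.2 (SmoothE.ofTangent (hX 0))).2.2 Z' hZ').comp f.base.contMDiff
  refine (h1.add (contMDiff_pairing c hc (autForm_smooth hs hc hf _ (hX 0))
    (autForm_smooth hs hc hf _ (hX 1)))).congr fun x => ?_
  have h2 : (fun i => X i x) = ![X 0 x, X 1 x] := by funext i; fin_cases i <;> rfl
  rw [h2, autTwoForm_apply]
  refine congrArg (fun t : ℝ => t + Q.pairing c x (autForm hs hc hf x (X 0 x))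
    (autForm hs hc hf x (X 1 x))) ?_
  refine Eq.symm ((congrArg₂ (fun (e : Q.EFib (f.base x)) w => e.2.2 w)
    (f.push_base (fun x => (X 0 x, 0, 0)) x) (hr x).symm))

/-- A tangent vector `w` and `r` in `ad P` are orthogonal, hence so are their images. This says that
half the left side cancels `c(νa(w), νr) = c(a(w), r)`. -/
theorem aut_ad_cotangent (x : M) (r : Q.adP x) (w : TangentSpace 𝓘(ℝ, EM) x) :
    (f.fib x (0, r, 0)).2.2 (dEquiv f.base x w) =
      -2 * Q.pairing c x (autForm hs hc hf x w) r := by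
  have h1 := autAd_pairing hs hc hf x (autForm hs hc hf x w) r
  rw [autAd_autForm] at h1
  have h2 : (f.fib x (w, 0, 0)).2.2 (dEquiv f.base x 0) = 0 :=
    (congrArg (f.fib x (w, 0, 0)).2.2 (map_zero (dEquiv f.base x))).trans (map_zero _)
  have h3 : 1 / 2 * ((f.fib x (0, r, 0)).2.2 (dEquiv f.base x w)
      + (f.fib x (w, 0, 0)).2.2 (dEquiv f.base x 0))
    + Q.pairing c (f.base x) (tangentAdBlock f x w) ((autAd hs hc hf).fib x r) =
      1 / 2 * (0 + 0) + Q.pairing c x 0 r := aut_pairE hs hc hf x (w, 0, 0) (0, r, 0)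
  have h4 : Q.pairing c x 0 r = 0 := by rw [map_zero]; rfl
  linarith

theorem aut_eq (x : M) (e : Q.EFib x) : f.fib x e =
    (diagE (autAd hs hc hf) (shearE c (autTwoForm hs hc hf) (autForm hs hc hf) ⟨x, e⟩)).2 := by
  refine (eq_diagE_shearE (ν := autAd hs hc hf) (e' := f.fib x e)).2
    ⟨(aut_tangent hs hc hf x e).symm, ?_, fun w => ?_⟩
  · rw [aut_ad_eq hs hc hf, ← autAd_autForm hs hc hf, map_add]
    rfl
  · have h1 := (aut_cotangent hs hc hf x e.2.2).2.2 w
    have h2 := aut_ad_cotangent hs hc hf x e.2.1 w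
    have h3 : (f.fib x e).2.2 (dEquiv f.base x w) = tangentCotangentBlock f x e.1 w
        + (f.fib x (0, e.2.1, 0)).2.2 (dEquiv f.base x w)
        + (f.fib x (0, 0, e.2.2)).2.2 (dEquiv f.base x w) := by
      exact congrArg (fun t => t.2.2 (dEquiv f.base x w)) (fib_decompose f x e)
    have h4 := autTwoForm_apply hs hc hf x e.1 w
    refine h3.trans ?_
    linarith

end
end PrincipalBundle
end Decomposition

/-! ### Necessity of the equations for `d^θ`, `F` and `H`. -/

noncomputable section Conditions

variable {EM M EG G EP P : Type*}
  [NormedAddCommGroup EM] [NormedSpace ℝ EM] [FiniteDimensional ℝ EM]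
  [TopologicalSpace M] [T2Space M] [ChartedSpace EM M] [IsManifold 𝓘(ℝ, EM) ∞ M]
  [NormedAddCommGroup EG] [NormedSpace ℝ EG] [FiniteDimensional ℝ EG]
  [TopologicalSpace G] [ChartedSpace EG G] [Group G] [LieGroup 𝓘(ℝ, EG) ∞ G]
  [NormedAddCommGroup EP] [NormedSpace ℝ EP] [FiniteDimensional ℝ EP]
  [TopologicalSpace P] [ChartedSpace EP P] [IsManifold 𝓘(ℝ, EP) ∞ P]

/-- This isolates the curvature `F'` in the bracket identity of two vector fields. `S`, `S'` and `D`
are the terms of `d^θ a`; the zeros are the absent components in `ad P`. -/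
theorem curvature_of_bracket {V W : Type*} [LieRing V] [LieAlgebra ℝ V] [LieRing W]
    [LieAlgebra ℝ W] (L : V ≃ₗ[ℝ] W) {A B S S' D F : V} {F' u v : W} (k : L ⁅A, B⁆ = ⁅u, v⁆)
    (h : -⁅u, v⁆ - F' + L (S + ⁅A, B⁆) - L (S' + ⁅B, A⁆) =
      L (D + (-⁅(0 : V), (0 : V)⁆ - F + 0 - 0))) :
    F' = L (F + (S - S' - D) + (1 / 2 : ℝ) • (2 : ℝ) • ⁅A, B⁆) := by
  have hs : (1 / 2 : ℝ) • (2 : ℝ) • ⁅A, B⁆ = ⁅A, B⁆ := by rw [smul_smul]; norm_num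
  have sk : ⁅B, A⁆ = -⁅A, B⁆ := (lie_skew _ _).symm
  rw [hs]
  rw [← k, sk] at h
  have h' : F' = -L ⁅A, B⁆ + L (S + ⁅A, B⁆) - L (S' + -⁅A, B⁆)
      - L (D + (-⁅(0 : V), (0 : V)⁆ - F + 0 - 0)) := by
    rw [← h]; abel
  rw [h', ← map_neg, ← map_add, ← map_sub, ← map_sub, lie_zero]
  congr 1
  abel

namespace PrincipalBundle

variable {Q : PrincipalBundle EM M EG G EP P}
  {c : LinearMap.BilinForm ℝ (GroupLieAlgebra 𝓘(ℝ, EG) G)}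
  {θ : Q.Connection} {H : VForm EM M 3 ℝ} {f : BundleAut (EM := EM) Q.EFib Q.SmoothE}

theorem Connection.curv_zero_right (θ : Q.Connection) (x : M) (v : TangentSpace 𝓘(ℝ, EM) x) :
    θ.curv x ![v, 0] = 0 := (θ.curv x).map_coord_zero 1 rfl

theorem mlieBracket_zero_apply (X : VecField EM M) (x : M) :
    mlieBracket 𝓘(ℝ, EM) X (fun _ => 0) x = 0 := congrFun mlieBracket_zero_right x

variable (hs : c.IsSymm) (hc : ∀ (g : G) A B, c (Ad g A) (Ad g B) = c A B) (hf : f ∈ AutE c θ H)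
include hs hc hf

theorem shearRelated_push (e : ∀ x, Q.EFib x) :
    ShearRelated c (autAd hs hc hf) (autTwoForm hs hc hf) (autForm hs hc hf) e (f.push e) :=
  shearRelated_iff.2 fun x => (f.push_base e x).trans (aut_eq hs hc hf x (e x))

theorem shearRelated_dorfman {e e' : ∀ x, Q.EFib x} (he : Q.SmoothE e) (he' : Q.SmoothE e') :
    ShearRelated c (autAd hs hc hf) (autTwoForm hs hc hf) (autForm hs hc hf) (dorfman c θ H e e')
      (dorfman c θ H (f.push e) (f.push e')) := by
  rw [← hf.2 e e' he he']
  exact shearRelated_push hs hc hf _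

/-- The component in `ad P` of the condition that an automorphism preserves the bracket. -/
theorem aut_dorfman_ad {X X' Y Y' : VecField EM M} (hX : X.Smooth) (hY : Y.Smooth)
    (hXX : ∀ x, dEquiv f.base x (X x) = X' (f.base x))
    (hYY : ∀ x, dEquiv f.base x (Y x) = Y' (f.base x))
    {r t r' t' : Q.AdSection} (hr : Q.SmoothAd r) (ht : Q.SmoothAd t)
    (hrr : ∀ x, r' (f.base x) = (autAd hs hc hf).fib x (autForm hs hc hf x (X x) + r x))
    (htt : ∀ x, t' (f.base x) = (autAd hs hc hf).fib x (autForm hs hc hf x (Y x) + t x)) (x : M) :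
    -⁅r' (f.base x), t' (f.base x)⁆ - θ.curv (f.base x) ![X' (f.base x), Y' (f.base x)]
        + θ.covDeriv t' (f.base x) (X' (f.base x)) - θ.covDeriv r' (f.base x) (Y' (f.base x)) =
      (autAd hs hc hf).fib x (autForm hs hc hf x (mlieBracket 𝓘(ℝ, EM) X Y x)
        + (-⁅r x, t x⁆ - θ.curv x ![X x, Y x] + θ.covDeriv t x (X x) - θ.covDeriv r x (Y x))) := by
  have he : Q.SmoothE (fun x => (X x, r x, 0)) := ⟨hX, hr, OneForm.Smooth.zero⟩
  have he' : Q.SmoothE (fun x => (Y x, t x, 0)) := ⟨hY, ht, OneForm.Smooth.zero⟩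
  have h1 := shearRelated_push hs hc hf (fun x => (X x, r x, 0))
  have h2 := shearRelated_push hs hc hf (fun x => (Y x, t x, 0))
  have h3 := (shearRelated_dorfman hs hc hf he he').ad x
  -- As the base map is surjective, the relations determine the primed data: they are the components
  -- of the two pushed sections.
  have e1 : X' = fun y => (f.push (fun x => (X x, r x, 0)) y).1 := by
    funext y
    obtain ⟨x, rfl⟩ := f.base.surjective y
    exact (hXX x).symm.trans (h1.tangent x)
  have e2 : Y' = fun y => (f.push (fun x => (Y x, t x, 0)) y).1 := by
    funext y
    obtain ⟨x, rfl⟩ := f.base.surjective y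
    exact (hYY x).symm.trans (h2.tangent x)
  have e3 : r' = fun y => (f.push (fun x => (X x, r x, 0)) y).2.1 := by
    funext y
    obtain ⟨x, rfl⟩ := f.base.surjective y
    exact (hrr x).trans (h1.ad x).symm
  have e4 : t' = fun y => (f.push (fun x => (Y x, t x, 0)) y).2.1 := by
    funext y
    obtain ⟨x, rfl⟩ := f.base.surjective y
    exact (htt x).trans (h2.ad x).symm
  rw [e1, e2, e3, e4]
  exact h3

set_option maxHeartbeats 1000000 in
-- For two sections with only components in `ad P`, every term of the bracket identity except `-[r,
-- t]` vanishes.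
theorem autAd_mem : autAd hs hc hf ∈ Q.AutAd c := by
  refine ⟨autAd_pairing hs hc hf, fun x r t => ?_⟩
  obtain ⟨r, hr, rfl⟩ := exists_smoothAd_eq x r
  obtain ⟨t, ht, rfl⟩ := exists_smoothAd_eq x t
  have h := aut_dorfman_ad hs hc hf (X := fun _ => 0) (X' := fun _ => 0) (Y := fun _ => 0)
    (Y' := fun _ => 0) VecField.Smooth.zero VecField.Smooth.zero (fun _ => map_zero _)
    (fun _ => map_zero _) (r' := (autAd hs hc hf).push r) (t' := (autAd hs hc hf).push t) hr ht
    (fun x => ((autAd hs hc hf).push_base r x).trans (congrArg ((autAd hs hc hf).fib x)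
      (by rw [map_zero, zero_add])))
    (fun x => ((autAd hs hc hf).push_base t x).trans (congrArg ((autAd hs hc hf).fib x)
      (by rw [map_zero, zero_add]))) x
  have h1 : (autAd hs hc hf).push r (f.base x) = (autAd hs hc hf).fib x (r x) :=
    (autAd hs hc hf).push_base r x
  have h2 : (autAd hs hc hf).push t (f.base x) = (autAd hs hc hf).fib x (t x) :=
    (autAd hs hc hf).push_base t x
  rw [mlieBracket_zero_apply, θ.curv_zero_right, θ.curv_zero_right, LinearMap.map_zero,
    LinearMap.map_zero, LinearMap.map_zero, LinearMap.map_zero, LinearMap.map_zero, h1, h2,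
    zero_add, sub_zero, sub_zero, sub_zero, sub_zero, add_zero, add_zero] at h
  exact neg_injective ((map_neg ((autAd hs hc hf).fib x) ⁅r x, t x⁆).symm.trans h.symm)

set_option maxHeartbeats 1000000 in
-- Test on a pulled-back vector field and a section of `ad P`. The image of the field has the
-- component νa(X) in `ad P`, and its fibre bracket with the image section supplies the term `[a(X),
-- r]`.
theorem aut_preservesDeriv : θ.PreservesDeriv (autAd hs hc hf) (autForm hs hc hf) := by
  intro X r hX hr y
  obtain ⟨x, rfl⟩ := (autAd hs hc hf).base.surjective y
  have hX' := hX.mpullback f.base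
  have h := aut_dorfman_ad hs hc hf (X' := X) (Y := fun _ => 0) (Y' := fun _ => 0) hX'
    VecField.Smooth.zero (dEquiv_mpullback f.base X) (fun _ => map_zero _) (r := fun _ => 0)
    (r' := (autAd hs hc hf).push (fun x => autForm hs hc hf x
      (mpullback 𝓘(ℝ, EM) 𝓘(ℝ, EM) f.base X x))) (t' := r) SmoothAd.zero
    ((autAd hs hc hf).smooth_pull.2 hr)
    (fun x => ((autAd hs hc hf).push_base _ x).trans (congrArg ((autAd hs hc hf).fib x)
      (by rw [add_zero])))
    (fun x => (((autAd hs hc hf).fib x).apply_symm_apply _).symm.trans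
      (congrArg ((autAd hs hc hf).fib x) (by rw [map_zero, zero_add]; rfl))) x
  have h1 : (autAd hs hc hf).push (fun x => autForm hs hc hf x
      (mpullback 𝓘(ℝ, EM) 𝓘(ℝ, EM) f.base X x)) (f.base x) = (autAd hs hc hf).fib x
        (autForm hs hc hf x (mpullback 𝓘(ℝ, EM) 𝓘(ℝ, EM) f.base X x)) :=
    (autAd hs hc hf).push_base _ x
  have h2 : (autAd hs hc hf).fib x ((autAd hs hc hf).pull r x) = r (f.base x) :=
    ((autAd hs hc hf).fib x).apply_symm_apply _
  have h3 := (autAd_mem hs hc hf).2 x (autForm hs hc hf x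
      (mpullback 𝓘(ℝ, EM) 𝓘(ℝ, EM) f.base X x)) ((autAd hs hc hf).pull r x)
  rw [h2] at h3
  rw [mlieBracket_zero_apply, θ.curv_zero_right, θ.curv_zero_right, LinearMap.map_zero,
    LinearMap.map_zero, LinearMap.map_zero, h1, zero_lie, neg_zero,
    zero_add, sub_zero, sub_zero, sub_zero, sub_zero, zero_add] at h
  refine Eq.trans ?_ ((autAd hs hc hf).push_base _ x).symm
  refine Eq.trans ?_ (map_add ((autAd hs hc hf).fib x) _ _).symm
  refine (neg_add_eq_iff_eq_add.1 h).trans ((add_comm _ _).trans ?_)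
  exact congrArg₂ (· + ·) rfl h3.symm

set_option maxHeartbeats 1000000 in
-- Test on two vector fields. Their images have components νa(X) and νa(Y), whose covariant
-- derivatives are known from `aut_preservesDeriv`; the only unknown left is the curvature.
theorem aut_preservesCurv : θ.PreservesCurv (autAd hs hc hf) (autForm hs hc hf) := by
  intro X Y hX hY y
  obtain ⟨x, rfl⟩ := (autAd hs hc hf).base.surjective y
  have hD := aut_preservesDeriv hs hc hf
  have ha := autForm_smooth hs hc hf
  have hX' := hX.mpullback f.base
  have hY' := hY.mpullback f.base
  have rel : ∀ (s : Q.AdSection) x, (autAd hs hc hf).push s (f.base x) =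
    (autAd hs hc hf).fib x (s x + 0) := fun s x => by
      rw [add_zero]; exact (autAd hs hc hf).push_base s x
  have rel' : ∀ (s : Q.AdSection) x, (autAd hs hc hf).push s (f.base x) =
    (autAd hs hc hf).fib x (s x) := fun s x => (autAd hs hc hf).push_base s x
  have h := aut_dorfman_ad hs hc hf (X' := X) (Y' := Y) hX' hY' (dEquiv_mpullback f.base X)
    (dEquiv_mpullback f.base Y) (r := fun _ => 0) (t := fun _ => 0) SmoothAd.zero SmoothAd.zero
    (rel (fun x => autForm hs hc hf x (mpullback 𝓘(ℝ, EM) 𝓘(ℝ, EM) f.base X x)))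
    (rel (fun x => autForm hs hc hf x (mpullback 𝓘(ℝ, EM) 𝓘(ℝ, EM) f.base Y x))) x
  have h1 := hD.related hX ((autAd hs hc hf).smooth_push.2 (ha _ hY')) (dEquiv_mpullback f.base X)
    (rel' (fun x => autForm hs hc hf x (mpullback 𝓘(ℝ, EM) 𝓘(ℝ, EM) f.base Y x))) x
  have h2 := hD.related hY ((autAd hs hc hf).smooth_push.2 (ha _ hX')) (dEquiv_mpullback f.base Y)
    (rel' (fun x => autForm hs hc hf x (mpullback 𝓘(ℝ, EM) 𝓘(ℝ, EM) f.base X x))) x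
  have h3 := (autAd_mem hs hc hf).2 x (autForm hs hc hf x
      (mpullback 𝓘(ℝ, EM) 𝓘(ℝ, EM) f.base X x)) (autForm hs hc hf x
      (mpullback 𝓘(ℝ, EM) 𝓘(ℝ, EM) f.base Y x))
  rw [← rel' (fun x => autForm hs hc hf x (mpullback 𝓘(ℝ, EM) 𝓘(ℝ, EM) f.base X x)),
    ← rel' (fun x => autForm hs hc hf x (mpullback 𝓘(ℝ, EM) 𝓘(ℝ, EM) f.base Y x))] at h3
  have h4 := θ.covDeriv_zero x (mpullback 𝓘(ℝ, EM) 𝓘(ℝ, EM) f.base X x)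
  have h5 := θ.covDeriv_zero x (mpullback 𝓘(ℝ, EM) 𝓘(ℝ, EM) f.base Y x)
  rw [h4, h5] at h
  refine Eq.trans ?_ ((autAd hs hc hf).push_base _ x).symm
  refine curvature_of_bracket ((autAd hs hc hf).fib x) h3 (Eq.trans ?_ h)
  exact congrArg₂ (fun p q => -⁅(autAd hs hc hf).push (fun x => autForm hs hc hf x
    (mpullback 𝓘(ℝ, EM) 𝓘(ℝ, EM) f.base X x)) (f.base x), (autAd hs hc hf).push (fun x =>
    autForm hs hc hf x (mpullback 𝓘(ℝ, EM) 𝓘(ℝ, EM) f.base Y x)) (f.base x)⁆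
      - θ.curv (f.base x) ![X (f.base x), Y (f.base x)] + p - q) h1.symm h2.symm

/-- The first two equations being available, `dorfman_cotangent_related` computes the cotangent
component up to its defect, and preservation of the bracket forces this defect to vanish. -/
theorem aut_transformsH :
    θ.TransformsH c H (autAd hs hc hf).base (autTwoForm hs hc hf) (autForm hs hc hf) := by
  intro X Y Z hX hY hZ x
  obtain ⟨Z', hZ', hZZ⟩ := hZ.exists_related f.base
  have hm := autAd_mem hs hc hf
  have he := SmoothE.ofTangent (Q := Q) hX
  have he' := SmoothE.ofTangent (Q := Q) hY
  have h1 := dorfman_cotangent_related (H := H) hs hc hm.1 (autTwoForm_smooth hs hc hf)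
    (autForm_smooth hs hc hf) (aut_preservesDeriv hs hc hf) (aut_preservesCurv hs hc hf) he he'
    (f.smooth_push.2 he) (f.smooth_push.2 he') (shearRelated_push hs hc hf _)
    (shearRelated_push hs hc hf _) hZ hZ' hZZ x
  have h2 := (shearRelated_dorfman hs hc hf he he').cotangent x (Z x)
  have h3 : dEquiv (autAd hs hc hf).base x (Z x) = Z' ((autAd hs hc hf).base x) := hZZ x
  rw [h3, h1] at h2
  linarith

end PrincipalBundle
end Conditions

/-! ### The composition law. -/

noncomputable section Composition

variable {EM M EG G EP P : Type*}
  [NormedAddCommGroup EM] [NormedSpace ℝ EM] [FiniteDimensional ℝ EM]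
  [TopologicalSpace M] [ChartedSpace EM M] [IsManifold 𝓘(ℝ, EM) ∞ M]
  [NormedAddCommGroup EG] [NormedSpace ℝ EG] [FiniteDimensional ℝ EG]
  [TopologicalSpace G] [ChartedSpace EG G] [Group G] [LieGroup 𝓘(ℝ, EG) ∞ G]
  [NormedAddCommGroup EP] [NormedSpace ℝ EP] [FiniteDimensional ℝ EP]
  [TopologicalSpace P] [ChartedSpace EP P] [IsManifold 𝓘(ℝ, EP) ∞ P]

theorem dEquiv_trans (φ ψ : M ≃ₘ^∞⟮𝓘(ℝ, EM), 𝓘(ℝ, EM)⟯ M) (x : M)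
    (v : TangentSpace 𝓘(ℝ, EM) x) :
    dEquiv (φ.trans ψ) x v = dEquiv ψ (φ x) (dEquiv φ x v) :=
  congrArg (fun T : EM →L[ℝ] EM => T v) (mfderiv_comp (I' := 𝓘(ℝ, EM)) x
    (ψ.contMDiff.mdifferentiableAt (x := φ x) (by simp))
    (φ.contMDiff.mdifferentiableAt (x := x) (by simp)))

namespace PrincipalBundle

variable {Q : PrincipalBundle EM M EG G EP P}
  {c : LinearMap.BilinForm ℝ (GroupLieAlgebra 𝓘(ℝ, EG) G)}

theorem fib_pullForm (ν : BundleAut (EM := EM) (fun x => Q.adP x) Q.SmoothAd) (a : Q.AdForm) (x : M)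
    (v : TangentSpace 𝓘(ℝ, EM) x) :
    ν.fib x (pullForm ν a x v) = a (ν.base x) (dEquiv ν.base x v) :=
  (ν.fib x).apply_symm_apply _

/-- The composition law of the transformations `f_ν(B, a)`. -/
theorem diagE_shearE_comp (hs : c.IsSymm)
    (ν ν' : BundleAut (EM := EM) (fun x => Q.adP x) Q.SmoothAd)
    (hp : ∀ x (r t : Q.adP x),
      Q.pairing c (ν'.base x) (ν'.fib x r) (ν'.fib x t) = Q.pairing c x r t)
    (B B' : VForm EM M 2 ℝ) (a a' : Q.AdForm) :
    (diagE ν ∘ shearE c B a) ∘ (diagE ν' ∘ shearE c B' a') =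
      diagE (ν * ν') ∘ shearE c (VForm.pullback ν'.base B + B' + wedge c (pullForm ν' a) a')
        (pullForm ν' a + a') := by
  funext ⟨x, e⟩
  obtain ⟨e₁, he₁⟩ : ∃ e₁ : Q.EFib (ν'.base x), e₁ = (diagE ν' (shearE c B' a' ⟨x, e⟩)).2 :=
    ⟨_, rfl⟩
  obtain ⟨e₂, he₂⟩ : ∃ e₂ : Q.EFib (ν.base (ν'.base x)),
    e₂ = (diagE ν (shearE c B a ⟨ν'.base x, e₁⟩)).2 := ⟨_, rfl⟩
  obtain ⟨h1, h2, h3⟩ := eq_diagE_shearE.1 he₁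
  obtain ⟨k1, k2, k3⟩ := eq_diagE_shearE.1 he₂
  suffices key : e₂ = (diagE (ν * ν') (shearE c (VForm.pullback ν'.base B + B'
      + wedge c (pullForm ν' a) a') (pullForm ν' a + a') ⟨x, e⟩)).2 by
    subst he₁
    subst he₂
    exact congrArg (Sigma.mk (ν.base (ν'.base x))) key
  refine (eq_diagE_shearE (ν := ν * ν') (x := x)).2 ⟨?_, ?_, fun w => ?_⟩
  · exact (dEquiv_trans ν'.base ν.base x e.1).trans ((congrArg _ h1).trans k1)
  · refine k2.trans (congrArg (ν.fib (ν'.base x)) ?_)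
    rw [h2, ← h1, ← fib_pullForm]
    refine (map_add (ν'.fib x) _ _).symm.trans (congrArg (ν'.fib x) ?_)
    exact (add_assoc _ _ _).symm
  · have q1 := dEquiv_trans ν'.base ν.base x w
    have q2 := k3 (dEquiv ν'.base x w)
    rw [h3, h2, ← h1, ← fib_pullForm, ← fib_pullForm, hp, hp] at q2
    refine Eq.trans (congrArg _ q1) (q2.trans ?_)
    have q3 : (VForm.pullback ν'.base B + B' + wedge c (pullForm ν' a) a') x ![e.1, w] =
      B (ν'.base x) ![dEquiv ν'.base x e.1, dEquiv ν'.base x w] + B' x ![e.1, w]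
      + (Q.pairing c x (pullForm ν' a x e.1) (a' x w)
        - Q.pairing c x (pullForm ν' a x w) (a' x e.1)) := by
      refine congrArg (fun t => t + B' x ![e.1, w]
        + (Q.pairing c x (pullForm ν' a x e.1) (a' x w)
          - Q.pairing c x (pullForm ν' a x w) (a' x e.1))) ?_
      refine congrArg (B (ν'.base x)) (funext fun i => ?_)
      fin_cases i <;> rfl
    have q4 : ∀ v, (pullForm ν' a + a') x v = pullForm ν' a x v + a' x v := fun _ => rfl
    -- With α = ν'⁻¹·a, composing yields the cross term `-2c(α(w), a'(X))`, while `-c(α + a', α +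
    -- a')` yields `-c(α(X), a'(w)) - c(a'(X), α(w))`. The two-form `c(α ∧ a')` is exactly the
    -- difference.
    have q5 := pairing_symm c hs x (a' x e.1) (pullForm ν' a x w)
    rw [q3, q4, q4]
    simp only [map_add, LinearMap.add_apply]
    rw [q5]
    ring

end PrincipalBundle
end Composition

/-! ### Sufficiency: `f_ν(B, a)` as an automorphism of `E`. -/

noncomputable section ShearAutomorphism

variable {EM M EG G EP P : Type*}
  [NormedAddCommGroup EM] [NormedSpace ℝ EM] [FiniteDimensional ℝ EM]
  [TopologicalSpace M] [T2Space M] [ChartedSpace EM M] [IsManifold 𝓘(ℝ, EM) ∞ M]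
  [NormedAddCommGroup EG] [NormedSpace ℝ EG] [FiniteDimensional ℝ EG]
  [TopologicalSpace G] [ChartedSpace EG G] [Group G] [LieGroup 𝓘(ℝ, EG) ∞ G]
  [NormedAddCommGroup EP] [NormedSpace ℝ EP] [FiniteDimensional ℝ EP]
  [TopologicalSpace P] [ChartedSpace EP P] [IsManifold 𝓘(ℝ, EP) ∞ P]

theorem VForm.apply_add_left (B : VForm EM M 2 ℝ) (x : M) (u u' v : TangentSpace 𝓘(ℝ, EM) x) :
    B x ![u + u', v] = B x ![u, v] + B x ![u', v] := by
  rw [B.apply_swap, B.apply_swap x u, B.apply_swap x u']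
  have := (contract (B x).toAlternatingMap v).map_add u u'
  exact (congrArg Neg.neg this).trans (neg_add _ _)

theorem VForm.apply_smul_left (B : VForm EM M 2 ℝ) (x : M) (k : ℝ)
    (u v : TangentSpace 𝓘(ℝ, EM) x) : B x ![k • u, v] = k * B x ![u, v] := by
  rw [B.apply_swap, B.apply_swap x u]
  have := (contract (B x).toAlternatingMap v).map_smul k u
  exact (congrArg Neg.neg this).trans (mul_neg _ _).symm

theorem VForm.Smooth.apply_two {B : VForm EM M 2 ℝ} (hB : B.Smooth) {X Y : VecField EM M}
    (hX : X.Smooth) (hY : Y.Smooth) : ContMDiff 𝓘(ℝ, EM) 𝓘(ℝ, ℝ) ∞ (fun x => B x ![X x, Y x]) := by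
  refine (hB ![X, Y] (fun i => by fin_cases i <;> assumption)).congr fun x => ?_
  refine congrArg (B x) (funext fun i => ?_)
  fin_cases i <;> rfl

namespace PrincipalBundle

variable {Q : PrincipalBundle EM M EG G EP P}
  {c : LinearMap.BilinForm ℝ (GroupLieAlgebra 𝓘(ℝ, EG) G)}
  {θ : Q.Connection} {H : VForm EM M 3 ℝ}
  {ν : BundleAut (EM := EM) (fun x => Q.adP x) Q.SmoothAd} {B : VForm EM M 2 ℝ} {a : Q.AdForm}

/-- The forward direction reads off the three components. Backwards, the triangular system is solved
in order: the tangent component, then the component in `ad P` after subtracting `a(X)`, then the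
covector. -/
theorem ShearRelated.smooth_iff (hc : ∀ (g : G) A B, c (Ad g A) (Ad g B) = c A B) (hB : B.Smooth)
    (ha : Q.SmoothForm a) {e e' : ∀ x, Q.EFib x} (h : ShearRelated c ν B a e e') :
    Q.SmoothE e ↔ Q.SmoothE e' := by
  have pull_ad : ν.pull (fun y => (e' y).2.1) = fun x => a x (e x).1 + (e x).2.1 :=
    ν.pull_eq_of_related h.ad
  constructor
  · intro he
    refine ⟨?_, ?_, fun W hW => ?_⟩
    · obtain ⟨X', hX', hr⟩ := he.1.exists_related ν.base
      have e1 : X' = fun y => (e' y).1 := by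
        funext y
        obtain ⟨x, rfl⟩ := ν.base.surjective y
        exact (hr x).symm.trans (h.tangent x)
      rwa [← e1]
    · refine ν.smooth_pull.1 ?_
      rw [pull_ad]
      exact (ha _ he.1).add he.2.1
    · have hW' := hW.mpullback ν.base
      have h1 : ContMDiff 𝓘(ℝ, EM) 𝓘(ℝ, ℝ) ∞ (fun x => (e x).2.2 (mpullback 𝓘(ℝ, EM) 𝓘(ℝ, EM) ν.base W x)
          + B x ![(e x).1, mpullback 𝓘(ℝ, EM) 𝓘(ℝ, EM) ν.base W x]
          - Q.pairing c x (a x (e x).1) (a x (mpullback 𝓘(ℝ, EM) 𝓘(ℝ, EM) ν.base W x))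
          - 2 * Q.pairing c x (a x (mpullback 𝓘(ℝ, EM) 𝓘(ℝ, EM) ν.base W x)) (e x).2.1) :=
        (((he.2.2 _ hW').add (hB.apply_two he.1 hW')).sub
        (contMDiff_pairing c hc (ha _ he.1) (ha _ hW'))).sub
        ((contMDiff_const (c := (2 : ℝ))).mul (contMDiff_pairing c hc (ha _ hW') he.2.1))
      set g : M → ℝ := fun x => (e x).2.2 (mpullback 𝓘(ℝ, EM) 𝓘(ℝ, EM) ν.base W x)
          + B x ![(e x).1, mpullback 𝓘(ℝ, EM) 𝓘(ℝ, EM) ν.base W x]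
          - Q.pairing c x (a x (e x).1) (a x (mpullback 𝓘(ℝ, EM) 𝓘(ℝ, EM) ν.base W x))
          - 2 * Q.pairing c x (a x (mpullback 𝓘(ℝ, EM) 𝓘(ℝ, EM) ν.base W x)) (e x).2.1
      refine (h1.comp ν.base.symm.contMDiff).congr fun y => ?_
      obtain ⟨x, rfl⟩ := ν.base.surjective y
      refine Eq.trans ?_ (congrArg g (ν.base.symm_apply_apply x).symm)
      refine (congrArg (e' (ν.base x)).2.2 (dEquiv_mpullback ν.base W x).symm).trans ?_
      exact h.cotangent x _
  · intro he
    have hX : VecField.Smooth (fun x => (e x).1) := by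
      rw [← mpullback_eq_of_related ν.base (X := fun x => (e x).1) (X' := fun x => (e' x).1) h.tangent]
      exact he.1.mpullback ν.base
    have hr : Q.SmoothAd (fun x => (e x).2.1) := by
      have h1 := ν.smooth_pull.2 he.2.1
      rw [pull_ad] at h1
      have h2 := SmoothAd.sub h1 (ha _ hX)
      simpa only [add_sub_cancel_left] using h2
    refine ⟨hX, hr, fun W hW => ?_⟩
    obtain ⟨W', hW', hWW⟩ := hW.exists_related ν.base
    have h1 := ((he.2.2 W' hW').comp ν.base.contMDiff).sub ((hB.apply_two hX hW).sub
      (contMDiff_pairing c hc (ha _ hX) (ha _ hW)) |>.sub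
        ((contMDiff_const (c := (2 : ℝ))).mul (contMDiff_pairing c hc (ha _ hW) hr)))
    refine h1.congr fun x => ?_
    have h2 := h.cotangent x (W x)
    rw [hWW x] at h2
    refine Eq.trans ?_ (congrArg (fun t : ℝ => t - (B x ![(e x).1, W x]
      - Q.pairing c x (a x (e x).1) (a x (W x)) - 2 * Q.pairing c x (a x (W x)) (e x).2.1)) h2.symm)
    ring

variable (c ν B a) in
/-- The map `f_ν(B, a)` on the fibre over `x`. -/
def shearFun (x : M) (e : Q.EFib x) : Q.EFib (ν.base x) := (diagE ν (shearE c B a ⟨x, e⟩)).2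

theorem shearFun_spec (x : M) (e : Q.EFib x) : dEquiv ν.base x e.1 = (shearFun c ν B a x e).1 ∧
    (shearFun c ν B a x e).2.1 = ν.fib x (a x e.1 + e.2.1) ∧
    ∀ w, (shearFun c ν B a x e).2.2 (dEquiv ν.base x w) = e.2.2 w + B x ![e.1, w]
      - Q.pairing c x (a x e.1) (a x w) - 2 * Q.pairing c x (a x w) e.2.1 :=
  eq_diagE_shearE.1 rfl

variable (c ν B a) in
/-- The linear map `f_ν(B, a)` on the fibre over `x`. -/
def shearMap (x : M) : Q.EFib x →ₗ[ℝ] Q.EFib (ν.base x) where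
  toFun := shearFun c ν B a x
  map_add' e e' := by
    obtain ⟨h1, h2, h3⟩ := shearFun_spec (c := c) (ν := ν) (B := B) (a := a) x e
    obtain ⟨k1, k2, k3⟩ := shearFun_spec (c := c) (ν := ν) (B := B) (a := a) x e'
    refine (eq_diagE_shearE.2 ⟨?_, ?_, fun w => ?_⟩).symm
    · exact (map_add (dEquiv ν.base x) e.1 e'.1).trans (congrArg₂ (· + ·) h1 k1)
    · refine (congrArg₂ (· + ·) h2 k2).trans ((map_add (ν.fib x) _ _).symm.trans
        (congrArg (ν.fib x) ?_))
      refine Eq.trans ?_ (congrArg (· + (e.2.1 + e'.2.1)) (map_add (a x) e.1 e'.1).symm)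
      exact add_add_add_comm _ _ _ _
    · refine (congrArg₂ (fun p q : ℝ => p + q) (h3 w) (k3 w)).trans ?_
      have q1 := B.apply_add_left x e.1 e'.1 w
      have q2 : Q.pairing c x (a x (e + e').1) (a x w) =
          Q.pairing c x (a x e.1) (a x w) + Q.pairing c x (a x e'.1) (a x w) := by
        refine (congrArg (fun t => Q.pairing c x t (a x w)) (map_add (a x) e.1 e'.1)).trans ?_
        rw [map_add]; rfl
      have q3 : Q.pairing c x (a x w) (e + e').2.1 =
          Q.pairing c x (a x w) e.2.1 + Q.pairing c x (a x w) e'.2.1 := map_add _ _ _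
      have q4 : (e + e').2.2 w = e.2.2 w + e'.2.2 w := rfl
      have q5 : B x ![(e + e').1, w] = _ := q1
      rw [q2, q3, q4, q5]
      ring
  map_smul' k e := by
    obtain ⟨h1, h2, h3⟩ := shearFun_spec (c := c) (ν := ν) (B := B) (a := a) x e
    refine (eq_diagE_shearE.2 ⟨?_, ?_, fun w => ?_⟩).symm
    · exact (map_smul (dEquiv ν.base x) k e.1).trans (congrArg (k • ·) h1)
    · refine (congrArg (k • ·) h2).trans ((map_smul (ν.fib x) _ _).symm.trans
        (congrArg (ν.fib x) ?_))
      refine Eq.trans ?_ (congrArg (· + k • e.2.1) (map_smul (a x) k e.1).symm)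
      exact smul_add _ _ _
    · refine (congrArg (fun p : ℝ => k * p) (h3 w)).trans ?_
      have q1 : B x ![(k • e).1, w] = _ := B.apply_smul_left x k e.1 w
      have q2 : Q.pairing c x (a x (k • e).1) (a x w) = k * Q.pairing c x (a x e.1) (a x w) := by
        refine (congrArg (fun t => Q.pairing c x t (a x w)) (map_smul (a x) k e.1)).trans ?_
        rw [map_smul]; rfl
      have q3 : Q.pairing c x (a x w) (k • e).2.1 = k * Q.pairing c x (a x w) e.2.1 :=
        map_smul _ _ _
      have q4 : (k • e).2.2 w = k * e.2.2 w := rfl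
      rw [q1, q2, q3, q4]
      ring

theorem shearMap_bijective (x : M) : Function.Bijective (shearMap c ν B a x) := by
  constructor
  · intro e e' h
    obtain ⟨h1, h2, h3⟩ := shearFun_spec (c := c) (ν := ν) (B := B) (a := a) x e
    obtain ⟨k1, k2, k3⟩ := shearFun_spec (c := c) (ν := ν) (B := B) (a := a) x e'
    have i1 : e.1 = e'.1 := (dEquiv ν.base x).injective
      (h1.trans ((congrArg (fun t => t.1) h).trans k1.symm))
    have i2 : e.2.1 = e'.2.1 := by
      have := (ν.fib x).injective (h2.symm.trans ((congrArg (fun t => t.2.1) h).trans k2))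
      rw [i1] at this
      exact add_left_cancel this
    refine Prod.ext i1 (Prod.ext i2 (ContinuousLinearMap.ext fun w => ?_))
    have := (h3 w).symm.trans ((congrArg (fun t => t.2.2 (dEquiv ν.base x w)) h).trans (k3 w))
    rw [i1, i2] at this
    linarith
  · intro e'
    obtain ⟨v, hv⟩ := (dEquiv ν.base x).surjective e'.1
    obtain ⟨r, hr⟩ := (ν.fib x).surjective e'.2.1
    -- The covector that solves the last equation once the tangent vector `v` and the component `r -
    -- a(v)` are known.
    let ξ : TangentSpace 𝓘(ℝ, EM) x →L[ℝ] ℝ :=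
      e'.2.2.comp (dEquiv ν.base x).toContinuousLinearMap - LinearMap.toContinuousLinearMap
        (contract (B x).toAlternatingMap v - Q.pairing c x (a x v) ∘ₗ a x
          - (2 : ℝ) • ((Q.pairing c x).flip (r - a x v) ∘ₗ a x))
    have hξ : ∀ w, ξ w = e'.2.2 (dEquiv ν.base x w) - (B x ![v, w]
      - Q.pairing c x (a x v) (a x w) - 2 * Q.pairing c x (a x w) (r - a x v)) := fun w => rfl
    refine ⟨(v, r - a x v, ξ), (eq_diagE_shearE.2 ⟨hv, ?_, fun w => ?_⟩).symm⟩
    · rw [add_sub_cancel, hr]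
    · rw [hξ]
      ring

/-- The automorphism `f_ν(B, a)` of the vector bundle `E`. -/
def shearAut (hc : ∀ (g : G) A B, c (Ad g A) (Ad g B) = c A B)
    (ν : BundleAut (EM := EM) (fun x => Q.adP x) Q.SmoothAd) (hB : B.Smooth)
    (ha : Q.SmoothForm a) : BundleAut (EM := EM) Q.EFib Q.SmoothE where
  base := ν.base
  fib x := LinearEquiv.ofBijective (shearMap c ν B a x) (shearMap_bijective x)
  smooth s := by
    refine ShearRelated.smooth_iff (c := c) (ν := ν) (B := B) (a := a) hc hB ha
      (shearRelated_iff.2 fun x => ?_)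
    exact ((LinearEquiv.ofBijective (shearMap c ν B a x)
      (shearMap_bijective x)).apply_symm_apply _).symm

theorem shearAut_total (hc : ∀ (g : G) A B, c (Ad g A) (Ad g B) = c A B) (hB : B.Smooth)
    (ha : Q.SmoothForm a) : (shearAut hc ν hB ha).total = diagE ν ∘ shearE c B a := rfl

theorem shearRelated_shearAut_push (hc : ∀ (g : G) A B, c (Ad g A) (Ad g B) = c A B)
    (hB : B.Smooth) (ha : Q.SmoothForm a) (e : ∀ x, Q.EFib x) :
    ShearRelated c ν B a e ((shearAut hc ν hB ha).push e) :=
  shearRelated_iff.2 fun x => (shearAut hc ν hB ha).push_base e x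

/-- The transformation law of `H` annihilates the defect of `dorfman_cotangent_related`. The
cotangent clause is pointwise in `w`, so it suffices to extend `w` to a pair of related fields. -/
theorem ShearRelated.dorfman (hs : c.IsSymm) (hc : ∀ (g : G) A B, c (Ad g A) (Ad g B) = c A B)
    (hν : ν ∈ Q.AutAd c) (hB : B.Smooth) (ha : Q.SmoothForm a) (hD : θ.PreservesDeriv ν a)
    (hF : θ.PreservesCurv ν a) (hH : θ.TransformsH c H ν.base B a)
    {e e' e₂ e₂' : ∀ x, Q.EFib x} (he : Q.SmoothE e) (he' : Q.SmoothE e') (he₂ : Q.SmoothE e₂)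
    (he₂' : Q.SmoothE e₂') (h : ShearRelated c ν B a e e₂) (h' : ShearRelated c ν B a e' e₂') :
    ShearRelated c ν B a (dorfman c θ H e e') (dorfman c θ H e₂ e₂') where
  tangent := mlieBracket_related (X := fun x => (e x).1) (X' := fun x => (e₂ x).1)
    (Y := fun x => (e' x).1) (Y' := fun x => (e₂' x).1) he₂.1 he₂'.1 h.1 h'.1
  ad := dorfman_ad_related hν.2 ha hD hF he he' he₂ he₂' h h'
  cotangent x w := by
    obtain ⟨Z, Z', hZ, hZ', hZZ, rfl⟩ := exists_related_eq ν.base x w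
    rw [hZZ, dorfman_cotangent_related hs hc hν.1 hB ha hD hF he he' he₂ he₂' h h' hZ hZ' hZZ x,
      hH _ _ Z he.1 he'.1 hZ x, sub_self, add_zero]

theorem shearAut_mem (hs : c.IsSymm) (hc : ∀ (g : G) A B, c (Ad g A) (Ad g B) = c A B)
    (hν : ν ∈ Q.AutAd c) (hB : B.Smooth) (ha : Q.SmoothForm a) (hD : θ.PreservesDeriv ν a)
    (hF : θ.PreservesCurv ν a) (hH : θ.TransformsH c H ν.base B a) :
    shearAut hc ν hB ha ∈ AutE c θ H := by
  refine ⟨fun x e e' => ?_, fun e e' he he' => ?_⟩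
  · obtain ⟨h1, h2, h3⟩ := shearFun_spec (c := c) (ν := ν) (B := B) (a := a) x e
    obtain ⟨k1, k2, k3⟩ := shearFun_spec (c := c) (ν := ν) (B := B) (a := a) x e'
    have q1 := h3 e'.1
    have q2 := k3 e.1
    have q3 := hν.1 x (a x e.1 + e.2.1) (a x e'.1 + e'.2.1)
    have q4 : Q.pairing c x (a x e.1 + e.2.1) (a x e'.1 + e'.2.1) =
        Q.pairing c x (a x e.1) (a x e'.1) + Q.pairing c x (a x e.1) e'.2.1
        + Q.pairing c x e.2.1 (a x e'.1) + Q.pairing c x e.2.1 e'.2.1 := by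
      simp only [map_add, LinearMap.add_apply]
      ring
    have q5 := pairing_symm c hs x e.2.1 (a x e'.1)
    have q6 := pairing_symm c hs x (a x e.1) (a x e'.1)
    have q7 := B.apply_swap x e.1 e'.1
    rw [← h2, ← k2] at q3
    rw [k1] at q1
    rw [h1] at q2
    show Q.pairE c (ν.base x) (shearFun c ν B a x e) (shearFun c ν B a x e') = _
    rw [pairE, pairE, q1, q2, q3, q4]
    -- In the symmetrised pairing `B` drops out by antisymmetry, `-c(a, a)` cancels the pairing of
    -- the two shifts by `a`, and `-2c(a, ·)` cancels the mixed terms.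
    linarith
  · funext y
    obtain ⟨x, rfl⟩ := ν.base.surjective y
    have h := shearRelated_shearAut_push (c := c) (ν := ν) (B := B) (a := a) hc hB ha e
    have h' := shearRelated_shearAut_push (c := c) (ν := ν) (B := B) (a := a) hc hB ha e'
    have he₂ := (shearAut hc ν hB ha).smooth_push.2 he
    have he₂' := (shearAut hc ν hB ha).smooth_push.2 he'
    refine ((shearAut hc ν hB ha).push_base (dorfman c θ H e e') x).trans ?_
    exact (shearRelated_iff.1 (h.dorfman hs hc hν hB ha hD hF hH he he' he₂ he₂' h') x).symm

end PrincipalBundle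
end ShearAutomorphism

end TransitiveCourant

theorem mainTheorem9 {EM M EG G EP P : Type*}
    [NormedAddCommGroup EM] [NormedSpace ℝ EM] [FiniteDimensional ℝ EM]
    [TopologicalSpace M] [T2Space M] [ChartedSpace EM M] [IsManifold 𝓘(ℝ, EM) ∞ M]
    [NormedAddCommGroup EG] [NormedSpace ℝ EG] [FiniteDimensional ℝ EG]
    [TopologicalSpace G] [ChartedSpace EG G] [Group G] [LieGroup 𝓘(ℝ, EG) ∞ G]
    [NormedAddCommGroup EP] [NormedSpace ℝ EP] [FiniteDimensional ℝ EP]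
    [TopologicalSpace P] [ChartedSpace EP P] [IsManifold 𝓘(ℝ, EP) ∞ P]
    (Q : PrincipalBundle EM M EG G EP P)
    (c : LinearMap.BilinForm ℝ (GroupLieAlgebra 𝓘(ℝ, EG) G))
    (c_symm : c.IsSymm) (c_nondeg : c.Nondegenerate)
    (c_inv : ∀ (g : G) A B, c (Ad g A) (Ad g B) = c A B)
    (θ : Q.Connection) (H : VForm EM M 3 ℝ) (H_smooth : H.Smooth) (bianchi : θ.Bianchi c H) :
    BundleAut.total '' (PrincipalBundle.AutE c θ H : Set (BundleAut (EM := EM) Q.EFib Q.SmoothE)) =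
      {T | ∃ ν ∈ Q.AutAd c, ∃ (B : VForm EM M 2 ℝ) (a : Q.AdForm), B.Smooth ∧ Q.SmoothForm a ∧
        θ.PreservesDeriv ν a ∧ θ.PreservesCurv ν a ∧ θ.TransformsH c H ν.base B a ∧
        T = PrincipalBundle.diagE ν ∘ PrincipalBundle.shearE c B a} ∧
    ∀ f ∈ PrincipalBundle.AutE c θ H, ∀ f' ∈ PrincipalBundle.AutE c θ H,
      ∀ ν ∈ Q.AutAd c, ∀ ν' ∈ Q.AutAd c, ∀ (B B' : VForm EM M 2 ℝ) (a a' : Q.AdForm),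
        B.Smooth → B'.Smooth → Q.SmoothForm a → Q.SmoothForm a' →
        f.total = PrincipalBundle.diagE ν ∘ PrincipalBundle.shearE c B a →
        f'.total = PrincipalBundle.diagE ν' ∘ PrincipalBundle.shearE c B' a' →
        (f * f').total = PrincipalBundle.diagE (ν * ν') ∘ PrincipalBundle.shearE c
          (VForm.pullback ν'.base B + B'
            + PrincipalBundle.wedge c (PrincipalBundle.pullForm ν' a) a')
          (PrincipalBundle.pullForm ν' a + a') := by 
  refine ⟨Set.Subset.antisymm ?_ ?_, ?_⟩
  · rintro _ ⟨f, hf, rfl⟩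
    exact ⟨PrincipalBundle.autAd c_symm c_inv hf, PrincipalBundle.autAd_mem c_symm c_inv hf,
      PrincipalBundle.autTwoForm c_symm c_inv hf, PrincipalBundle.autForm c_symm c_inv hf,
      PrincipalBundle.autTwoForm_smooth c_symm c_inv hf,
      PrincipalBundle.autForm_smooth c_symm c_inv hf,
      PrincipalBundle.aut_preservesDeriv c_symm c_inv hf,
      PrincipalBundle.aut_preservesCurv c_symm c_inv hf,
      PrincipalBundle.aut_transformsH c_symm c_inv hf,
      funext fun p => congrArg (Sigma.mk (f.base p.1))
        (PrincipalBundle.aut_eq c_symm c_inv hf p.1 p.2)⟩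
  · rintro _ ⟨ν, hν, B, a, hB, ha, hD, hF, hH, rfl⟩
    exact ⟨PrincipalBundle.shearAut c_inv ν hB ha,
      PrincipalBundle.shearAut_mem c_symm c_inv hν hB ha hD hF hH,
      PrincipalBundle.shearAut_total c_inv hB ha⟩
  · intro f _ f' _ ν _ ν' hν' B B' a a' _ _ _ _ h h'
    rw [BundleAut.total_mul, h, h']
    exact PrincipalBundle.diagE_shearE_comp c_symm ν ν' hν'.1 B B' a a'
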